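/- Let $k$ be a field of characteristic $0$ and let $X$ be a normal variety over $k$ (an integral, normal, separated scheme of finite type over $k$) of dimension $n$. Let $K_X=\operatorname{div}(\omega)$ be the canonical divisor of a nonzero rational $n$-form $\omega$ on $X$, and let $r\ge 1$ be an integer such that $rK_X$ is Cartier. Consider the natural map \[ (\wedge^n\Omega_X)^{\otimes r}\to\mathcal O_X(rK_X),\qquad \alpha_1\otimes\dots\otimes\alpha_r\mapsto \frac{\alpha_1}{\omega}\cdots\frac{\alpha_r}{\omega}, \] where $\mathcal O_X(rK_X)$ is the sheaf of rational functions $f$ with $f=0$ or $\operatorname{div}(f)+rK_X\ge 0$. Let $\mathfrak n_{r,X}\subset\mathcal O_X$ (the Nash ideal of level $r$) be the largest ideal sheaf whose product with $\mathcal O_X(rK_X)$ is contained in the image of this map. Let $\pi\colon\mathrm{Gr}(\Omega_X,n)\to X$ be the Grassmannian bundle of locally free quotients of rank $n$ of $\Omega_X$ (the $X$-scheme that represents the functor of such quotients of the pullbacks of $\Omega_X$), and let the Nash blow-up $\nu\colon\widehat X\to X$ be the closure of $\pi^{-1}(X_{\mathrm{reg}})=\mathrm{Gr}(\Omega_{X_{\mathrm{reg}}},n)$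 in $\mathrm{Gr}(\Omega_X,n)$, with the reduced scheme structure and the restriction of $\pi$, where $X_{\mathrm{reg}}$ is the smooth locus of $X$. Then: (1) the product $\mathfrak n_{r,X}\cdot\mathcal O_X(rK_X)$ is equal to the image of $(\wedge^n\Omega_X)^{\otimes r}\to\mathcal O_X(rK_X)$; (2) $\nu\colon\widehat X\to X$ is the blow-up of $X$ along $\mathfrak n_{r,X}$; that is, the ideal sheaf $\mathfrak n_{r,X}\cdot\mathcal O_{\widehat X}$ is invertible, and every morphism $f\colon T\to X$ of schemes such that $\mathfrak n_{r,X}\cdot\mathcal O_T$ is invertible factors uniquely through $\nu$. In particular, $\widehat X$ is isomorphic over $X$ to the blow-up of $\mathfrak n_{r,X}$. -/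

import Mathlib

open CategoryTheory AlgebraicGeometry TensorProduct

universe u

noncomputable section

namespace NashBlowup

/-! ### Algebra: differentials and top forms -/

section Algebra

/-- The `A`-linear map `A ⊗_R Ω_{R/k} → A ⊗_S Ω_{S/k}`, `a ⊗ df ↦ a ⊗ df`, for `k → R → S → A`. -/
def differentialsRes (k R S A : Type u) [CommRing k] [CommRing R] [CommRing S] [CommRing A]
    [Algebra k R] [Algebra k S] [Algebra R S] [IsScalarTower k R S]
    [Algebra R A] [Algebra S A] [IsScalarTower R S A] :
    A ⊗[R] Ω[R⁄k] →ₗ[A] A ⊗[S] Ω[S⁄k] :=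
  (KaehlerDifferential.mapBaseChange k R S).baseChange A ∘ₗ
    (TensorProduct.AlgebraTensorModule.cancelBaseChange R S A A (Ω[R⁄k])).symm.toLinearMap

/-- The natural map `⋀ⁿ_R Ω_{R/k} → ⋀ⁿ_K Ω_{K/k}`, for `k → R → K`. -/
def formMap (k R K : Type u) [CommRing k] [CommRing R] [CommRing K]
    [Algebra k R] [Algebra k K] [Algebra R K] [IsScalarTower k R K] (n : ℕ) :
    ⋀[R]^n Ω[R⁄k] →ₗ[R] ⋀[K]^n Ω[K⁄k] :=
  exteriorPower.alternatingMapLinearEquiv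
    { ((exteriorPower.ιMulti K n (M := Ω[K⁄k])).toMultilinearMap.restrictScalars R).compLinearMap
        (fun _ => KaehlerDifferential.map k k R K) with
      map_eq_zero_of_eq' := fun v i j h hij =>
        (exteriorPower.ιMulti K n (M := Ω[K⁄k])).map_eq_zero_of_eq
          (fun l => KaehlerDifferential.map k k R K (v l)) (by simp only [h]) hij }

theorem formMap_ιMulti (k R K : Type u) [CommRing k] [CommRing R] [CommRing K]
    [Algebra k R] [Algebra k K] [Algebra R K] [IsScalarTower k R K] (n : ℕ)
    (v : Fin n → Ω[R⁄k]) :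
    formMap k R K n (exteriorPower.ιMulti R n v) =
      exteriorPower.ιMulti K n (fun i => KaehlerDifferential.map k k R K (v i)) := by
  simp only [formMap, exteriorPower.alternatingMapLinearEquiv_apply_ιMulti]
  rfl

theorem differentialsRes_tmul_D (k R S A : Type u) [CommRing k] [CommRing R] [CommRing S]
    [CommRing A] [Algebra k R] [Algebra k S] [Algebra R S] [IsScalarTower k R S]
    [Algebra R A] [Algebra S A] [IsScalarTower R S A] (a : A) (f : R) :
    differentialsRes k R S A (a ⊗ₜ KaehlerDifferential.D k R f) =
      a ⊗ₜ KaehlerDifferential.D k S (algebraMap R S f) := by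
  simp [differentialsRes]

end Algebra

/-! ### Schemes over a field -/

section Scheme

variable (k : Type u) [Field k] (X : Scheme.{u}) [X.Over (Spec (.of k))]

/-- The ring of sections over an open subset of a `k`-scheme is a `k`-algebra. -/
instance sectionAlgebra (U : X.Opens) : Algebra k Γ(X, U) :=
  ((Scheme.ΓSpecIso (.of k)).inv ≫ (X ↘ Spec (.of k)).appTop ≫
    X.presheaf.map (homOfLE (le_top : U ≤ ⊤)).op).hom.toAlgebra

/-- The stalks of a `k`-scheme are `k`-algebras. -/
instance stalkAlgebra (x : X) : Algebra k (X.presheaf.stalk x) :=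
  ((Scheme.ΓSpecIso (.of k)).inv ≫ (X ↘ Spec (.of k)).appTop ≫
    X.presheaf.germ ⊤ x trivial).hom.toAlgebra

theorem isScalarTower_res {U V : X.Opens} (h : V ≤ U) :
    letI : Algebra Γ(X, U) Γ(X, V) := (X.presheaf.map (homOfLE h).op).hom.toAlgebra
    IsScalarTower k Γ(X, U) Γ(X, V) := by
  let : Algebra Γ(X, U) Γ(X, V) := (X.presheaf.map (homOfLE h).op).hom.toAlgebra
  have key : (X.presheaf.map (homOfLE (le_top : V ≤ ⊤)).op) =
      X.presheaf.map (homOfLE (le_top : U ≤ ⊤)).op ≫ X.presheaf.map (homOfLE h).op := by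
    rw [← X.presheaf.map_comp]; rfl
  refine IsScalarTower.of_algebraMap_eq fun c => ?_
  exact ConcreteCategory.congr_hom key
    ((X ↘ Spec (.of k)).appTop.hom ((Scheme.ΓSpecIso (.of k)).inv.hom c))

instance isScalarTower_section [IsIntegral X] (U : X.Opens) [Nonempty U] :
    IsScalarTower k Γ(X, U) X.functionField := by
  have key : X.presheaf.germ ⊤ (genericPoint X) trivial =
      X.presheaf.map (homOfLE (le_top : U ≤ ⊤)).op ≫ X.germToFunctionField U :=
    (X.presheaf.germ_res _ _ _).symm
  refine IsScalarTower.of_algebraMap_eq fun c => ?_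
  exact ConcreteCategory.congr_hom key
    ((X ↘ Spec (.of k)).appTop.hom ((Scheme.ΓSpecIso (.of k)).inv.hom c))

instance isScalarTower_stalk [IsIntegral X] (x : X) :
    IsScalarTower k (X.presheaf.stalk x) X.functionField := by
  have key : X.presheaf.germ ⊤ (genericPoint X) trivial =
      X.presheaf.germ ⊤ x trivial ≫
        X.presheaf.stalkSpecializes ((genericPoint_spec X).specializes trivial) :=
    (X.presheaf.germ_stalkSpecializes _ _).symm
  refine IsScalarTower.of_algebraMap_eq fun c => ?_
  exact ConcreteCategory.congr_hom key
    ((X ↘ Spec (.of k)).appTop.hom ((Scheme.ΓSpecIso (.of k)).inv.hom c))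

end Scheme

/-! ### Divisors, the sheaf `𝒪_X(rK_X)` and the Nash ideal -/

section Divisors

variable (k : Type u) [Field k] {X : Scheme.{u}} [X.Over (Spec (.of k))] [IsIntegral X]
  [LocallyOfFiniteType (X ↘ Spec (.of k))]

/-- The order of vanishing of a rational function at a point of codimension one
(`0` at the other points, and `0` for the zero function). -/
def ord (f : X.functionField) (x : X) : ℤ :=
  haveI : IsLocallyNoetherian X := LocallyOfFiniteType.isLocallyNoetherian (X ↘ Spec (.of k))
  X.ord f x

open Classical in
/-- The canonical divisor `K_X = div ω` of a rational top form `ω ≠ 0`. At a point `x` of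
codimension one, the regular top forms are the free `𝒪_{X,x}`-module of rank one
`𝒪_{X,x} · η` which is the image of `⋀ⁿ Ω_{X,x}`; if `ω = f η`, the multiplicity is `ord_x f`.
(A Weil divisor is given by its multiplicities, `0` at points not of codimension one.) -/
def canonicalDivisor (n : ℕ) (ω : ⋀[X.functionField]^n Ω[X.functionField⁄k]) (x : X) : ℤ :=
  if h : ∃ f : X.functionField, f ≠ 0 ∧
      Submodule.span (X.presheaf.stalk x) {f⁻¹ • ω} =
        LinearMap.range (formMap k (X.presheaf.stalk x) X.functionField n)
  then ord k h.choose x else 0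

/-- A Weil divisor is Cartier if it is locally principal. -/
def IsCartier (D : X → ℤ) : Prop :=
  ∀ x : X, ∃ U : X.Opens, x ∈ U ∧ ∃ h : X.functionField, h ≠ 0 ∧
    ∀ y ∈ U, Order.coheight y = 1 → D y = ord k h y

/-- The sections over `U` of the sheaf `𝒪_X(D)`, for `X` normal: the rational functions `f` with
`f = 0` or `div f + D ≥ 0` on `U`. -/
def divisorialSections (D : X → ℤ) (U : X.Opens) [Nonempty U] :
    Submodule Γ(X, U) X.functionField :=
  Submodule.span Γ(X, U)
    {f | f = 0 ∨ ∀ y ∈ U, Order.coheight y = 1 → 0 ≤ ord k f y + D y}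

/-- The image of `(⋀ⁿ Ω_X)^{⊗ r} → 𝒪_X(rK_X)` over an affine open `U`, where `K_X = div ω`:
a section `α₁ ⊗ ⋯ ⊗ αᵣ` is mapped to `c₁ ⋯ cᵣ`, where `αᵢ = cᵢ ω` as rational top forms. -/
def formsImage (n r : ℕ) (ω : ⋀[X.functionField]^n Ω[X.functionField⁄k])
    (U : X.Opens) [Nonempty U] : Submodule Γ(X, U) X.functionField :=
  Submodule.span Γ(X, U)
    {f | ∃ (α : Fin r → ⋀[Γ(X, U)]^n Ω[Γ(X, U)⁄k]) (c : Fin r → X.functionField),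
      (∀ i, formMap k Γ(X, U) X.functionField n (α i) = c i • ω) ∧ f = ∏ i, c i}

/-- The Nash ideal of level `r`: the largest ideal sheaf whose product with `𝒪_X(rK_X)` is
contained in the image of `(⋀ⁿ Ω_X)^{⊗ r} → 𝒪_X(rK_X)`. (If `rK_X` is Cartier, it is the unique
ideal sheaf whose product with `𝒪_X(rK_X)` is equal to the image.) -/
def nashIdeal (n r : ℕ) (ω : ⋀[X.functionField]^n Ω[X.functionField⁄k]) : X.IdealSheafData :=
  sSup {I | ∀ (U : X.affineOpens) [Nonempty U.1],
    I.ideal U • divisorialSections k (r • canonicalDivisor k n ω) U.1 ≤ formsImage k n r ω U.1}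

end Divisors

/-! ### The Grassmannian bundle and the Nash blow-up -/

section Nash

variable (k : Type u) [Field k] (X : Scheme.{u}) [X.Over (Spec (.of k))]

/-- A Grassmannian bundle `π : Gr(Ω_X, n) → X`: an `X`-scheme that represents the functor of
locally free quotients of rank `n` of the pullbacks of `Ω_X`. It suffices to test on affine
`X`-schemes `Spec A → X` which factor through an affine open `U` of `X`; the `X`-morphisms
`Spec A → Gr(Ω_X, n)` are then in bijection with the `A`-submodules of `A ⊗ Ω_U` with locally
free quotient of rank `n`, naturally in `A` and compatibly with the inclusions `V ≤ U`. -/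
structure GrassmannianBundle (n : ℕ) where
  /-- the total space -/
  space : Scheme.{u}
  /-- the projection -/
  π : space ⟶ X
  /-- the bijection between morphisms and quotients -/
  points (U : X.affineOpens) (A : Type u) [CommRing A] [Algebra Γ(X, U) A] :
    {g : Spec (.of A) ⟶ space //
      g ≫ π = Spec.map (CommRingCat.ofHom (algebraMap Γ(X, U) A)) ≫ U.2.fromSpec} ≃
    Module.Grassmannian A (A ⊗[Γ(X, U)] Ω[Γ(X, U)⁄k]) n
  points_map (U : X.affineOpens) (A B : Type u) [CommRing A] [CommRing B]
    [Algebra Γ(X, U) A] [Algebra Γ(X, U) B] (φ : A →ₐ[Γ(X, U)] B)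
    (a : {g : Spec (.of A) ⟶ space //
      g ≫ π = Spec.map (CommRingCat.ofHom (algebraMap Γ(X, U) A)) ≫ U.2.fromSpec})
    (b : {g : Spec (.of B) ⟶ space //
      g ≫ π = Spec.map (CommRingCat.ofHom (algebraMap Γ(X, U) B)) ≫ U.2.fromSpec})
    (h : b.1 = Spec.map (CommRingCat.ofHom φ.toRingHom) ≫ a.1) :
    points U B b = Module.Grassmannian.map φ (points U A a)
  points_res (U V : X.affineOpens) (hVU : V.1 ≤ U.1) (A : Type u) [CommRing A]
    [Algebra Γ(X, U) A] [Algebra Γ(X, V) A]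
    (hA : algebraMap Γ(X, U) A =
      (algebraMap Γ(X, V) A).comp (X.presheaf.map (homOfLE hVU).op).hom)
    (a : {g : Spec (.of A) ⟶ space //
      g ≫ π = Spec.map (CommRingCat.ofHom (algebraMap Γ(X, U) A)) ≫ U.2.fromSpec})
    (b : {g : Spec (.of A) ⟶ space //
      g ≫ π = Spec.map (CommRingCat.ofHom (algebraMap Γ(X, V) A)) ≫ V.2.fromSpec})
    (h : a.1 = b.1) :
    letI : Algebra Γ(X, U) Γ(X, V) := (X.presheaf.map (homOfLE hVU).op).hom.toAlgebra
    haveI : IsScalarTower k Γ(X, U) Γ(X, V) := isScalarTower_res k X hVU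
    haveI : IsScalarTower Γ(X, U) Γ(X, V) A := IsScalarTower.of_algebraMap_eq' hA
    (points U A a).toSubmodule =
      (points V A b).toSubmodule.comap (differentialsRes k Γ(X, U) Γ(X, V) A)

variable {k X} [LocallyOfFiniteType (X ↘ Spec (.of k))] {n : ℕ}

/-- The closure in `Gr(Ω_X, n)` of its restriction `Gr(Ω_{X_reg}, n)` to the smooth locus. -/
def GrassmannianBundle.closureRegular (G : GrassmannianBundle k X n) :
    TopologicalSpace.Closeds G.space :=
  ⟨closure (G.π ⁻¹' ((X ↘ Spec (.of k)).smoothLocus : Set X)), isClosed_closure⟩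

/-- The Nash blow-up of `X`: the closure of `Gr(Ω_{X_reg}, n)` in `Gr(Ω_X, n)`, as a reduced
closed subscheme. -/
def nashBlowup (G : GrassmannianBundle k X n) : Scheme.{u} :=
  (Scheme.IdealSheafData.vanishingIdeal G.closureRegular).subscheme

/-- The projection of the Nash blow-up to `X`. -/
def nashBlowupMap (G : GrassmannianBundle k X n) : nashBlowup G ⟶ X :=
  (Scheme.IdealSheafData.vanishingIdeal G.closureRegular).subschemeι ≫ G.π

end Nash

/-! ### Blow-ups -/

/-- An ideal sheaf is invertible if it is locally generated by one nonzerodivisor. -/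
def IsInvertibleIdeal {Y : Scheme.{u}} (J : Y.IdealSheafData) : Prop :=
  ∀ y : Y, ∃ V : Y.affineOpens, y ∈ V.1 ∧ ∃ a ∈ nonZeroDivisors Γ(Y, V), J.ideal V = Ideal.span {a}

/-- `b : B → X` is the blow-up of the ideal sheaf `I`: the inverse image ideal sheaf `I · 𝒪_B` is
invertible, and `b` is universal with this property. -/
structure IsBlowUp {X B : Scheme.{u}} (I : X.IdealSheafData) (b : B ⟶ X) : Prop where
  invertible : IsInvertibleIdeal (I.comap b)
  existsUnique_lift {T : Scheme.{u}} (f : T ⟶ X) (hf : IsInvertibleIdeal (I.comap f)) :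
    ∃! g : T ⟶ B, g ≫ b = f

end NashBlowup

end

noncomputable section

namespace NashBlowup

/-! ### Krull's description of integrally closed noetherian domains -/

/-! Write `K` for the function field. In characteristic 0, `Ω[K⁄k]` has dimension at most `n`, so a
nonzero `ω` forces dimension `n`, and `v₁ ∧ ⋯ ∧ vₙ = δ(v) ω` for a nonzero alternating form `δ`. The
image of the `r`-fold tensor power of top forms is thus spanned by products of `r` values of `δ`
(`minorPower`). On an open set where `rK_X` has equation `h`, normality gives `𝒪(rK_X) = h⁻¹𝒪`. The
conductor of `𝒪(rK_X)` into the image is then generated by the functions `h ∏ⱼ δ(vⱼ)`. It commutes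
with localisation, so it is an ideal sheaf; it is therefore the Nash ideal, and its product with
`𝒪(rK_X)` is the whole image (`nashIdeal_ideal`, `conductorIdeal_smul_divisorialSections`).

These generators are products of `r` Plücker coordinates, up to one common factor, which links them
to rank `n` quotients of `Ω` in both directions. If a generator `p` becomes a nonzerodivisor
dividing all the others, Cramer's rule gives functionals `qᵢ` with `qᵢ(eⱼ) = p` for `i = j` and `0`
otherwise. Division by `p` produces a free quotient of rank `n`
(`nonempty_grassmannian_of_generator`). Conversely, over a local domain containing the coordinate
ring `R`, a locally free quotient of rank `n` has a basis coming from elements `e` of `Ω`. Every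
`δ(v)` is then `δ(e)` times a determinant, so the generator built from `e` alone divides all the
others (`exists_generator_of_grassmannian`).

The Nash blow-up is integral and dominates `X`, so the converse direction makes the ideal principal
in its local rings, hence invertible. For the universal property, let `T → X` make the ideal
invertible. Locally on `T` one generator `p` generates the pulled back ideal, and `T → X` factors
through the spectrum of the affine blow-up algebra `R[I/p]`. This is a domain containing `R`, so the
first direction gives it a point of the Grassmannian bundle, which lies in the closure of the part
over the smooth locus. Uniqueness is checked on stalks: over a domain containing `R` there is at
most one quotient (`grassmannian_subsingleton`), and maps out of `R[I/p]` are unique once `p` is a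
nonzerodivisor. -/

theorem mem_range_of_forall_height_eq_one {R K : Type*} [CommRing R] [IsDomain R]
    [IsNoetherianRing R] [IsIntegrallyClosed R] [Field K] [Algebra R K] [IsFractionRing R K]
    (x : K) (h : ∀ (p : Ideal R), p.IsPrime → p.height = 1 →
      ∃ s ∉ p, ∃ a : R, algebraMap R K s * x = algebraMap R K a) :
    x ∈ (algebraMap R K).range := by
  by_contra hx
  let L : Submodule R K := LinearMap.range (Algebra.linearMap R K)
  have hL : ∀ z : K, z ∈ L ↔ ∃ a : R, algebraMap R K a = z := fun z => Iff.rfl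
  have hx0 : L.mkQ x ≠ 0 := by
    simpa [L] using hx
  -- The denominator ideal of `x` lies in an associated prime `p` of `K / R`, the exact denominator
  -- ideal of some `y`. The aim is that `p` has height one, where the hypothesis supplies a
  -- denominator of `x` outside `p`.
  obtain ⟨p, hp, hle⟩ := exists_le_isAssociatedPrime_of_isNoetherianRing R (L.mkQ x) hx0
  rw [isAssociatedPrime_iff] at hp
  obtain ⟨hprime, y', hy'⟩ := hp
  obtain ⟨y, rfl⟩ := L.mkQ_surjective y'
  have hmem : ∀ s : R, s ∈ p ↔ ∃ a : R, algebraMap R K a = algebraMap R K s * y := by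
    intro s
    rw [hy', Submodule.mem_colon_singleton, ← map_smul, Submodule.mem_bot, Submodule.mkQ_apply,
      Submodule.Quotient.mk_eq_zero, hL, Algebra.smul_def]
  have hmemx : ∀ s : R, (∃ a : R, algebraMap R K a = algebraMap R K s * x) → s ∈ p := by
    intro s hs
    apply hle
    rw [Submodule.mem_colon_singleton, ← map_smul, Submodule.mem_bot, Submodule.mkQ_apply,
      Submodule.Quotient.mk_eq_zero, hL, Algebra.smul_def]
    exact hs
  have hpbot : p ≠ ⊥ := by
    obtain ⟨a, s, hs, hyas⟩ := IsFractionRing.div_surjective (A := R) y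
    intro hbot
    have : s ∈ p := (hmem s).2 ⟨a, by
      rw [← hyas, mul_div_cancel₀]
      exact IsFractionRing.to_map_ne_zero_of_mem_nonZeroDivisors hs⟩
    rw [hbot, Ideal.mem_bot] at this
    exact nonZeroDivisors.ne_zero hs this
  have hy : ¬ ∃ a : R, algebraMap R K a = y := by
    intro ⟨a, ha⟩
    exact hprime.ne_top ((Ideal.eq_top_iff_one p).2 ((hmem 1).2 ⟨a, by simpa using ha⟩))
  -- If `p y ⊆ p`, then `y` is integral over `R` by the determinant trick, hence in `R`, which is
  -- excluded. So `a y` is a unit at `p` for some `a ∈ p`.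
  have key : ∃ a ∈ p, ∃ u ∉ p, algebraMap R K u = algebraMap R K a * y := by
    by_contra hcon
    push Not at hcon
    apply hy
    rw [← IsIntegrallyClosed.isIntegral_iff (R := R)]
    let N : Submodule R K := Submodule.map (Algebra.linearMap R K) p
    have hN : N ≠ ⊥ := by
      intro hb
      refine hpbot (Submodule.map_injective_of_injective (f := Algebra.linearMap R K)
        (IsFractionRing.injective R K) ?_)
      rw [Submodule.map_bot]
      exact hb
    refine isIntegral_of_smul_mem_submodule (M := K) N hN ?_ y ?_
    · exact (IsNoetherian.noetherian p).map _
    · rintro _ ⟨b, hb, rfl⟩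
      obtain ⟨c, hc⟩ := (hmem b).1 hb
      refine ⟨c, ?_, ?_⟩
      · by_contra hcp
        exact hcon b hb c hcp hc
      · simp only [Algebra.linearMap_apply, smul_eq_mul]
        rw [hc, mul_comm]
  obtain ⟨a, ha, w, hw, hwa⟩ := key
  -- Locally at `p` the ideal `p` is generated by `a`: every `b ∈ p` satisfies `b w = (b y) a` with
  -- `w ∉ p`. Krull's principal ideal theorem then bounds the height.
  have hmin : p ∈ (Ideal.span {a}).minimalPrimes := by
    refine ⟨⟨hprime, by simpa [Ideal.span_le] using ha⟩, ?_⟩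
    rintro q ⟨hq, haq⟩ hqp b hb
    obtain ⟨c, hc⟩ := (hmem b).1 hb
    have hbw : b * w = c * a := by
      apply IsFractionRing.injective R K
      rw [map_mul, map_mul, hwa, hc]; ring
    have : b * w ∈ q := by
      rw [hbw]
      exact q.mul_mem_left _ (haq (Ideal.mem_span_singleton_self a))
    exact (hq.mem_or_mem this).resolve_right fun hwq => hw (hqp hwq)
  have hle1 : p.height ≤ 1 := Ideal.height_le_one_of_isPrincipal_of_mem_minimalPrimes _ p hmin
  have hne : p.height ≠ 0 := by
    rwa [Ne, Ideal.height_eq_zero_iff_eq_bot]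
  have hone : p.height = 1 := le_antisymm hle1 (Order.one_le_iff_ne_zero.mpr hne)
  obtain ⟨s, hs, b, hb⟩ := h p hprime hone
  exact hs (hmemx s ⟨b, hb.symm⟩)

theorem mem_range_of_one_le_ordFrac {R K : Type*} [CommRing R] [IsDomain R]
    [IsDiscreteValuationRing R] [Field K] [Algebra R K] [IsFractionRing R K] {x : K}
    (hx : 1 ≤ Ring.ordFrac R x) : x ∈ (algebraMap R K).range := by
  rw [Ring.ordFrac_eq_valuation_inv] at hx
  have hx0 : (IsDiscreteValuationRing.maximalIdeal R).valuation K x ≤ 1 := by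
    by_contra! hcon
    have := inv_lt_one_of_one_lt₀ hcon
    exact absurd hx (not_le.mpr this)
  obtain ⟨a, ha⟩ := IsDiscreteValuationRing.exists_lift_of_le_one hx0
  exact ⟨a, ha⟩

/-! ### The dimension of the space of differentials of a function field -/

/-- Lying over lifts the first prime of a chain, and going up lifts the rest. -/
theorem ringKrullDim_le_of_injective_of_isIntegral {R S : Type*} [CommRing R] [CommRing S]
    [Algebra R S] [Algebra.IsIntegral R S] (h : Function.Injective (algebraMap R S)) :
    ringKrullDim R ≤ ringKrullDim S := by
  refine iSup_le fun l => ?_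
  have hker : RingHom.ker (algebraMap R S) ≤ l.head.asIdeal := by
    rw [(RingHom.injective_iff_ker_eq_bot _).1 h]; exact bot_le
  obtain ⟨P, -, hP, hPl⟩ := Ideal.exists_ideal_over_prime_of_isIntegral l.head.asIdeal (⊥ : Ideal S)
    hker
  have : P.LiesOver l.head.asIdeal := ⟨hPl.symm⟩
  obtain ⟨L, hL, -, -⟩ := Ideal.exists_ltSeries_of_hasGoingUp l P
  rw [← hL]
  exact le_iSup_of_le L le_rfl

/-- By Noether normalisation `R` is finite over a polynomial ring `P` in `s` variables. In
characteristic 0 the extension `K / Frac P` is separable, so the `s` differentials of the variables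
span `Ω[K⁄k]`, while `s ≤ dim R`. The upper bound is enough, since a nonzero top form gives the
other inequality. -/
theorem natCast_finrank_differentials_le_ringKrullDim (k R K : Type u) [Field k] [CharZero k]
    [CommRing R] [IsDomain R] [Field K] [Algebra k R] [Algebra k K] [Algebra R K]
    [IsScalarTower k R K] [IsFractionRing R K] [Algebra.FiniteType k R] :
    Module.Finite K Ω[K⁄k] ∧ (Module.finrank K Ω[K⁄k] : WithBot ℕ∞) ≤ ringKrullDim R := by
  obtain ⟨s, g, hinj, hfin⟩ := exists_finite_inj_algHom_of_fg k R
  let P := MvPolynomial (Fin s) k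
  let : Algebra P R := g.toRingHom.toAlgebra
  have : IsScalarTower k P R := IsScalarTower.of_algebraMap_eq' g.comp_algebraMap.symm
  let : Algebra P K := ((algebraMap R K).comp g.toRingHom).toAlgebra
  have : IsScalarTower P R K := IsScalarTower.of_algebraMap_eq' rfl
  have : IsScalarTower k P K := IsScalarTower.of_algebraMap_eq fun x => by
    rw [IsScalarTower.algebraMap_apply P R K, ← IsScalarTower.algebraMap_apply k P R,
      ← IsScalarTower.algebraMap_apply k R K]
  have : Module.Finite P R := hfin
  have hPR : Function.Injective (algebraMap P R) := hinj
  have hPK : Function.Injective (algebraMap P K) :=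
    (IsFractionRing.injective R K).comp hinj
  have : FaithfulSMul P K := (faithfulSMul_iff_algebraMap_injective P K).2 hPK
  let L := FractionRing P
  let : Algebra L K := FractionRing.liftAlgebra P K
  have : IsScalarTower P L K := FractionRing.isScalarTower_liftAlgebra P K
  have : CharZero L := charZero_of_injective_algebraMap
    (R := k)
    (by rw [IsScalarTower.algebraMap_eq k P L]
        exact (IsFractionRing.injective P L).comp (MvPolynomial.C_injective (Fin s) k))
  have : Algebra.IsAlgebraic P K := by
    have : Algebra.IsAlgebraic R K :=
      IsLocalization.isAlgebraic (R := R) (S := K) (M := nonZeroDivisors R)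
    have : FaithfulSMul P R := (faithfulSMul_iff_algebraMap_injective P R).2 hPR
    exact Algebra.IsAlgebraic.trans P R K
  have : Algebra.IsAlgebraic L K :=
    IsFractionRing.comap_isAlgebraic_iff.mp ‹Algebra.IsAlgebraic P K›
  have : Algebra.FormallyUnramified L K := Algebra.FormallyUnramified.of_isSeparable L K
  have : Algebra.FormallyUnramified P L :=
    Algebra.FormallyUnramified.of_isLocalization (nonZeroDivisors P)
  have : Algebra.FormallyUnramified P K := Algebra.FormallyUnramified.comp P L K
  have hsurj : Function.Surjective (KaehlerDifferential.mapBaseChange k P K) := fun y =>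
    (KaehlerDifferential.exact_mapBaseChange_map k P K y).1 (Subsingleton.elim _ _)
  have : Module.Finite P Ω[P⁄k] :=
    Module.Finite.of_basis (KaehlerDifferential.mvPolynomialBasis k _)
  have hfinK : Module.Finite K Ω[K⁄k] := Module.Finite.of_surjective _ hsurj
  refine ⟨hfinK, ?_⟩
  have h1 : Module.finrank K Ω[K⁄k] ≤ s := by
    refine (LinearMap.finrank_le_finrank_of_surjective hsurj).trans ?_
    rw [Module.finrank_eq_card_basis
      ((KaehlerDifferential.mvPolynomialBasis k (Fin s)).baseChange K)]
    simp
  have h2 : (s : WithBot ℕ∞) ≤ ringKrullDim P := by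
    have := ringKrullDim_add_natCard_le_ringKrullDim_mvPolynomial (R := k) (Fin s)
    rw [ringKrullDim_eq_zero_of_field] at this
    rwa [zero_add, Nat.card_fin] at this
  have h3 : ringKrullDim P ≤ ringKrullDim R := ringKrullDim_le_of_injective_of_isIntegral hPR
  exact (by exact_mod_cast h1 : (Module.finrank K Ω[K⁄k] : WithBot ℕ∞) ≤ s).trans (h2.trans h3)

/-! ### Points of the Grassmannian over a domain -/

section Grassmannian

/-- The map `B ⊗ M → L ⊗ M` induced by `B → L`. -/
def tensorRes (R B L M : Type u) [CommRing R] [CommRing B] [CommRing L] [Algebra R B] [Algebra R L]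
    [Algebra B L] [IsScalarTower R B L] [AddCommGroup M] [Module R M] :
    B ⊗[R] M →ₗ[B] L ⊗[R] M :=
  AlgebraTensorModule.map (Algebra.linearMap B L) LinearMap.id

variable {R B L M : Type u} [CommRing R] [CommRing B] [Algebra R B] [AddCommGroup M] [Module R M]
  {n : ℕ}

theorem tensorRes_tmul [CommRing L] [Algebra R L] [Algebra B L] [IsScalarTower R B L]
    (b : B) (m : M) : tensorRes R B L M (b ⊗ₜ m) = algebraMap B L b ⊗ₜ m := rfl

/-- After base change to `L`, the quotient map is a surjection between spaces of dimension `n`,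
hence an isomorphism. A projective quotient embeds in its base change to `L`. So the submodule is
forced to be the torsion, which leaves no choice for it. -/
theorem grassmannian_toSubmodule_eq_ker [Field L] [Algebra R L] [Algebra B L]
    [IsScalarTower R B L] (hBL : Function.Injective (algebraMap B L)) [Module.Finite L (L ⊗[R] M)]
    (hn : Module.finrank L (L ⊗[R] M) = n) (N : Module.Grassmannian B (B ⊗[R] M) n) :
    N.toSubmodule = LinearMap.ker (tensorRes R B L M) := by
  let Q := (B ⊗[R] M) ⧸ N.toSubmodule
  let g : L ⊗[R] M →ₗ[L] L ⊗[B] Q := Module.Grassmannian.baseChangeMkQ L N.toSubmodule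
  have hg : Function.Surjective g := Module.Grassmannian.baseChangeMkQ_surjective N.toSubmodule
  have hrank : Module.finrank L (L ⊗[B] Q) = n := by
    have h1 := Module.rankAtStalk_baseChange (R := B) (S := L) (M := Q) ⟨⊥, Ideal.isPrime_bot⟩
    rw [N.rankAtStalk_eq, Module.rankAtStalk_eq_finrank_of_free] at h1
    simpa using h1
  have hginj : Function.Injective g :=
    (LinearMap.injective_iff_surjective_of_finrank_eq_finrank (hn.trans hrank.symm)).2 hg
  have hcomp : ∀ x, g (tensorRes R B L M x) = 1 ⊗ₜ[B] N.toSubmodule.mkQ x := by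
    intro x
    induction x with
    | zero => simp
    | add x y hx hy => rw [map_add, map_add, hx, hy, map_add, tmul_add]
    | tmul b m =>
      have : b ⊗ₜ[R] m = b • ((1 : B) ⊗ₜ[R] m) := by rw [smul_tmul', smul_eq_mul, mul_one]
      rw [tensorRes_tmul, this, map_smul, tmul_smul]
      simp [g, Module.Grassmannian.baseChangeMkQ, smul_tmul', Algebra.smul_def]
  have hQ : Function.Injective (fun q : Q => (1 : L) ⊗ₜ[B] q) := by
    have h1 := Module.Flat.rTensor_preserves_injective_linearMap (M := Q)
      (Algebra.linearMap B L) hBL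
    have h2 : (fun q : Q => (1 : L) ⊗ₜ[B] q) =
        (LinearMap.rTensor Q (Algebra.linearMap B L)) ∘ (TensorProduct.lid B Q).symm := by
      funext q; simp
    rw [h2]
    exact h1.comp (TensorProduct.lid B Q).symm.injective
  ext x
  rw [LinearMap.mem_ker, ← map_eq_zero_iff g hginj, hcomp, ← Submodule.Quotient.mk_eq_zero,
    ← Submodule.mkQ_apply]
  exact ⟨fun h => by rw [h, tmul_zero], fun h => hQ (by simpa using h)⟩

theorem grassmannian_subsingleton [Field L] [Algebra R L] [Algebra B L]
    [IsScalarTower R B L] (hBL : Function.Injective (algebraMap B L)) [Module.Finite L (L ⊗[R] M)]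
    (hn : Module.finrank L (L ⊗[R] M) = n) : Subsingleton (Module.Grassmannian B (B ⊗[R] M) n) :=
  ⟨fun N N' => Module.Grassmannian.ext <| by
    rw [grassmannian_toSubmodule_eq_ker hBL hn N, grassmannian_toSubmodule_eq_ker hBL hn N']⟩

/-- A surjection onto a free module of rank `n` is a point of the Grassmannian. -/
theorem nonempty_grassmannian_of_surjective [Nontrivial B] (f : B ⊗[R] M →ₗ[B] (Fin n → B))
    (hf : Function.Surjective f) : Nonempty (Module.Grassmannian B (B ⊗[R] M) n) := by
  let e := f.quotKerEquivOfSurjective hf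
  refine ⟨⟨LinearMap.ker f, Module.Finite.equiv e.symm, Module.Projective.of_equiv e.symm,
    fun p => ?_⟩⟩
  rw [Module.rankAtStalk_eq_of_equiv e, Module.rankAtStalk_eq_finrank_of_free]
  simp

/-- The quotients `qᵢ / p` are well defined over `B` because `p` is a nonzerodivisor; they are dual
to the `eⱼ`, so together they form a surjection onto `Bⁿ`. -/
theorem nonempty_grassmannian_of_forms [Nontrivial B] (p : R)
    (hp : algebraMap R B p ∈ nonZeroDivisors B) (e : Fin n → M) (q : Fin n → M →ₗ[R] R)
    (hqe : ∀ i j, q i (e j) = if i = j then p else 0)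
    (hdvd : ∀ i m, algebraMap R B p ∣ algebraMap R B (q i m)) :
    Nonempty (Module.Grassmannian B (B ⊗[R] M) n) := by
  choose c hc using hdvd
  have hcancel : ∀ x y : B, algebraMap R B p * x = algebraMap R B p * y → x = y := fun x y h =>
    (mul_cancel_left_mem_nonZeroDivisors hp).1 h
  let f : M →ₗ[R] (Fin n → B) :=
    { toFun := fun m i => c i m
      map_add' := fun x y => funext fun i => hcancel _ _ <| by
        rw [← hc, Pi.add_apply, mul_add, ← hc, ← hc, map_add, map_add]
      map_smul' := fun a x => funext fun i => hcancel _ _ <| by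
        rw [← hc, RingHom.id_apply, Pi.smul_apply, mul_smul_comm, ← hc, map_smul, smul_eq_mul,
          map_mul, Algebra.smul_def] }
  have hfe : ∀ j, f (e j) = Pi.single j 1 := fun j => funext fun i => hcancel _ _ <| by
    change _ * c i (e j) = _
    rw [← hc, hqe, Pi.single_apply]
    split_ifs <;> simp
  refine nonempty_grassmannian_of_surjective (f.liftBaseChange B) fun y => ?_
  refine ⟨∑ j, y j ⊗ₜ e j, ?_⟩
  rw [map_sum]
  simp only [LinearMap.liftBaseChange_tmul, hfe]
  funext i
  simp [Finset.sum_apply, Pi.single_apply]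

end Grassmannian

/-! ### Products of minors -/

section Minors

variable {R K M V : Type u} [CommRing R] [Field K] [Algebra R K] [IsFractionRing R K]
  [AddCommGroup M] [Module R M] [AddCommGroup V] [Module K V] [Module R V] [IsScalarTower R K V]
  {n r : ℕ}

/-- Since `V` is the base change of `M` to `K` and `K` embeds in `L`, the space `L ⊗ M` is `L ⊗ V`.
-/
theorem finrank_tensor_of_isLocalizedModule (ι : M →ₗ[R] V)
    [IsLocalizedModule (nonZeroDivisors R) ι]
    [Module.Finite K V] (L : Type u) [Field L] [Algebra R L]
    (hL : Function.Injective (algebraMap R L)) :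
    Module.Finite L (L ⊗[R] M) ∧ Module.finrank L (L ⊗[R] M) = Module.finrank K V := by
  have : FaithfulSMul R L := (faithfulSMul_iff_algebraMap_injective R L).2 hL
  let : Algebra K L := (IsFractionRing.lift (K := K) hL).toAlgebra
  have : IsScalarTower R K L := IsScalarTower.of_algebraMap_eq fun x =>
    (IsFractionRing.lift_algebraMap hL x).symm
  have h1 : IsBaseChange K ι := (isLocalizedModule_iff_isBaseChange (nonZeroDivisors R) K ι).1 ‹_›
  let e1 : L ⊗[R] M ≃ₗ[L] L ⊗[K] V := (h1.comp (TensorProduct.isBaseChange K V L)).equiv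
  exact ⟨Module.Finite.equiv e1.symm, by rw [e1.finrank_eq, Module.finrank_baseChange]⟩

/-- Cramer's rule: replacing one entry of one factor of `gen v` by a variable element `m` gives a
linear functional of `m`. Applied to the entries of that factor it returns `gen v` or, by
alternation, `0`. -/
theorem nonempty_grassmannian_of_generator (ι : M →ₗ[R] V)
    (δ : V [⋀^Fin n]→ₗ[K] K) (h : K) (gen : (Fin r → Fin n → M) → R)
    (hgen : ∀ v, algebraMap R K (gen v) = h * ∏ j, δ (ι ∘ v j))
    (hr : 0 < r) {B : Type u} [CommRing B] [Nontrivial B]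
    [Algebra R B] (v : Fin r → Fin n → M) (hp : algebraMap R B (gen v) ∈ nonZeroDivisors B)
    (hdvd : ∀ w, algebraMap R B (gen v) ∣ algebraMap R B (gen w)) :
    Nonempty (Module.Grassmannian B (B ⊗[R] M) n) := by
  classical
  let j₀ : Fin r := ⟨0, hr⟩
  -- Only the factor `j₀` is varied; the other `r - 1` factors stay fixed and act as a common
  -- scalar. This needs `r ≥ 1`.
  let w (i : Fin n) (m : M) : Fin r → Fin n → M :=
    Function.update v j₀ (Function.update (v j₀) i m)
  have hw : ∀ i m, algebraMap R K (gen (w i m)) =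
      h * (δ (Function.update (ι ∘ v j₀) i (ι m)) * ∏ j ∈ Finset.univ.erase j₀, δ (ι ∘ v j)) := by
    intro i m
    rw [hgen, ← Finset.mul_prod_erase Finset.univ _ (Finset.mem_univ j₀)]
    congr 2
    · simp only [w, Function.update_self]
      rw [Function.comp_update]
    · refine Finset.prod_congr rfl fun j hj => ?_
      simp only [w, Function.update_of_ne (Finset.ne_of_mem_erase hj)]
  have hinj := IsFractionRing.injective R K
  let q (i : Fin n) : M →ₗ[R] R :=
    { toFun := fun m => gen (w i m)
      map_add' := fun x y => hinj <| by
        rw [map_add, hw, hw, hw, map_add, AlternatingMap.map_update_add]; ring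
      map_smul' := fun a x => hinj <| by
        rw [smul_eq_mul, map_mul, hw, hw, map_smul, ← algebraMap_smul K a (ι x),
          AlternatingMap.map_update_smul, RingHom.id_apply, smul_eq_mul]; ring }
  refine nonempty_grassmannian_of_forms (gen v) hp (v j₀) q (fun i j => ?_)
    fun i m => hdvd (w i m)
  split_ifs with hij
  · subst hij
    change gen (w i (v j₀ i)) = _
    simp [w]
  · apply hinj
    change algebraMap R K (gen (w i (v j₀ j))) = _
    rw [hw, (δ.map_eq_zero_of_eq _ _ hij), zero_mul, mul_zero, map_zero]
    rw [Function.update_self, Function.update_of_ne (Ne.symm hij), Function.comp_apply]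

/-- A free quotient of rank `n` singles out a tuple `e` whose minor divides all minors, the ratio
being the determinant of coordinates in the quotient. Repeating `e` in all `r` factors gives the
dividing generator. -/
theorem exists_generator_of_grassmannian (ι : M →ₗ[R] V)
    (δ : V [⋀^Fin n]→ₗ[K] K) (h : K) (gen : (Fin r → Fin n → M) → R)
    (hgen : ∀ v, algebraMap R K (gen v) = h * ∏ j, δ (ι ∘ v j))
    [IsLocalizedModule (nonZeroDivisors R) ι]
    [Module.Finite K V] (hV : Module.finrank K V = n) (hδ : δ ≠ 0) (hh : h ≠ 0)
    {B : Type u} [CommRing B] [IsDomain B] [IsLocalRing B] [Algebra R B]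
    (hRB : Function.Injective (algebraMap R B)) (N : Module.Grassmannian B (B ⊗[R] M) n) :
    ∃ v, gen v ≠ 0 ∧ ∀ w, algebraMap R B (gen v) ∣ algebraMap R B (gen w) := by
  classical
  let L := FractionRing B
  have hBL : Function.Injective (algebraMap B L) := IsFractionRing.injective B L
  have hRL : Function.Injective (algebraMap R L) := by
    rw [IsScalarTower.algebraMap_eq R B L]; exact hBL.comp hRB
  let : Algebra K L := (IsFractionRing.lift (K := K) hRL).toAlgebra
  have : IsScalarTower R K L := IsScalarTower.of_algebraMap_eq fun x =>
    (IsFractionRing.lift_algebraMap hRL x).symm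
  obtain ⟨hfin, hrank⟩ := finrank_tensor_of_isLocalizedModule (K := K) ι L hRL
  have hN := grassmannian_toSubmodule_eq_ker hBL (hrank.trans hV) N
  let Q := (B ⊗[R] M) ⧸ N.toSubmodule
  have : Module.FinitePresentation B Q := Module.finitePresentation_of_projective B Q
  -- Over a local ring a basis of the free quotient can be extracted from any spanning family, here
  -- from the images of `1 ⊗ m`.
  obtain ⟨κ, a, b, hb⟩ := Module.exists_basis_of_span_of_flat
    (fun m : M => N.toSubmodule.mkQ ((1 : B) ⊗ₜ[R] m)) (by
      rw [eq_top_iff]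
      rintro x -
      obtain ⟨x, rfl⟩ := N.toSubmodule.mkQ_surjective x
      induction x with
      | zero => simp
      | add x y hx hy => rw [map_add]; exact add_mem hx hy
      | tmul c m =>
        have : c ⊗ₜ[R] m = c • ((1 : B) ⊗ₜ[R] m) := by rw [smul_tmul', smul_eq_mul, mul_one]
        rw [this, map_smul]
        exact Submodule.smul_mem _ _ (Submodule.subset_span ⟨m, rfl⟩))
  have : Module.Free B Q := Module.Free.of_basis b
  have hQn : Module.finrank B Q = n := by
    have h1 := N.rankAtStalk_eq (IsLocalRing.closedPoint B)
    rwa [Module.rankAtStalk_eq_finrank_of_free] at h1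
  have : Fintype κ := @Fintype.ofFinite κ (Module.Finite.finite_basis b)
  have hκ : Fintype.card κ = n := (Module.finrank_eq_card_basis b).symm.trans hQn
  let σ : Fin n ≃ κ := (Fintype.equivFinOfCardEq hκ).symm
  let e : Fin n → M := fun i => a (σ i)
  let c (m : M) (i : Fin n) : B := b.repr (N.toSubmodule.mkQ ((1 : B) ⊗ₜ[R] m)) (σ i)
  -- The relation expressing `m` in the basis holds modulo `N`; as `N` is the kernel of the map to
  -- `L ⊗ M`, it becomes an identity there.
  have hc : ∀ m, ∑ i, c m i • ((1 : L) ⊗ₜ[R] e i) = (1 : L) ⊗ₜ[R] m := by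
    intro m
    have hmem : ∑ i, c m i • ((1 : B) ⊗ₜ[R] e i) - (1 : B) ⊗ₜ[R] m ∈ N.toSubmodule := by
      rw [← Submodule.Quotient.mk_eq_zero, ← Submodule.mkQ_apply, map_sub, sub_eq_zero, map_sum]
      conv_rhs => rw [← b.sum_repr (N.toSubmodule.mkQ ((1 : B) ⊗ₜ[R] m))]
      rw [← σ.sum_comp]
      refine Finset.sum_congr rfl fun i _ => ?_
      rw [map_smul, hb]
    rw [hN, LinearMap.mem_ker, map_sub, sub_eq_zero, map_sum] at hmem
    simpa [tensorRes_tmul] using hmem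
  let bV : Module.Basis (Fin n) K V := Module.finBasisOfFinrankEq K V hV
  let coord : M →ₗ[R] (Fin n → L) :=
    { toFun := fun m i => algebraMap K L (bV.repr (ι m) i)
      map_add' := fun x y => by ext i; simp
      map_smul' := fun s x => by
        ext i
        simp only [map_smul, RingHom.id_apply, Pi.smul_apply]
        rw [← algebraMap_smul K s (ι x), map_smul, Finsupp.smul_apply, smul_eq_mul, map_mul,
          ← IsScalarTower.algebraMap_apply, Algebra.smul_def] }
  have hcoord : ∀ m i, algebraMap K L (bV.repr (ι m) i) =
      ∑ j, algebraMap K L (bV.repr (ι (e j)) i) * algebraMap B L (c m j) := by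
    intro m i
    have h1 := congrFun (congrArg (coord.liftBaseChange L) (hc m)) i
    rw [map_sum, Finset.sum_apply] at h1
    simp only [← algebraMap_smul L (c m _), map_smul, LinearMap.liftBaseChange_tmul, one_smul,
      Pi.smul_apply, smul_eq_mul] at h1
    rw [show algebraMap K L (bV.repr (ι m) i) = coord m i from rfl, ← one_mul (coord m i), ← h1]
    exact (Finset.sum_congr rfl fun j _ => mul_comm _ _)
  -- The coordinate matrix of `v` is that of `e` times the matrix `c` with entries in `B`;
  -- determinants are multiplicative.
  have hdet : ∀ v : Fin n → M, ∃ d : B,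
      algebraMap K L (δ (ι ∘ v)) = algebraMap K L (δ (ι ∘ e)) * algebraMap B L d := by
    intro v
    refine ⟨Matrix.det (Matrix.of fun j l => c (v l) j), ?_⟩
    rw [δ.eq_smul_basis_det bV]
    simp only [AlternatingMap.smul_apply, smul_eq_mul, map_mul, mul_assoc]
    congr 1
    rw [Module.Basis.det_apply, Module.Basis.det_apply, RingHom.map_det, RingHom.map_det,
      RingHom.map_det, ← Matrix.det_mul]
    congr 1
    ext i l
    simp only [RingHom.mapMatrix_apply, Matrix.map_apply, Module.Basis.toMatrix_apply,
      Matrix.mul_apply, Function.comp_apply, Matrix.of_apply]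
    exact hcoord (v l) i
  -- Otherwise `δ` vanishes on all tuples from `M`; up to denominators these include a basis of `V`,
  -- so `δ` would be zero.
  have hδe : δ (ι ∘ e) ≠ 0 := by
    have : Nontrivial R := (algebraMap R K).domain_nontrivial
    have hsurj := fun i => IsLocalizedModule.surj (nonZeroDivisors R) ι (bV i)
    choose y hy using hsurj
    intro h0
    obtain ⟨d, hd⟩ := hdet fun i => (y i).1
    rw [h0, map_zero, zero_mul, map_eq_zero] at hd
    have h1 : (ι ∘ fun i => (y i).1) = fun i => algebraMap R K (y i).2 • bV i := by
      funext i
      rw [Function.comp_apply, ← hy, algebraMap_smul]; rfl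
    rw [h1, AlternatingMap.map_smul_univ, smul_eq_zero, Finset.prod_eq_zero_iff] at hd
    rcases hd with ⟨i, -, hi⟩ | hd
    · exact IsFractionRing.to_map_ne_zero_of_mem_nonZeroDivisors (y i).2.2 hi
    · apply hδ
      rw [δ.eq_smul_basis_det bV, hd, zero_smul]
  refine ⟨fun _ => e, ?_, fun w => ?_⟩
  · intro h0
    have h1 := hgen fun _ => e
    rw [h0, map_zero] at h1
    exact mul_ne_zero hh (Finset.prod_ne_zero_iff.2 fun _ _ => hδe) h1.symm
  · choose d hd using hdet
    refine ⟨∏ j, d (w j), hBL ?_⟩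
    rw [map_mul, ← IsScalarTower.algebraMap_apply R B L, ← IsScalarTower.algebraMap_apply R B L,
      IsScalarTower.algebraMap_apply R K L, IsScalarTower.algebraMap_apply R K L, hgen, hgen,
      map_mul, map_mul, map_prod, map_prod, map_prod, mul_assoc, ← Finset.prod_mul_distrib]
    exact congrArg _ (Finset.prod_congr rfl fun j _ => hd (w j))

end Minors

/-! ### Affine blow-up algebras -/

section AffineBlowup

variable {R : Type u} [CommRing R] (I : Ideal R) (p : R)

/-- The affine blow-up algebra `R[I/p]`, as a subalgebra of `R_p`. -/
def affineBlowup : Subalgebra R (Localization.Away p) :=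
  Algebra.adjoin R {s | ∃ x ∈ I, algebraMap R (Localization.Away p) p * s =
    algebraMap R (Localization.Away p) x}

variable {I p}

theorem isDomain_affineBlowup [IsDomain R] (hp : p ≠ 0) : IsDomain (affineBlowup I p) :=
  have : IsDomain (Localization.Away p) :=
    IsLocalization.isDomain_localization (powers_le_nonZeroDivisors_of_noZeroDivisors hp)
  inferInstance

theorem algebraMap_affineBlowup_injective [IsDomain R] (hp : p ≠ 0) :
    Function.Injective (algebraMap R (affineBlowup I p)) := by
  have h : Function.Injective (algebraMap R (Localization.Away p)) :=
    IsLocalization.injective _ (powers_le_nonZeroDivisors_of_noZeroDivisors hp)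
  rw [IsScalarTower.algebraMap_eq R (affineBlowup I p) (Localization.Away p)] at h
  rw [RingHom.coe_comp] at h
  exact Function.Injective.of_comp h

theorem dvd_affineBlowup {x : R} (hx : x ∈ I) :
    algebraMap R (affineBlowup I p) p ∣ algebraMap R (affineBlowup I p) x := by
  let s : Localization.Away p := algebraMap R _ x * IsLocalization.Away.invSelf p
  have hs : algebraMap R (Localization.Away p) p * s = algebraMap R (Localization.Away p) x := by
    rw [mul_left_comm, IsLocalization.Away.mul_invSelf, mul_one]
  exact ⟨⟨s, Algebra.subset_adjoin ⟨x, hx, hs⟩⟩, Subtype.ext hs.symm⟩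

variable {A : Type u} [CommRing A] [Algebra R A]

/-- Every element becomes an element of `R` after multiplication by a power of `p`, which can be
cancelled in `A`. -/
theorem affineBlowup_algHom_ext (hp : algebraMap R A p ∈ nonZeroDivisors A)
    (f g : affineBlowup I p →ₐ[R] A) : f = g := by
  ext y
  obtain ⟨N, a, ha⟩ := IsLocalization.Away.surj p (y : Localization.Away p)
  have hy : y * algebraMap R (affineBlowup I p) (p ^ N) = algebraMap R _ a :=
    Subtype.ext (by simpa using ha)
  have hp' : algebraMap R A (p ^ N) ∈ nonZeroDivisors A := by
    rw [map_pow]; exact pow_mem hp N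
  have key : ∀ φ : affineBlowup I p →ₐ[R] A, φ y * algebraMap R A (p ^ N) = algebraMap R A a :=
    fun φ => by rw [← φ.commutes, ← map_mul, hy, φ.commutes]
  exact (mul_cancel_right_mem_nonZeroDivisors hp').1 ((key f).trans (key g).symm)

/-- Since `A` embeds in its localisation at `p`, it suffices that `R_p → A_p` carries the generators
`x / p` into `A`, which is the divisibility hypothesis. -/
theorem exists_affineBlowup_algHom (hp : algebraMap R A p ∈ nonZeroDivisors A)
    (hI : ∀ x ∈ I, algebraMap R A p ∣ algebraMap R A x) : Nonempty (affineBlowup I p →ₐ[R] A) := by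
  let A' := Localization.Away (algebraMap R A p)
  have hinj : Function.Injective (IsScalarTower.toAlgHom R A A') :=
    IsLocalization.injective (M := Submonoid.powers (algebraMap R A p)) A'
      (Submonoid.powers_le.2 hp)
  have hunit : IsUnit (algebraMap R A' p) := by
    rw [IsScalarTower.algebraMap_apply R A A']
    exact IsLocalization.Away.algebraMap_isUnit (algebraMap R A p)
  let φ₀ : Localization.Away p →+* A' := IsLocalization.Away.lift p (g := algebraMap R A') hunit
  let φ : Localization.Away p →ₐ[R] A' :=
    { φ₀ with commutes' := fun x => IsLocalization.Away.lift_eq p hunit x }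
  have hle : affineBlowup I p ≤ (IsScalarTower.toAlgHom R A A').range.comap φ := by
    refine Algebra.adjoin_le ?_
    rintro s ⟨x, hx, hs⟩
    obtain ⟨c, hc⟩ := hI x hx
    refine ⟨c, ?_⟩
    apply hunit.mul_left_cancel
    have h1 := congrArg φ hs
    rw [map_mul, φ.commutes, φ.commutes] at h1
    change algebraMap R A' p * algebraMap A A' c = algebraMap R A' p * φ s
    rw [h1, IsScalarTower.algebraMap_apply R A A', IsScalarTower.algebraMap_apply R A A' x, hc,
      map_mul]
  let e := AlgEquiv.ofInjective _ hinj
  exact ⟨(e.symm : _ →ₐ[R] A).comp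
    ((φ.comp (affineBlowup I p).val).codRestrict (IsScalarTower.toAlgHom R A A').range
      fun y => hle y.2)⟩

end AffineBlowup

/-! ### Coefficients of top forms -/

section Forms

/-- A space of dimension below `n` has no nonzero `n`-th exterior power, so the dimension is `n`,
the exterior power is the line spanned by `ω`, and `δ` is the coordinate on it. -/
theorem exists_coordinate {K V : Type u} [Field K] [AddCommGroup V] [Module K V]
    [Module.Finite K V] {n : ℕ} (hV : Module.finrank K V ≤ n) (ω : ⋀[K]^n V) (hω : ω ≠ 0) :
    Module.finrank K V = n ∧ ∃ δ : V [⋀^Fin n]→ₗ[K] K, δ ≠ 0 ∧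
      ∀ v, exteriorPower.ιMulti K n v = δ v • ω := by
  have hn : Module.finrank K V = n := by
    refine le_antisymm hV (not_lt.1 fun hlt => ?_)
    have h0 := exteriorPower.finrank_eq (R := K) (M := V) (n := n)
    rw [Nat.choose_eq_zero_of_lt hlt] at h0
    have := Module.finrank_zero_iff.1 h0
    exact hω (Subsingleton.elim _ _)
  have h1 : Module.finrank K (⋀[K]^n V) = 1 := by
    rw [exteriorPower.finrank_eq, hn, Nat.choose_self]
  let e : K ≃ₗ[K] ⋀[K]^n V := LinearEquiv.ofBijective (LinearMap.toSpanSingleton K _ ω)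
    ⟨fun x y h => smul_left_injective K hω h, fun y =>
      exists_smul_eq_of_finrank_eq_one h1 hω y⟩
  have he : ∀ v, exteriorPower.ιMulti K n v =
      (e.symm.toLinearMap.compAlternatingMap (exteriorPower.ιMulti K n)) v • ω := fun v =>
    (e.apply_symm_apply (exteriorPower.ιMulti K n v)).symm
  refine ⟨hn, _, fun h0 => hω ?_, he⟩
  have hspan := exteriorPower.ιMulti_span K n V
  have hω' : ω ∈ Submodule.span K (Set.range (exteriorPower.ιMulti K n (M := V))) := by
    rw [hspan]; trivial
  have hz : Set.range (exteriorPower.ιMulti K n (M := V)) ⊆ {0} := by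
    rintro _ ⟨v, rfl⟩
    rw [he, h0, AlternatingMap.zero_apply, zero_smul]; rfl
  simpa using Submodule.span_mono hz hω'

variable {k K : Type u} [Field k] [Field K] [Algebra k K] {n : ℕ}
  (δ : Ω[K⁄k] [⋀^Fin n]→ₗ[K] K) (R S : Type u) [CommRing R] [CommRing S]
  [Algebra k R] [Algebra R K] [IsScalarTower k R K] [Algebra k S] [Algebra S K]
  [IsScalarTower k S K]

/-- The `R`-module of the coefficients of the regular top forms. -/
def minorModule : Submodule R K :=
  Submodule.span R (Set.range fun v : Fin n → Ω[R⁄k] => δ (KaehlerDifferential.map k k R K ∘ v))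

/-- The `R`-module spanned by the products of `r` coefficients of regular top forms. -/
def minorPower (r : ℕ) : Submodule R K :=
  Submodule.span R (Set.range fun v : Fin r → Fin n → Ω[R⁄k] =>
    ∏ j, δ (KaehlerDifferential.map k k R K ∘ v j))

variable {δ R S}

theorem minorModule_pow (r : ℕ) : minorModule δ R ^ r = minorPower δ R r := by
  rw [minorModule, minorPower, Submodule.span_pow]
  congr 1
  ext x
  rw [Set.mem_pow_iff_prod]
  constructor
  · rintro ⟨f, hf, rfl⟩
    choose v hv using hf
    exact ⟨v, Finset.prod_congr rfl fun i _ => hv i⟩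
  · rintro ⟨v, rfl⟩
    exact ⟨_, fun i => ⟨v i, rfl⟩, rfl⟩

/-- This replaces exterior powers by submodules of `K`: the coefficients relative to `ω` of the
regular forms are exactly the module `minorModule`. -/
theorem exists_formMap_eq_iff {ω : ⋀[K]^n Ω[K⁄k]} (hω : ω ≠ 0)
    (hδ : ∀ v, exteriorPower.ιMulti K n v = δ v • ω) (c : K) :
    (∃ α, formMap k R K n α = c • ω) ↔ c ∈ minorModule δ R := by
  constructor
  · rintro ⟨α, hα⟩
    have key : ∀ β, ∃ d ∈ minorModule δ R, formMap k R K n β = d • ω := by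
      intro β
      have hβ : β ∈ Submodule.span R (Set.range (exteriorPower.ιMulti R n (M := Ω[R⁄k]))) := by
        rw [exteriorPower.ιMulti_span]; trivial
      induction hβ using Submodule.span_induction with
      | mem x hx =>
        obtain ⟨v, rfl⟩ := hx
        refine ⟨_, Submodule.subset_span ⟨v, rfl⟩, ?_⟩
        rw [formMap_ιMulti, hδ]; rfl
      | zero => exact ⟨0, zero_mem _, by simp⟩
      | add x y _ _ hx hy =>
        obtain ⟨a, ha, ha'⟩ := hx
        obtain ⟨b, hb, hb'⟩ := hy
        exact ⟨a + b, add_mem ha hb, by rw [map_add, ha', hb', add_smul]⟩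
      | smul s x _ hx =>
        obtain ⟨a, ha, ha'⟩ := hx
        exact ⟨s • a, Submodule.smul_mem _ _ ha, by rw [map_smul, ha', smul_assoc]⟩
    obtain ⟨d, hd, hd'⟩ := key α
    rwa [smul_left_injective K hω (hα.symm.trans hd')]
  · intro hc
    induction hc using Submodule.span_induction with
    | mem x hx =>
      obtain ⟨v, rfl⟩ := hx
      refine ⟨exteriorPower.ιMulti R n v, ?_⟩
      rw [formMap_ιMulti, hδ]; rfl
    | zero => exact ⟨0, by simp⟩
    | add x y _ _ hx hy =>
      obtain ⟨a, ha⟩ := hx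
      obtain ⟨b, hb⟩ := hy
      exact ⟨a + b, by rw [map_add, ha, hb, add_smul]⟩
    | smul s x _ hx =>
      obtain ⟨a, ha⟩ := hx
      exact ⟨s • a, by rw [map_smul, ha, smul_assoc]⟩

theorem range_formMap_eq {ω : ⋀[K]^n Ω[K⁄k]} (hω : ω ≠ 0)
    (hδ : ∀ v, exteriorPower.ιMulti K n v = δ v • ω)
    (h1 : ∀ y : ⋀[K]^n Ω[K⁄k], ∃ c : K, c • ω = y) :
    LinearMap.range (formMap k R K n) =
      (minorModule δ R).map ((LinearMap.toSpanSingleton K _ ω).restrictScalars R) := by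
  ext y
  rw [LinearMap.mem_range, Submodule.mem_map]
  constructor
  · rintro ⟨α, rfl⟩
    obtain ⟨c, hc⟩ := h1 (formMap k R K n α)
    exact ⟨c, (exists_formMap_eq_iff hω hδ c).1 ⟨α, hc.symm⟩, hc⟩
  · rintro ⟨c, hc, rfl⟩
    exact (exists_formMap_eq_iff hω hδ c).2 hc

open Pointwise in
theorem span_formMap_eq_minorPower {ω : ⋀[K]^n Ω[K⁄k]} (hω : ω ≠ 0)
    (hδ : ∀ v, exteriorPower.ιMulti K n v = δ v • ω) (r : ℕ) :
    Submodule.span R {f | ∃ (α : Fin r → ⋀[R]^n Ω[R⁄k]) (c : Fin r → K),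
      (∀ i, formMap k R K n (α i) = c i • ω) ∧ f = ∏ i, c i} = minorPower δ R r := by
  apply le_antisymm
  · rw [Submodule.span_le]
    rintro _ ⟨α, c, hc, rfl⟩
    rw [SetLike.mem_coe, ← minorModule_pow]
    have hci : ∀ i, c i ∈ minorModule δ R := fun i =>
      (exists_formMap_eq_iff hω hδ (c i)).1 ⟨α i, hc i⟩
    have h1 : (∏ i, c i) ∈ ((minorModule δ R : Set K)) ^ r :=
      Set.mem_pow_iff_prod.2 ⟨c, hci, rfl⟩
    exact Submodule.pow_subset_pow _ h1
  · rw [minorPower, Submodule.span_le]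
    rintro _ ⟨v, rfl⟩
    refine Submodule.subset_span ⟨fun j => exteriorPower.ιMulti R n (v j), _, fun j => ?_, rfl⟩
    rw [formMap_ιMulti, hδ]; rfl

variable [Algebra R S] [IsScalarTower k R S] [IsScalarTower R S K]

theorem map_comp_map_differentials (v : Fin n → Ω[R⁄k]) :
    KaehlerDifferential.map k k S K ∘ (KaehlerDifferential.map k k R S ∘ v) =
      KaehlerDifferential.map k k R K ∘ v := by
  funext i
  simp only [Function.comp_apply]
  have hx : ∀ x : Ω[R⁄k], KaehlerDifferential.map k k S K (KaehlerDifferential.map k k R S x) =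
      KaehlerDifferential.map k k R K x := by
    intro x
    have hx' : x ∈ Submodule.span R (Set.range (KaehlerDifferential.D k R)) := by
      rw [KaehlerDifferential.span_range_derivation]; trivial
    induction hx' using Submodule.span_induction with
    | mem x hx =>
      obtain ⟨f, rfl⟩ := hx
      simp only [KaehlerDifferential.map_D, ← IsScalarTower.algebraMap_apply]
    | zero => simp
    | add x y _ _ hx hy => simp only [map_add, hx, hy]
    | smul a x _ hx =>
      rw [(KaehlerDifferential.map k k R K).map_smul, (KaehlerDifferential.map k k R S).map_smul,
        ← hx, ← algebraMap_smul S a (KaehlerDifferential.map k k R S x), map_smul,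
        algebraMap_smul]
  exact hx (v i)

theorem minorPower_le (r : ℕ) {x : K} (hx : x ∈ minorPower δ R r) : x ∈ minorPower δ S r := by
  have h : minorPower δ R r ≤ (minorPower δ S r).restrictScalars R := by
    rw [minorPower, Submodule.span_le]
    rintro _ ⟨v, rfl⟩
    refine Submodule.subset_span ⟨fun j => KaehlerDifferential.map k k R S ∘ v j, ?_⟩
    simp only [map_comp_map_differentials]
  exact h hx

/-- Differentials of a localisation are differentials of `R` up to denominators, and multilinearity
of `δ` collects these into one element of `W`. -/
theorem exists_mul_mem_minorPower (W : Submonoid R) [IsLocalization W S] (r : ℕ) {x : K}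
    (hx : x ∈ minorPower δ S r) : ∃ w ∈ W, algebraMap R K w * x ∈ minorPower δ R r := by
  have hv : ∀ v : Fin n → Ω[S⁄k], ∃ w ∈ W, ∃ u : Fin n → Ω[R⁄k],
      algebraMap R K w * δ (KaehlerDifferential.map k k S K ∘ v) =
        δ (KaehlerDifferential.map k k R K ∘ u) := by
    intro v
    choose y hy using fun i =>
      IsLocalizedModule.surj W (KaehlerDifferential.map k k R S) (v i)
    refine ⟨∏ i, ((y i).2 : R), Submonoid.prod_mem _ fun i _ => (y i).2.2,
      fun i => (y i).1, ?_⟩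
    rw [← map_comp_map_differentials (R := R) (S := S)]
    have h1 : (KaehlerDifferential.map k k S K ∘ KaehlerDifferential.map k k R S ∘
        fun i => (y i).1) = fun i => algebraMap R K (y i).2 •
          (KaehlerDifferential.map k k S K ∘ v) i := by
      funext i
      simp only [Function.comp_apply]
      rw [← hy, Submonoid.smul_def, ← algebraMap_smul S ((y i).2 : R) (v i), map_smul,
        algebraMap_smul, algebraMap_smul]
    rw [h1, AlternatingMap.map_smul_univ, map_prod, smul_eq_mul]
  induction hx using Submodule.span_induction with
  | mem x hx =>
    obtain ⟨v, rfl⟩ := hx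
    choose w hw u hu using fun j => hv (v j)
    refine ⟨∏ j, w j, Submonoid.prod_mem _ fun j _ => hw j, ?_⟩
    rw [map_prod, ← Finset.prod_mul_distrib]
    exact Submodule.subset_span ⟨u, Finset.prod_congr rfl fun j _ => (hu j).symm⟩
  | zero => exact ⟨1, one_mem _, by simp⟩
  | add x y _ _ hx hy =>
    obtain ⟨a, ha, ha'⟩ := hx
    obtain ⟨b, hb, hb'⟩ := hy
    refine ⟨a * b, mul_mem ha hb, ?_⟩
    have : algebraMap R K (a * b) * (x + y) =
        b • (algebraMap R K a * x) + a • (algebraMap R K b * y) := by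
      rw [Algebra.smul_def, Algebra.smul_def, map_mul]; ring
    rw [this]
    exact add_mem (Submodule.smul_mem _ _ ha') (Submodule.smul_mem _ _ hb')
  | smul s x _ hx =>
    obtain ⟨a, ha, ha'⟩ := hx
    obtain ⟨⟨c, d⟩, hcd⟩ := IsLocalization.surj W s
    refine ⟨d * a, mul_mem d.2 ha, ?_⟩
    have : algebraMap R K (d * a) * (s • x) = c • (algebraMap R K a * x) := by
      rw [Algebra.smul_def, Algebra.smul_def, map_mul, IsScalarTower.algebraMap_apply R S K c,
        ← hcd, map_mul, ← IsScalarTower.algebraMap_apply R S K]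
      ring
    rw [this]
    exact Submodule.smul_mem _ _ ha'

end Forms

/-! ### Normal varieties: local structure -/

section Variety

variable (k : Type u) [Field k] {X : Scheme.{u}} [X.Over (Spec (.of k))]
  [LocallyOfFiniteType (X ↘ Spec (.of k))]

theorem finiteType_section (U : X.affineOpens) : Algebra.FiniteType k Γ(X, U) := by
  have h := (X ↘ Spec (.of k)).finiteType_appLE (U := ⊤) (isAffineOpen_top _) U.2 le_top
  have h2 : Function.Bijective (Scheme.ΓSpecIso (.of k)).inv.hom :=
    ConcreteCategory.bijective_of_isIso (Scheme.ΓSpecIso (.of k)).inv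
  have h3 : (algebraMap k Γ(X, U)).FiniteType :=
    h.comp (RingHom.FiniteType.of_surjective _ h2.surjective)
  exact h3

theorem ringKrullDim_section_le (U : X.affineOpens) :
    ringKrullDim Γ(X, U) ≤ topologicalKrullDim X := by
  rw [← PrimeSpectrum.topologicalKrullDim_eq_ringKrullDim]
  change topologicalKrullDim (Spec Γ(X, U)) ≤ _
  rw [← IsHomeomorph.topologicalKrullDim_eq _ U.2.isoSpec.hom.homeomorph.isHomeomorph]
  exact topologicalKrullDim_subspace_le X U

variable [IsIntegral X]

theorem exists_coordinate_functionField [CharZero k] {n : ℕ} (hn : topologicalKrullDim X = n)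
    (ω : ⋀[X.functionField]^n Ω[X.functionField⁄k]) (hω : ω ≠ 0) :
    Module.Finite X.functionField Ω[X.functionField⁄k] ∧
    Module.finrank X.functionField Ω[X.functionField⁄k] = n ∧
    ∃ δ : Ω[X.functionField⁄k] [⋀^Fin n]→ₗ[X.functionField] X.functionField, δ ≠ 0 ∧
      ∀ v, exteriorPower.ιMulti X.functionField n v = δ v • ω := by
  obtain ⟨U, hU, hx, -⟩ := X.isBasis_affineOpens.exists_subset_of_mem_open
    (Set.mem_univ (genericPoint X)) isOpen_univ
  obtain ⟨U, hU, rfl⟩ := hU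
  have : Nonempty U := ⟨⟨_, hx⟩⟩
  have := functionField_isFractionRing_of_isAffineOpen X U hU
  have := finiteType_section k ⟨U, hU⟩
  obtain ⟨hfin, hle⟩ :=
    natCast_finrank_differentials_le_ringKrullDim k Γ(X, U) X.functionField
  have h1 := hle.trans ((ringKrullDim_section_le (X := X) ⟨U, hU⟩).trans hn.le)
  have h2 : Module.finrank X.functionField Ω[X.functionField⁄k] ≤ n := by exact_mod_cast h1
  obtain ⟨h3, h4⟩ := exists_coordinate h2 ω hω
  exact ⟨hfin, h3, h4⟩

end Variety

/-! ### Orders of vanishing and regularity in codimension one -/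

section Normal

variable (k : Type u) [Field k] {X : Scheme.{u}} [X.Over (Spec (.of k))]
  [LocallyOfFiniteType (X ↘ Spec (.of k))] [IsIntegral X]

/-- A noetherian, integrally closed local domain of dimension one is a discrete valuation ring. -/
theorem isDiscreteValuationRing_stalk (k : Type u) [Field k] {X : Scheme.{u}}
    [X.Over (Spec (.of k))] [LocallyOfFiniteType (X ↘ Spec (.of k))] [IsIntegral X] (y : X)
    (hnormal : IsIntegrallyClosed (X.presheaf.stalk y))
    (hy : Order.coheight y = 1) : IsDiscreteValuationRing (X.presheaf.stalk y) := by
  have : IsLocallyNoetherian X := LocallyOfFiniteType.isLocallyNoetherian (X ↘ Spec (.of k))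
  have hdim := ringKrullDim_stalk_eq_coheight y
  rw [hy] at hdim
  have h1 : Ring.KrullDimLE 1 (X.presheaf.stalk y) := krullDimLE_of_coheight_le hy.le
  have : Ring.DimensionLEOne (X.presheaf.stalk y) :=
    ⟨fun {p} hp hp' => Ring.krullDimLE_one_iff_of_noZeroDivisors.1 h1 p hp hp'⟩
  have : IsDedekindDomain (X.presheaf.stalk y) := {}
  have hf : ¬ IsField (X.presheaf.stalk y) := fun hf => by
    rw [ringKrullDim_eq_zero_of_isField hf] at hdim
    exact absurd hdim (by decide)
  exact ((IsDiscreteValuationRing.TFAE _ hf).out 2 0).1 ‹_›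

variable {k}

theorem ord_nonneg_iff (y : X) (hnormal : IsIntegrallyClosed (X.presheaf.stalk y))
    (hy : Order.coheight y = 1) {f : X.functionField} (hf : f ≠ 0) :
    0 ≤ ord k f y ↔ f ∈ (algebraMap (X.presheaf.stalk y) X.functionField).range := by
  have : IsLocallyNoetherian X := LocallyOfFiniteType.isLocallyNoetherian (X ↘ Spec (.of k))
  have := isDiscreteValuationRing_stalk k y hnormal hy
  have hk : Ring.KrullDimLE 1 (X.presheaf.stalk y) := krullDimLE_of_coheight_le hy.le
  rw [ord, Scheme.le_ord_iff hy hf]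
  change 1 ≤ Ring.ordFrac (X.presheaf.stalk y) f ↔ _
  refine ⟨mem_range_of_one_le_ordFrac, ?_⟩
  rintro ⟨s, rfl⟩
  exact Ring.ordFrac_ge_one_of_ne_zero fun h => hf (by rw [h, map_zero])

theorem ord_mul {f g : X.functionField} (hf : f ≠ 0) (hg : g ≠ 0) (y : X) :
    ord k (f * g) y = ord k f y + ord k g y :=
  haveI : IsLocallyNoetherian X := LocallyOfFiniteType.isLocallyNoetherian (X ↘ Spec (.of k))
  Scheme.ord_mul hf hg

theorem ord_inv {f : X.functionField} (hf : f ≠ 0) (y : X) : ord k f⁻¹ y = - ord k f y := by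
  have h := ord_mul (k := k) hf (inv_ne_zero hf) y
  have h1 : ord k (1 : X.functionField) y = 0 := by
    have h := ord_mul (k := k) (one_ne_zero (α := X.functionField)) one_ne_zero y
    rw [mul_one] at h
    omega
  rw [mul_inv_cancel₀ hf, h1] at h
  omega

theorem ord_prod {ι : Type*} (s : Finset ι) (f : ι → X.functionField) (hf : ∀ i ∈ s, f i ≠ 0)
    (y : X) : ord k (∏ i ∈ s, f i) y = ∑ i ∈ s, ord k (f i) y := by
  classical
  induction s using Finset.induction_on with
  | empty =>
    have h := ord_mul (k := k) (one_ne_zero (α := X.functionField)) one_ne_zero y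
    rw [mul_one] at h
    simp only [Finset.prod_empty, Finset.sum_empty]
    omega
  | insert a s ha ih =>
    rw [Finset.prod_insert ha, Finset.sum_insert ha, ord_mul, ih]
    · exact fun i hi => hf i (Finset.mem_insert_of_mem hi)
    · exact hf a (Finset.mem_insert_self a s)
    · exact Finset.prod_ne_zero_iff.2 fun i hi => hf i (Finset.mem_insert_of_mem hi)

theorem isLocalization_stalk_fromSpec {X : Scheme.{u}} (U : X.affineOpens)
    (p : PrimeSpectrum Γ(X, U)) :
    ∃ y : U.1, U.2.fromSpec p = y ∧
      IsLocalization.AtPrime (X.presheaf.stalk y.1) p.asIdeal := by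
  have hy : U.2.fromSpec p ∈ U.1 := by
    have : U.2.fromSpec p ∈ Set.range U.2.fromSpec := ⟨_, rfl⟩
    rwa [U.2.range_fromSpec] at this
  exact ⟨⟨U.2.fromSpec p, hy⟩, rfl, U.2.isLocalization_stalk' p hy⟩

theorem isIntegrallyClosed_section {X : Scheme.{u}} [IsIntegral X]
    (hnormal : ∀ x : X, IsIntegrallyClosed (X.presheaf.stalk x)) (U : X.affineOpens)
    [Nonempty U.1] : IsIntegrallyClosed Γ(X, U) := by
  refine IsIntegrallyClosed.of_localization_maximal fun p _ hp => ?_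
  obtain ⟨y, -, hy⟩ := isLocalization_stalk_fromSpec U ⟨p, hp.isPrime⟩
  have := hnormal y.1
  exact IsIntegrallyClosed.of_equiv
    (IsLocalization.algEquiv p.primeCompl (X.presheaf.stalk y.1)
      (Localization.AtPrime p)).toRingEquiv

/-- A rational function without poles in codimension one is regular. -/
theorem mem_range_section_of_forall_stalk {X : Scheme.{u}} [IsIntegral X]
    [IsLocallyNoetherian X]
    (hnormal : ∀ x : X, IsIntegrallyClosed (X.presheaf.stalk x))
    (U : X.affineOpens) [Nonempty U.1] (f : X.functionField)
    (hf : ∀ y ∈ U.1, Order.coheight y = 1 →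
      f ∈ (algebraMap (X.presheaf.stalk y) X.functionField).range) :
    f ∈ (algebraMap Γ(X, U) X.functionField).range := by
  have := functionField_isFractionRing_of_isAffineOpen X U.1 U.2
  have : IsNoetherianRing Γ(X, U) := IsLocallyNoetherian.component_noetherian U
  have := isIntegrallyClosed_section hnormal U
  refine mem_range_of_forall_height_eq_one f fun p hp hp1 => ?_
  obtain ⟨y, -, hloc⟩ := isLocalization_stalk_fromSpec U ⟨p, hp⟩
  have := functionField_isScalarTower X U.1 y
  have hy1 : Order.coheight y.1 = 1 := by
    have h1 := ringKrullDim_stalk_eq_coheight y.1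
    rw [IsLocalization.AtPrime.ringKrullDim_eq_height p, hp1] at h1
    exact_mod_cast h1.symm
  obtain ⟨g, hg⟩ := hf y y.2 hy1
  obtain ⟨⟨a, s⟩, has⟩ := IsLocalization.surj p.primeCompl g
  refine ⟨s, s.2, a, ?_⟩
  rw [← hg, IsScalarTower.algebraMap_apply Γ(X, U) (X.presheaf.stalk y.1) X.functionField,
    ← map_mul, mul_comm, has, ← IsScalarTower.algebraMap_apply]

end Normal

/-! ### The canonical divisor and the sheaf of forms -/

section Canonical

instance isScalarTower_section_stalk (k : Type u) [Field k] {X : Scheme.{u}}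
    [X.Over (Spec (.of k))] (U : X.Opens) (x : U) :
    IsScalarTower k Γ(X, U) (X.presheaf.stalk x.1) := by
  have key : X.presheaf.germ ⊤ x.1 trivial =
      X.presheaf.map (homOfLE (le_top : U ≤ ⊤)).op ≫ X.presheaf.germ U x.1 x.2 :=
    (X.presheaf.germ_res _ _ _).symm
  refine IsScalarTower.of_algebraMap_eq fun c => ?_
  exact ConcreteCategory.congr_hom key
    ((X ↘ Spec (.of k)).appTop.hom ((Scheme.ΓSpecIso (.of k)).inv.hom c))

theorem essFiniteType_stalk (k : Type u) [Field k] {X : Scheme.{u}}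
    [X.Over (Spec (.of k))] [LocallyOfFiniteType (X ↘ Spec (.of k))] (y : X) :
    Algebra.EssFiniteType k (X.presheaf.stalk y) := by
  obtain ⟨U, hU, hy, -⟩ := X.isBasis_affineOpens.exists_subset_of_mem_open
    (Set.mem_univ y) isOpen_univ
  obtain ⟨U, hU, rfl⟩ := hU
  obtain ⟨y', rfl⟩ : ∃ y' : U, y'.1 = y := ⟨⟨y, hy⟩, rfl⟩
  have := finiteType_section k ⟨U, hU⟩
  have hloc := IsAffineOpen.isLocalization_stalk hU y'
  have : Algebra.EssFiniteType Γ(X, U) (X.presheaf.stalk y'.1) :=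
    .of_isLocalization _ (hU.primeIdealOf y').asIdeal.primeCompl
  exact Algebra.EssFiniteType.comp k Γ(X, U) (X.presheaf.stalk y'.1)

/-- Finite generation makes this module a fractional ideal, which is what permits a single generator
over a discrete valuation ring. -/
theorem minorModule_fg {k K R : Type u} [Field k] [Field K] [Algebra k K] {n : ℕ} [CommRing R]
    [Algebra k R] [Algebra R K] [IsScalarTower k R K]
    (δ : Ω[K⁄k] [⋀^Fin n]→ₗ[K] K) {ω : ⋀[K]^n Ω[K⁄k]} (hω : ω ≠ 0)
    (hδ : ∀ v, exteriorPower.ιMulti K n v = δ v • ω)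
    (h1 : ∀ y : ⋀[K]^n Ω[K⁄k], ∃ c : K, c • ω = y) [Algebra.EssFiniteType k R] :
    (minorModule δ R).FG := by
  refine Submodule.fg_of_fg_map_injective ((LinearMap.toSpanSingleton K _ ω).restrictScalars R)
    (smul_left_injective K hω) ?_
  rw [← range_formMap_eq hω hδ h1]
  rw [LinearMap.range_eq_map]
  exact Module.Finite.fg_top.map _

theorem exists_smul_eq_of_coordinate {K V : Type*} [Field K] [AddCommGroup V] [Module K V] {n : ℕ}
    {δ : V [⋀^Fin n]→ₗ[K] K} {ω : ⋀[K]^n V}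
    (hδ : ∀ v, exteriorPower.ιMulti K n v = δ v • ω) (y : ⋀[K]^n V) : ∃ c : K, c • ω = y := by
  have hy : y ∈ Submodule.span K (Set.range (exteriorPower.ιMulti K n (M := V))) := by
    rw [exteriorPower.ιMulti_span]; trivial
  have hle : Submodule.span K (Set.range (exteriorPower.ιMulti K n (M := V))) ≤
      Submodule.span K {ω} := by
    rw [Submodule.span_le]
    rintro _ ⟨v, rfl⟩
    rw [hδ]
    exact Submodule.smul_mem _ _ (Submodule.mem_span_singleton_self ω)
  exact Submodule.mem_span_singleton.1 (hle hy)

/-- If all coefficients of forms over `R` vanish, clearing denominators shows that `δ` vanishes on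
`Ω[K⁄k]`. -/
theorem minorModule_ne_bot {k K R : Type u} [Field k] [Field K] [Algebra k K] {n : ℕ} [CommRing R]
    [IsDomain R] [Algebra k R] [Algebra R K] [IsScalarTower k R K] [IsFractionRing R K]
    (δ : Ω[K⁄k] [⋀^Fin n]→ₗ[K] K) (hδ0 : δ ≠ 0) : minorModule δ R ≠ ⊥ := by
  intro h
  refine hδ0 (AlternatingMap.ext fun v => ?_)
  choose u hu using fun i => KaehlerDifferential.map_surjective_of_surjective k k K K
    Function.surjective_id (v i)
  have hle : δ v ∈ minorPower δ K 1 := by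
    refine Submodule.subset_span ⟨fun _ => u, ?_⟩
    simp only [Finset.univ_unique, Finset.prod_singleton]
    exact congrArg δ (funext hu)
  obtain ⟨w, hw, hw'⟩ := exists_mul_mem_minorPower (δ := δ) (R := R) (nonZeroDivisors R) 1 hle
  rw [← minorModule_pow, h, pow_one, Submodule.mem_bot] at hw'
  exact (mul_eq_zero.1 hw').resolve_left
    (IsFractionRing.to_map_ne_zero_of_mem_nonZeroDivisors hw)

/-- At a point of codimension one the coefficients of forms are a nonzero fractional ideal of a
discrete valuation ring, hence principal. So the existence condition in `canonicalDivisor` holds,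
its default value `0` is not taken, and the chosen `f` is inverse to a generator. -/
theorem exists_canonicalDivisor_eq {k : Type u} [Field k] {X : Scheme.{u}}
    [X.Over (Spec (.of k))] [LocallyOfFiniteType (X ↘ Spec (.of k))] [IsIntegral X] {n : ℕ}
    {ω : ⋀[X.functionField]^n Ω[X.functionField⁄k]} (hω : ω ≠ 0)
    {δ : Ω[X.functionField⁄k] [⋀^Fin n]→ₗ[X.functionField] X.functionField} (hδ0 : δ ≠ 0)
    (hδ : ∀ v, exteriorPower.ιMulti X.functionField n v = δ v • ω) (y : X)
    (hnormal : IsIntegrallyClosed (X.presheaf.stalk y)) (hy : Order.coheight y = 1) :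
    ∃ f : X.functionField, f ≠ 0 ∧ canonicalDivisor k n ω y = ord k f y ∧
      ∀ c ∈ minorModule δ (X.presheaf.stalk y),
        c * f ∈ (algebraMap (X.presheaf.stalk y) X.functionField).range := by
  have := isDiscreteValuationRing_stalk k y hnormal hy
  have := essFiniteType_stalk k y
  have h1 := exists_smul_eq_of_coordinate hδ
  have hfg := minorModule_fg (R := X.presheaf.stalk y) δ hω hδ h1
  have hne := minorModule_ne_bot (R := X.presheaf.stalk y) δ hδ0
  have hrange := range_formMap_eq (R := X.presheaf.stalk y) hω hδ h1
  have hex : ∃ f : X.functionField, f ≠ 0 ∧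
      Submodule.span (X.presheaf.stalk y) {f⁻¹ • ω} =
        LinearMap.range (formMap k (X.presheaf.stalk y) X.functionField n) := by
    let I : FractionalIdeal (nonZeroDivisors (X.presheaf.stalk y)) X.functionField :=
      ⟨minorModule δ (X.presheaf.stalk y), FractionalIdeal.isFractional_of_fg hfg⟩
    obtain ⟨f, hf⟩ :=
      (inferInstance : (I : Submodule (X.presheaf.stalk y) X.functionField).IsPrincipal).principal
    change minorModule δ (X.presheaf.stalk y) = _ at hf
    have hf0 : f ≠ 0 := by
      rintro rfl
      exact hne (by rw [hf, Submodule.span_zero_singleton])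
    refine ⟨f⁻¹, inv_ne_zero hf0, ?_⟩
    rw [hrange, hf, Submodule.map_span, Set.image_singleton, inv_inv]
    rfl
  refine ⟨hex.choose, hex.choose_spec.1, by rw [canonicalDivisor, dif_pos hex], fun c hc => ?_⟩
  obtain ⟨hf0, hspan⟩ := hex.choose_spec
  generalize hex.choose = f at hf0 hspan
  obtain ⟨α, hα⟩ := (exists_formMap_eq_iff hω hδ c).2 hc
  have hmem : c • ω ∈ Submodule.span (X.presheaf.stalk y) {f⁻¹ • ω} :=
    hspan ▸ ⟨α, hα⟩
  obtain ⟨s, hs⟩ := Submodule.mem_span_singleton.1 hmem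
  refine ⟨s, ?_⟩
  rw [← smul_assoc] at hs
  rw [← smul_left_injective _ hω hs, Algebra.smul_def, mul_assoc, inv_mul_cancel₀ hf0, mul_one]

theorem formsImage_eq_minorPower {k : Type u} [Field k] {X : Scheme.{u}}
    [X.Over (Spec (.of k))] [LocallyOfFiniteType (X ↘ Spec (.of k))] [IsIntegral X] {n : ℕ}
    {ω : ⋀[X.functionField]^n Ω[X.functionField⁄k]} (hω : ω ≠ 0)
    {δ : Ω[X.functionField⁄k] [⋀^Fin n]→ₗ[X.functionField] X.functionField}
    (hδ : ∀ v, exteriorPower.ιMulti X.functionField n v = δ v • ω) (r : ℕ) (U : X.Opens)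
    [Nonempty U] : formsImage k n r ω U = minorPower δ Γ(X, U) r :=
  span_formMap_eq_minorPower hω hδ r

/-- At a point of codimension one each coefficient has order at least minus the multiplicity of
`K_X`; the orders of the `r` factors add up. -/
theorem formsImage_le_divisorialSections {k : Type u} [Field k] {X : Scheme.{u}}
    [X.Over (Spec (.of k))] [LocallyOfFiniteType (X ↘ Spec (.of k))] [IsIntegral X] {n : ℕ}
    (hnormal : ∀ x : X, IsIntegrallyClosed (X.presheaf.stalk x))
    {ω : ⋀[X.functionField]^n Ω[X.functionField⁄k]} (hω : ω ≠ 0)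
    {δ : Ω[X.functionField⁄k] [⋀^Fin n]→ₗ[X.functionField] X.functionField} (hδ0 : δ ≠ 0)
    (hδ : ∀ v, exteriorPower.ιMulti X.functionField n v = δ v • ω) (r : ℕ) (U : X.Opens)
    [Nonempty U] :
    formsImage k n r ω U ≤ divisorialSections k (r • canonicalDivisor k n ω) U := by
  rw [formsImage_eq_minorPower hω hδ, minorPower, divisorialSections]
  refine Submodule.span_mono ?_
  rintro _ ⟨v, rfl⟩
  refine or_iff_not_imp_left.2 fun h0 y hyU hy => ?_
  have hj : ∀ j ∈ Finset.univ, δ (KaehlerDifferential.map k k Γ(X, U) X.functionField ∘ v j) ≠ 0 :=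
    Finset.prod_ne_zero_iff.1 h0
  obtain ⟨y', rfl⟩ : ∃ y' : U, y'.1 = y := ⟨⟨y, hyU⟩, rfl⟩
  obtain ⟨f, hf0, hf, hc⟩ := exists_canonicalDivisor_eq hω hδ0 hδ y'.1 (hnormal y') hy
  have := functionField_isScalarTower X U y'
  rw [ord_prod _ _ hj, Pi.smul_apply, hf]
  have h1 : ∀ j, 0 ≤ ord k (δ (KaehlerDifferential.map k k Γ(X, U) X.functionField ∘ v j)) y' +
      ord k f y' := by
    intro j
    rw [← ord_mul (hj j (Finset.mem_univ j)) hf0,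
      ord_nonneg_iff y'.1 (hnormal y') hy (mul_ne_zero (hj j (Finset.mem_univ j)) hf0)]
    refine hc _ (Submodule.subset_span
      ⟨KaehlerDifferential.map k k Γ(X, U) (X.presheaf.stalk y'.1) ∘ v j, ?_⟩)
    exact congrArg δ (map_comp_map_differentials _)
  have h2 := Finset.sum_nonneg fun j (_ : j ∈ Finset.univ) => h1 j
  rw [Finset.sum_add_distrib] at h2
  simpa using h2

end Canonical

/-! ### Localisation of the sheaves of divisorial sections and of forms -/

section Local

theorem algebraMap_res {X : Scheme.{u}} [IsIntegral X] {U V : X.Opens} (h : V ≤ U) [Nonempty U]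
    [Nonempty V] (a : Γ(X, U)) :
    algebraMap Γ(X, V) X.functionField (X.presheaf.map (homOfLE h).op a) =
      algebraMap Γ(X, U) X.functionField a :=
  X.presheaf.germ_res_apply _ _ _ _

theorem nonempty_basicOpen {X : Scheme.{u}} [IsIntegral X] {U : X.Opens} {f : Γ(X, U)}
    (hf : f ≠ 0) : Nonempty (X.basicOpen f) := by
  by_contra h
  refine hf ((basicOpen_eq_bot_iff f).1 ?_)
  ext x
  simp only [TopologicalSpace.Opens.coe_bot, Set.mem_empty_iff_false, iff_false]
  exact fun hx => h ⟨⟨x, hx⟩⟩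

theorem algebraMap_section_injective (X : Scheme.{u}) [IsIntegral X] (U : X.Opens) [Nonempty U] :
    Function.Injective (algebraMap Γ(X, U) X.functionField) :=
  AlgebraicGeometry.germ_injective_of_isIntegral X _ _

variable {k : Type u} [Field k] {X : Scheme.{u}}
    [X.Over (Spec (.of k))] [LocallyOfFiniteType (X ↘ Spec (.of k))] [IsIntegral X]

theorem exists_pow_mul_mem_range_section {U : X.Opens} (hU : IsAffineOpen U) [Nonempty U]
    (f : Γ(X, U)) [Nonempty (X.basicOpen f)] {x : X.functionField}
    (hx : x ∈ (algebraMap Γ(X, X.basicOpen f) X.functionField).range) :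
    ∃ N, algebraMap Γ(X, U) X.functionField f ^ N * x ∈
      (algebraMap Γ(X, U) X.functionField).range := by
  obtain ⟨a, rfl⟩ := hx
  have := hU.isLocalization_basicOpen f
  obtain ⟨N, b, hb⟩ := IsLocalization.Away.surj f a
  refine ⟨N, b, ?_⟩
  rw [← algebraMap_res (X.basicOpen_le f) b, ← algebraMap_res (X.basicOpen_le f) f, ← map_pow,
    ← map_mul, mul_comm]
  exact congrArg _ hb.symm

/-- The function `h` is a local equation of the divisor `D` on `U`. -/
def IsEquation (k : Type u) [Field k] {X : Scheme.{u}} [X.Over (Spec (.of k))] [IsIntegral X]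
    [LocallyOfFiniteType (X ↘ Spec (.of k))] (D : X → ℤ) (U : X.Opens) (h : X.functionField) :
    Prop :=
  h ≠ 0 ∧ ∀ y ∈ U, Order.coheight y = 1 → D y = ord k h y

theorem IsEquation.mono {D : X → ℤ} {U V : X.Opens} {h : X.functionField}
    (hh : IsEquation k D U h) (hVU : V ≤ U) : IsEquation k D V h :=
  ⟨hh.1, fun y hy => hh.2 y (hVU hy)⟩

/-- Regularity of `h * x` is visibly preserved by sums and multiples, so taking the span in
`divisorialSections` adds no elements. -/
theorem mem_divisorialSections_iff
    (hnormal : ∀ x : X, IsIntegrallyClosed (X.presheaf.stalk x)) {D : X → ℤ} (hD : IsCartier k D)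
    (U : X.Opens) [Nonempty U] (x : X.functionField) :
    x ∈ divisorialSections k D U ↔ ∀ y ∈ U, Order.coheight y = 1 →
      ∀ h : X.functionField, h ≠ 0 → D y = ord k h y →
        h * x ∈ (algebraMap (X.presheaf.stalk y) X.functionField).range := by
  constructor
  · intro hx y hyU hy h h0 hDh
    induction hx using Submodule.span_induction with
    | mem x hx =>
      rcases hx with rfl | hx
      · rw [mul_zero]; exact zero_mem _
      · by_cases hx0 : x = 0
        · rw [hx0, mul_zero]; exact zero_mem _
        · rw [← ord_nonneg_iff (k := k) y (hnormal y) hy (mul_ne_zero h0 hx0), ord_mul h0 hx0,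
            ← hDh, add_comm]
          exact hx y hyU hy
    | zero => rw [mul_zero]; exact zero_mem _
    | add a b _ _ ha hb => rw [mul_add]; exact add_mem ha hb
    | smul s a _ ha =>
      obtain ⟨y', rfl⟩ : ∃ y' : U, y'.1 = y := ⟨⟨y, hyU⟩, rfl⟩
      have := functionField_isScalarTower X U y'
      rw [Algebra.smul_def, IsScalarTower.algebraMap_apply Γ(X, U) (X.presheaf.stalk y'.1),
        mul_left_comm]
      exact mul_mem ⟨_, rfl⟩ ha
  · intro hx
    refine Submodule.subset_span (or_iff_not_imp_left.2 fun hx0 y hyU hy => ?_)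
    obtain ⟨W, hyW, h, h0, hh⟩ := hD y
    have h1 := hh y hyW hy
    rw [h1, add_comm, ← ord_mul h0 hx0,
      ord_nonneg_iff (k := k) y (hnormal y) hy (mul_ne_zero h0 hx0)]
    exact hx y hyU hy h h0 h1

theorem divisorialSections_mono
    (hnormal : ∀ x : X, IsIntegrallyClosed (X.presheaf.stalk x)) {D : X → ℤ} (hD : IsCartier k D)
    {U V : X.Opens} (hVU : V ≤ U) [Nonempty U] [Nonempty V] {x : X.functionField}
    (hx : x ∈ divisorialSections k D U) : x ∈ divisorialSections k D V := by
  rw [mem_divisorialSections_iff hnormal hD] at hx ⊢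
  exact fun y hy => hx y (hVU hy)

theorem mem_divisorialSections_of_forall
    (hnormal : ∀ x : X, IsIntegrallyClosed (X.presheaf.stalk x)) {D : X → ℤ} (hD : IsCartier k D)
    (U : X.Opens) [Nonempty U] (x : X.functionField)
    (h : ∀ y ∈ U, ∃ (V : X.Opens) (_ : Nonempty V), y ∈ V ∧ x ∈ divisorialSections k D V) :
    x ∈ divisorialSections k D U := by
  rw [mem_divisorialSections_iff hnormal hD]
  intro y hy
  obtain ⟨V, _, hyV, hx⟩ := h y hy
  rw [mem_divisorialSections_iff hnormal hD] at hx
  exact hx y hyV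

/-- On an affine open with equation `h` the sheaf is `h⁻¹𝒪`: regularity of `h * x` in codimension
one implies regularity, by normality. -/
theorem mem_divisorialSections_iff_of_isEquation
    (hnormal : ∀ x : X, IsIntegrallyClosed (X.presheaf.stalk x)) {D : X → ℤ} (hD : IsCartier k D)
    {U : X.Opens} (hU : IsAffineOpen U) [Nonempty U] {h : X.functionField}
    (hh : IsEquation k D U h) (x : X.functionField) :
    x ∈ divisorialSections k D U ↔ h * x ∈ (algebraMap Γ(X, U) X.functionField).range := by
  have : IsLocallyNoetherian X := LocallyOfFiniteType.isLocallyNoetherian (X ↘ Spec (.of k))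
  rw [mem_divisorialSections_iff hnormal hD]
  constructor
  · intro hx
    exact mem_range_section_of_forall_stalk hnormal ⟨U, hU⟩ _ fun y hyU hy =>
      hx y hyU hy h hh.1 (hh.2 y hyU hy)
  · rintro ⟨a, ha⟩ y hyU hy h' h0' hh'
    obtain ⟨y', rfl⟩ : ∃ y' : U, y'.1 = y := ⟨⟨y, hyU⟩, rfl⟩
    have := functionField_isScalarTower X U y'
    have h1 : h' * h⁻¹ ∈ (algebraMap (X.presheaf.stalk y'.1) X.functionField).range := by
      rw [← ord_nonneg_iff (k := k) y'.1 (hnormal y') hy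
        (mul_ne_zero h0' (inv_ne_zero hh.1)), ord_mul h0' (inv_ne_zero hh.1), ord_inv hh.1,
        ← hh', hh.2 y' hyU hy]
      omega
    have h2 : h' * x = (h' * h⁻¹) * (h * x) := by
      rw [mul_assoc, inv_mul_cancel_left₀ hh.1]
    rw [h2, ← ha, IsScalarTower.algebraMap_apply Γ(X, U) (X.presheaf.stalk y'.1)]
    exact mul_mem h1 ⟨_, rfl⟩

/-- An affine open is covered by finitely many basic opens with an equation of a given Cartier
divisor. -/
theorem exists_finset_isEquation {D : X → ℤ} (hD : IsCartier k D) {U : X.Opens}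
    (hU : IsAffineOpen U) : ∃ t : Finset Γ(X, U), Ideal.span (t : Set Γ(X, U)) = ⊤ ∧
      ∀ f ∈ t, f ≠ 0 ∧ ∃ h, IsEquation k D (X.basicOpen f) h := by
  have h1 : Ideal.span {f : Γ(X, U) | f ≠ 0 ∧ ∃ h, IsEquation k D (X.basicOpen f) h} = ⊤ := by
    by_contra hne
    obtain ⟨p, hp, hle⟩ := Ideal.exists_le_maximal _ hne
    let y := hU.fromSpec ⟨p, hp.isPrime⟩
    have hyU : y ∈ U := by
      have : y ∈ Set.range hU.fromSpec := ⟨_, rfl⟩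
      rwa [hU.range_fromSpec] at this
    obtain ⟨W, hyW, h, h0, hh⟩ := hD y
    obtain ⟨f, hf, hyf⟩ := hU.exists_basicOpen_le (V := W) ⟨y, hyW⟩ hyU
    have hfp : f ∉ p := by
      have : (⟨p, hp.isPrime⟩ : PrimeSpectrum Γ(X, U)) ∈ hU.fromSpec ⁻¹ᵁ X.basicOpen f := hyf
      rwa [hU.fromSpec_preimage_basicOpen] at this
    exact hfp (hle (Ideal.subset_span
      ⟨fun h0 => hfp (h0 ▸ p.zero_mem), h, h0, fun y hy => hh y (hf hy)⟩))
  obtain ⟨t, ht, hs⟩ := (Ideal.span_eq_top_iff_finite _).1 h1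
  exact ⟨t, hs, fun f hf => ht hf⟩

theorem exists_mem_basicOpen_of_span_eq_top {X : Scheme.{u}} {U : X.Opens} (hU : IsAffineOpen U)
    {t : Set Γ(X, U)} (ht : Ideal.span t = ⊤) {y : X} (hy : y ∈ U) :
    ∃ f ∈ t, y ∈ X.basicOpen f := by
  by_contra! h
  have hle : Ideal.span t ≤ (hU.primeIdealOf ⟨y, hy⟩).asIdeal := by
    rw [Ideal.span_le]
    intro f hf
    by_contra hfp
    refine h f hf ?_
    have h1 : hU.primeIdealOf ⟨y, hy⟩ ∈ hU.fromSpec ⁻¹ᵁ X.basicOpen f := by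
      rw [hU.fromSpec_preimage_basicOpen]; exact hfp
    have h2 : hU.fromSpec (hU.primeIdealOf ⟨y, hy⟩) ∈ X.basicOpen f := h1
    have h3 : hU.fromSpec (hU.primeIdealOf ⟨y, hy⟩) = y := hU.fromSpec_primeIdealOf ⟨y, hy⟩
    rwa [h3] at h2
  exact (hU.primeIdealOf ⟨y, hy⟩).isPrime.ne_top (top_le_iff.1 (ht ▸ hle))

/-- Quasi-coherence of `𝒪_X(D)`. On each member of a finite cover with equations the sheaf is free,
so a power of `g` clears denominators; membership is then local. -/
theorem exists_pow_mul_mem_divisorialSections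
    (hnormal : ∀ x : X, IsIntegrallyClosed (X.presheaf.stalk x)) {D : X → ℤ} (hD : IsCartier k D)
    {U : X.Opens} (hU : IsAffineOpen U) [Nonempty U] (g : Γ(X, U)) [Nonempty (X.basicOpen g)]
    {x : X.functionField} (hx : x ∈ divisorialSections k D (X.basicOpen g)) :
    ∃ N, algebraMap Γ(X, U) X.functionField g ^ N * x ∈ divisorialSections k D U := by
  obtain ⟨t, ht, htD⟩ := exists_finset_isEquation hD hU
  -- All larger exponents are allowed so that the maximum over the finite cover works everywhere.
  have hloc : ∀ f ∈ t, ∃ N₀, ∀ N ≥ N₀, ∃ _ : Nonempty (X.basicOpen f),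
      algebraMap Γ(X, U) X.functionField g ^ N * x ∈ divisorialSections k D (X.basicOpen f) := by
    intro f hf
    obtain ⟨hf0, h, hh⟩ := htD f hf
    have hne := nonempty_basicOpen hf0
    have hfa := hU.basicOpen f
    let g' := X.presheaf.map (homOfLE (X.basicOpen_le f)).op g
    have hg' : X.basicOpen g' = X.basicOpen f ⊓ X.basicOpen g := X.basicOpen_res _ _
    have hg0 : g ≠ 0 := by
      rintro rfl
      obtain ⟨z⟩ := ‹Nonempty (X.basicOpen (0 : Γ(X, U)))›
      have := z.2
      simp at this
    have hmap : algebraMap Γ(X, X.basicOpen f) X.functionField g' =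
      algebraMap Γ(X, U) X.functionField g := algebraMap_res _ g
    have hne' : Nonempty (X.basicOpen g') := nonempty_basicOpen fun h0 => hg0 <|
      algebraMap_section_injective X U (by rw [← hmap, h0, map_zero, map_zero])
    have hx' := divisorialSections_mono hnormal hD (V := X.basicOpen g')
      (hg'.le.trans inf_le_right) hx
    rw [mem_divisorialSections_iff_of_isEquation hnormal hD (hfa.basicOpen g')
      (hh.mono (X.basicOpen_le g'))] at hx'
    obtain ⟨N₀, hN₀⟩ := exists_pow_mul_mem_range_section hfa g' hx'
    refine ⟨N₀, fun N hN => ⟨hne, ?_⟩⟩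
    rw [mem_divisorialSections_iff_of_isEquation hnormal hD hfa hh]
    rw [hmap] at hN₀
    have : h * (algebraMap Γ(X, U) X.functionField g ^ N * x) =
        algebraMap Γ(X, X.basicOpen f) X.functionField (g' ^ (N - N₀)) *
          (algebraMap Γ(X, U) X.functionField g ^ N₀ * (h * x)) := by
      nth_rw 1 [← Nat.sub_add_cancel hN]
      rw [map_pow, hmap, pow_add]; ring
    rw [this]
    exact mul_mem ⟨_, rfl⟩ hN₀
  choose! N₀ hN₀ using hloc
  refine ⟨t.sup N₀, mem_divisorialSections_of_forall hnormal hD U _ fun y hy => ?_⟩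
  obtain ⟨f, hf, hyf⟩ := exists_mem_basicOpen_of_span_eq_top hU ht hy
  obtain ⟨hne, h⟩ := hN₀ f hf _ (Finset.le_sup hf)
  exact ⟨X.basicOpen f, hne, hyf, h⟩

end Local

/-! ### Localisation of the modules of products of coefficients -/

section LocalForms

variable {k : Type u} [Field k] {X : Scheme.{u}} [X.Over (Spec (.of k))] [IsIntegral X]
  {n : ℕ} (δ : Ω[X.functionField⁄k] [⋀^Fin n]→ₗ[X.functionField] X.functionField) (r : ℕ)

theorem minorPower_section_mono {U V : X.Opens} (hVU : V ≤ U) [Nonempty U] [Nonempty V]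
    {x : X.functionField} (hx : x ∈ minorPower δ Γ(X, U) r) : x ∈ minorPower δ Γ(X, V) r := by
  let : Algebra Γ(X, U) Γ(X, V) := (X.presheaf.map (homOfLE hVU).op).hom.toAlgebra
  have : IsScalarTower k Γ(X, U) Γ(X, V) := isScalarTower_res k X hVU
  have : IsScalarTower Γ(X, U) Γ(X, V) X.functionField :=
    IsScalarTower.of_algebraMap_eq fun a => (algebraMap_res hVU a).symm
  exact minorPower_le r hx

theorem exists_pow_mul_mem_minorPower_section {U : X.Opens} (hU : IsAffineOpen U) [Nonempty U]
    (g : Γ(X, U)) [Nonempty (X.basicOpen g)] {x : X.functionField}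
    (hx : x ∈ minorPower δ Γ(X, X.basicOpen g) r) :
    ∃ N, algebraMap Γ(X, U) X.functionField g ^ N * x ∈ minorPower δ Γ(X, U) r := by
  have := hU.isLocalization_basicOpen g
  have : IsScalarTower k Γ(X, U) Γ(X, X.basicOpen g) := isScalarTower_res k X (X.basicOpen_le g)
  have : IsScalarTower Γ(X, U) Γ(X, X.basicOpen g) X.functionField :=
    IsScalarTower.of_algebraMap_eq fun a => (algebraMap_res (X.basicOpen_le g) a).symm
  obtain ⟨_, ⟨N, rfl⟩, hN⟩ := exists_mul_mem_minorPower (Submonoid.powers g) r hx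
  exact ⟨N, by rwa [map_pow] at hN⟩

theorem mem_minorPower_section_of_span_eq_top {U : X.Opens} (hU : IsAffineOpen U) [Nonempty U]
    {t : Set Γ(X, U)} (ht : Ideal.span t = ⊤) {x : X.functionField}
    (hx : ∀ f ∈ t, ∃ _ : Nonempty (X.basicOpen f), x ∈ minorPower δ Γ(X, X.basicOpen f) r) :
    x ∈ minorPower δ Γ(X, U) r := by
  refine Submodule.mem_of_span_eq_top_of_smul_pow_mem _ t ht x fun f => ?_
  obtain ⟨_, h⟩ := hx f f.2
  obtain ⟨N, hN⟩ := exists_pow_mul_mem_minorPower_section δ r hU f.1 h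
  exact ⟨N, by rwa [Algebra.smul_def, map_pow]⟩

theorem pow_mul_mem_minorPower_basicOpen_iff {U : X.Opens} [Nonempty U] (g : Γ(X, U))
    [Nonempty (X.basicOpen g)] (N : ℕ) (x : X.functionField) :
    algebraMap Γ(X, U) X.functionField g ^ N * x ∈ minorPower δ Γ(X, X.basicOpen g) r ↔
      x ∈ minorPower δ Γ(X, X.basicOpen g) r := by
  have hu : IsUnit (X.presheaf.map (homOfLE (X.basicOpen_le g)).op g) :=
    X.toRingedSpace.isUnit_res_basicOpen g
  rw [← algebraMap_res (X.basicOpen_le g) g, ← map_pow, ← Algebra.smul_def]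
  exact Submodule.smul_mem_iff_of_isUnit _ (hu.pow N)

end LocalForms

/-! ### The Nash ideal as a conductor -/

section Conductor

variable {k : Type u} [Field k] {X : Scheme.{u}}
    [X.Over (Spec (.of k))] [LocallyOfFiniteType (X ↘ Spec (.of k))] [IsIntegral X]
    (D : X → ℤ) {n : ℕ}
    (δ : Ω[X.functionField⁄k] [⋀^Fin n]→ₗ[X.functionField] X.functionField) (r : ℕ)

/-- The ideal of the functions on `U` which multiply the sections of `𝒪_X(D)` into the module
spanned by the products of `r` coefficients of forms. -/
def conductorIdeal (U : X.Opens) : Ideal Γ(X, U) where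
  -- For empty `U` the condition is vacuous and the ideal is everything, as needed over the zero
  -- ring.
  carrier := {a | ∀ [Nonempty U], ∀ d ∈ divisorialSections k D U,
    algebraMap Γ(X, U) X.functionField a * d ∈ minorPower δ Γ(X, U) r}
  zero_mem' := fun d _ => by rw [map_zero, zero_mul]; exact zero_mem _
  add_mem' := fun ha hb _ d hd => by
    rw [map_add, add_mul]; exact add_mem (ha d hd) (hb d hd)
  smul_mem' := fun c a ha _ d hd => by
    rw [smul_eq_mul, map_mul, mul_assoc, ← Algebra.smul_def]
    exact Submodule.smul_mem _ _ (ha d hd)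

variable {D}

/-- Over each basic open the sections of `𝒪_X(D)` are multiples of `(h f)⁻¹`, so only this one
section has to be tested. -/
theorem mem_conductorIdeal_of_forall_basicOpen
    (hnormal : ∀ x : X, IsIntegrallyClosed (X.presheaf.stalk x)) (hD : IsCartier k D)
    {U : X.Opens} (hU : IsAffineOpen U) [Nonempty U]
    {t : Finset Γ(X, U)} (ht : Ideal.span (t : Set Γ(X, U)) = ⊤) (h : Γ(X, U) → X.functionField)
    (hh : ∀ f ∈ t, f ≠ 0 ∧ IsEquation k D (X.basicOpen f) (h f)) (a : Γ(X, U))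
    (ha : ∀ f ∈ t, ∀ [Nonempty (X.basicOpen f)],
      algebraMap Γ(X, U) X.functionField a * (h f)⁻¹ ∈ minorPower δ Γ(X, X.basicOpen f) r) :
    a ∈ conductorIdeal D δ r U := by
  intro _ d hd
  refine mem_minorPower_section_of_span_eq_top δ r hU ht fun f hf => ?_
  have hne := nonempty_basicOpen (hh f hf).1
  refine ⟨hne, ?_⟩
  obtain ⟨b, hb⟩ := (mem_divisorialSections_iff_of_isEquation hnormal hD (hU.basicOpen f)
    (hh f hf).2 d).1 (divisorialSections_mono hnormal hD (X.basicOpen_le f) hd)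
  have : algebraMap Γ(X, U) X.functionField a * d =
      b • (algebraMap Γ(X, U) X.functionField a * (h f)⁻¹) := by
    rw [Algebra.smul_def, hb]
    have := (hh f hf).2.1
    field_simp
  rw [this]
  exact Submodule.smul_mem _ _ (ha f hf)

/-- Conductors commute with localisation when the source is finitely generated. Here `𝒪_X(D)` is
generated by one section on each of finitely many basic opens, so one power of `g` clears all
denominators. This is the compatibility that makes the conductor an ideal sheaf. -/
theorem map_conductorIdeal_basicOpen
    (hnormal : ∀ x : X, IsIntegrallyClosed (X.presheaf.stalk x)) (hD : IsCartier k D)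
    {U : X.Opens} (hU : IsAffineOpen U) (g : Γ(X, U)) :
    (conductorIdeal D δ r U).map (X.presheaf.map (homOfLE (X.basicOpen_le g)).op).hom =
      conductorIdeal D δ r (X.basicOpen g) := by
  by_cases hg0 : g = 0
  · have hbot : X.basicOpen g = ⊥ := (basicOpen_eq_bot_iff g).2 hg0
    have : Subsingleton Γ(X, X.basicOpen g) := by
      rw [hbot]; infer_instance
    exact Subsingleton.elim _ _
  have hneg := nonempty_basicOpen hg0
  have hneU : Nonempty U := hneg.map fun z => ⟨z.1, X.basicOpen_le g z.2⟩
  have hres := algebraMap_res (X.basicOpen_le g)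
  have hle : ∀ a ∈ conductorIdeal D δ r U,
      X.presheaf.map (homOfLE (X.basicOpen_le g)).op a ∈ conductorIdeal D δ r (X.basicOpen g) := by
    intro a ha _ d hd
    obtain ⟨N, hN⟩ := exists_pow_mul_mem_divisorialSections hnormal hD hU g hd
    rw [hres, ← pow_mul_mem_minorPower_basicOpen_iff δ r g N, mul_left_comm]
    exact minorPower_section_mono δ r (X.basicOpen_le g) (ha _ hN)
  refine le_antisymm (Ideal.map_le_iff_le_comap.2 hle) fun b hb => ?_
  have := hU.isLocalization_basicOpen g
  obtain ⟨m, a, hma⟩ := IsLocalization.Away.surj g b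
  have hu : IsUnit (X.presheaf.map (homOfLE (X.basicOpen_le g)).op g) :=
    X.toRingedSpace.isUnit_res_basicOpen g
  replace hma : b * (X.presheaf.map (homOfLE (X.basicOpen_le g)).op g) ^ m =
    X.presheaf.map (homOfLE (X.basicOpen_le g)).op a := hma
  obtain ⟨t, ht, htD⟩ := exists_finset_isEquation hD hU
  choose! ht0 h hh using htD
  have key : ∀ f ∈ t, ∃ N₀, ∀ N ≥ N₀, ∀ [Nonempty (X.basicOpen f)],
      algebraMap Γ(X, U) X.functionField (g ^ N * a) * (h f)⁻¹ ∈
        minorPower δ Γ(X, X.basicOpen f) r := by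
    intro f hf
    have hnef := nonempty_basicOpen (ht0 f hf)
    have h1 : (h f)⁻¹ ∈ divisorialSections k D (X.basicOpen f) := by
      rw [mem_divisorialSections_iff_of_isEquation hnormal hD (hU.basicOpen f) (hh f hf),
        mul_inv_cancel₀ (hh f hf).1]
      exact one_mem _
    -- The local generator extends to a section over `U` after multiplication by `f ^ M`; this
    -- factor is a unit on the basic open of `f` and is removed there.
    obtain ⟨M, hM⟩ := exists_pow_mul_mem_divisorialSections hnormal hD hU f h1
    have h2 := (Ideal.mul_mem_right (X.presheaf.map (homOfLE (X.basicOpen_le g)).op g ^ m)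
      _ @hb : _ ∈ conductorIdeal D δ r (X.basicOpen g)) _
        (divisorialSections_mono hnormal hD (X.basicOpen_le g) hM)
    rw [hma, hres] at h2
    obtain ⟨N₀, hN₀⟩ := exists_pow_mul_mem_minorPower_section δ r hU g h2
    refine ⟨N₀, fun N hN _ => ?_⟩
    rw [← pow_mul_mem_minorPower_basicOpen_iff δ r f M]
    refine minorPower_section_mono δ r (X.basicOpen_le f) ?_
    have : algebraMap Γ(X, U) X.functionField f ^ M *
        (algebraMap Γ(X, U) X.functionField (g ^ N * a) * (h f)⁻¹) =
        g ^ (N - N₀) • (algebraMap Γ(X, U) X.functionField g ^ N₀ *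
          (algebraMap Γ(X, U) X.functionField a *
            (algebraMap Γ(X, U) X.functionField f ^ M * (h f)⁻¹))) := by
      nth_rw 1 [← Nat.sub_add_cancel hN]
      rw [Algebra.smul_def, map_mul, map_pow, map_pow, pow_add]; ring
    rw [this]
    exact Submodule.smul_mem _ _ hN₀
  choose! N₀ hN₀ using key
  have ha : g ^ t.sup N₀ * a ∈ conductorIdeal D δ r U :=
    mem_conductorIdeal_of_forall_basicOpen δ r hnormal hD hU ht h
      (fun f hf => ⟨ht0 f hf, hh f hf⟩) _ fun f hf => hN₀ f hf _ (Finset.le_sup hf)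
  have hmem := Ideal.mem_map_of_mem (X.presheaf.map (homOfLE (X.basicOpen_le g)).op).hom @ha
  obtain ⟨v, hv⟩ := hu
  have hb' : b = (↑(v⁻¹ ^ (t.sup N₀ + m)) : Γ(X, X.basicOpen g)) *
      (X.presheaf.map (homOfLE (X.basicOpen_le g)).op).hom (g ^ t.sup N₀ * a) := by
    have h1 : (X.presheaf.map (homOfLE (X.basicOpen_le g)).op).hom (g ^ t.sup N₀ * a) =
        (↑(v ^ (t.sup N₀ + m)) : Γ(X, X.basicOpen g)) * b := by
      rw [map_mul, map_pow]
      change _ ^ _ * X.presheaf.map (homOfLE (X.basicOpen_le g)).op a = _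
      rw [← hma, Units.val_pow_eq_pow_val, hv, pow_add]
      change X.presheaf.map (homOfLE (X.basicOpen_le g)).op g ^ _ * _ = _
      ring
    rw [h1, ← mul_assoc, ← Units.val_mul, ← mul_pow, inv_mul_cancel, one_pow, Units.val_one,
      one_mul]
  rw [hb']
  exact Ideal.mul_mem_left _ _ hmem

theorem mem_conductorIdeal_iff_of_isEquation
    (hnormal : ∀ x : X, IsIntegrallyClosed (X.presheaf.stalk x)) (hD : IsCartier k D)
    {U : X.Opens} (hU : IsAffineOpen U) [Nonempty U] {h : X.functionField}
    (hh : IsEquation k D U h) (a : Γ(X, U)) :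
    a ∈ conductorIdeal D δ r U ↔
      algebraMap Γ(X, U) X.functionField a * h⁻¹ ∈ minorPower δ Γ(X, U) r := by
  constructor
  · intro ha
    refine ha _ ?_
    rw [mem_divisorialSections_iff_of_isEquation hnormal hD hU hh, mul_inv_cancel₀ hh.1]
    exact one_mem _
  · intro ha _ d hd
    obtain ⟨b, hb⟩ := (mem_divisorialSections_iff_of_isEquation hnormal hD hU hh d).1 hd
    have : algebraMap Γ(X, U) X.functionField a * d =
        b • (algebraMap Γ(X, U) X.functionField a * h⁻¹) := by
      rw [Algebra.smul_def, hb]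
      have := hh.1
      field_simp
    rw [this]
    exact Submodule.smul_mem _ _ ha

/-- If the forms are sections of `𝒪_X(D)`, the conductor is generated by the products of the
coefficients of forms with a local equation of `D`. -/
theorem exists_generators_conductorIdeal
    (hnormal : ∀ x : X, IsIntegrallyClosed (X.presheaf.stalk x)) (hD : IsCartier k D)
    {U : X.Opens} (hU : IsAffineOpen U) [Nonempty U] {h : X.functionField}
    (hh : IsEquation k D U h) (hle : minorPower δ Γ(X, U) r ≤ divisorialSections k D U) :
    ∃ gen : (Fin r → Fin n → Ω[Γ(X, U)⁄k]) → Γ(X, U),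
      (∀ v, algebraMap Γ(X, U) X.functionField (gen v) =
        h * ∏ j, δ (KaehlerDifferential.map k k Γ(X, U) X.functionField ∘ v j)) ∧
      conductorIdeal D δ r U = Ideal.span (Set.range gen) := by
  have h1 : ∀ v : Fin r → Fin n → Ω[Γ(X, U)⁄k], ∃ a, algebraMap Γ(X, U) X.functionField a =
        h * ∏ j, δ (KaehlerDifferential.map k k Γ(X, U) X.functionField ∘ v j) := fun v =>
    (mem_divisorialSections_iff_of_isEquation hnormal hD hU hh _).1
      (hle (Submodule.subset_span ⟨v, rfl⟩))
  choose gen hgen using h1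
  refine ⟨gen, hgen, ?_⟩
  ext a
  have h2 : (Submodule.span Γ(X, U) (Set.range gen)).map
      (Algebra.linearMap Γ(X, U) X.functionField) =
      (minorPower δ Γ(X, U) r).map (LinearMap.mulLeft Γ(X, U) h) := by
    rw [Submodule.map_span, minorPower, Submodule.map_span, ← Set.range_comp,
      ← Set.range_comp]
    congr 2
    funext v
    exact hgen v
  rw [mem_conductorIdeal_iff_of_isEquation δ r hnormal hD hU hh]
  refine Iff.trans ?_ (algebraMap_section_injective X U).mem_set_image
  change _ ↔ algebraMap Γ(X, U) X.functionField a ∈ (Submodule.span Γ(X, U) (Set.range gen)).map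
    (Algebra.linearMap Γ(X, U) X.functionField)
  rw [h2]
  constructor
  · intro ha
    exact ⟨_, ha, by rw [LinearMap.mulLeft_apply, mul_comm, inv_mul_cancel_right₀ hh.1]⟩
  · rintro ⟨x, hx, hxa⟩
    rw [LinearMap.mulLeft_apply] at hxa
    change h * x = algebraMap Γ(X, U) X.functionField a at hxa
    rwa [← hxa, mul_comm h, mul_inv_cancel_right₀ hh.1]

/-- Locally an element `x` of the image is `(h x) h⁻¹`, where `h x` lies in the conductor. Clearing
denominators in both factors writes `f ^ (N + M) • x` as a product over `U`, and the elements `f`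
generate the unit ideal. -/
theorem conductorIdeal_smul_divisorialSections
    (hnormal : ∀ x : X, IsIntegrallyClosed (X.presheaf.stalk x)) (hD : IsCartier k D)
    {U : X.Opens} (hU : IsAffineOpen U) [Nonempty U]
    (hle : minorPower δ Γ(X, U) r ≤ divisorialSections k D U) :
    conductorIdeal D δ r U • divisorialSections k D U = minorPower δ Γ(X, U) r := by
  apply le_antisymm
  · rw [Submodule.smul_le]
    intro a ha d hd
    rw [Algebra.smul_def]
    exact ha d hd
  intro x hx
  obtain ⟨t, ht, htD⟩ := exists_finset_isEquation hD hU
  refine Submodule.mem_of_span_eq_top_of_smul_pow_mem _ _ ht x fun ⟨f, hf⟩ => ?_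
  obtain ⟨hf0, h, hh⟩ := htD f hf
  have hne := nonempty_basicOpen hf0
  have hres := algebraMap_res (X.basicOpen_le f)
  obtain ⟨b, hb⟩ := (mem_divisorialSections_iff_of_isEquation hnormal hD (hU.basicOpen f) hh x).1
    (divisorialSections_mono hnormal hD (X.basicOpen_le f) (hle hx))
  have hbc : b ∈ conductorIdeal D δ r (X.basicOpen f) := by
    rw [mem_conductorIdeal_iff_of_isEquation δ r hnormal hD (hU.basicOpen f) hh, hb, mul_comm h,
      mul_inv_cancel_right₀ hh.1]
    exact minorPower_section_mono δ r (X.basicOpen_le f) hx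
  rw [← map_conductorIdeal_basicOpen δ r hnormal hD hU f] at hbc
  have := hU.isLocalization_basicOpen f
  obtain ⟨⟨a, s⟩, has⟩ := (IsLocalization.mem_map_algebraMap_iff (Submonoid.powers f)
    Γ(X, X.basicOpen f)).1 hbc
  obtain ⟨_, N, rfl⟩ := s
  have hh1 : h⁻¹ ∈ divisorialSections k D (X.basicOpen f) := by
    rw [mem_divisorialSections_iff_of_isEquation hnormal hD (hU.basicOpen f) hh,
      mul_inv_cancel₀ hh.1]
    exact one_mem _
  obtain ⟨M, hM⟩ := exists_pow_mul_mem_divisorialSections hnormal hD hU f hh1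
  refine ⟨N + M, ?_⟩
  have hab : algebraMap Γ(X, U) X.functionField a =
      algebraMap Γ(X, U) X.functionField f ^ N * (h * x) := by
    rw [← hb, ← hres, ← hres f, ← map_pow, ← map_mul, mul_comm, ← map_pow]
    exact congrArg _ has.symm
  have : f ^ (N + M) • x = a.1 • (algebraMap Γ(X, U) X.functionField f ^ M * h⁻¹) := by
    rw [Algebra.smul_def, Algebra.smul_def, hab, map_pow, pow_add]
    have := hh.1
    field_simp
  change f ^ (N + M) • x ∈ _
  rw [this]
  exact Submodule.smul_mem_smul a.2 hM

end Conductor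

/-! ### The Nash ideal and its local generators -/

section NashIdeal

variable {k : Type u} [Field k] {X : Scheme.{u}}
    [X.Over (Spec (.of k))] [LocallyOfFiniteType (X ↘ Spec (.of k))] [IsIntegral X] {n r : ℕ}
    {ω : ⋀[X.functionField]^n Ω[X.functionField⁄k]}
    {δ : Ω[X.functionField⁄k] [⋀^Fin n]→ₗ[X.functionField] X.functionField}

/-- The conductors form an ideal sheaf that satisfies the defining condition and contains every
other one that does, so the supremum is attained there. -/
theorem nashIdeal_ideal (hnormal : ∀ x : X, IsIntegrallyClosed (X.presheaf.stalk x))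
    (hD : IsCartier k (r • canonicalDivisor k n ω)) (hω : ω ≠ 0)
    (hδ : ∀ v, exteriorPower.ιMulti X.functionField n v = δ v • ω) (U : X.affineOpens) :
    (nashIdeal k n r ω).ideal U = conductorIdeal (r • canonicalDivisor k n ω) δ r U.1 := by
  let C : X.IdealSheafData :=
    { ideal := fun U => conductorIdeal (r • canonicalDivisor k n ω) δ r U.1
      map_ideal_basicOpen := fun U f => map_conductorIdeal_basicOpen δ r hnormal hD U.2 f }
  have hC : nashIdeal k n r ω = C := by
    refine IsLUB.sSup_eq (IsGreatest.isLUB ⟨fun U _ => ?_, fun I hI => ?_⟩)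
    · rw [formsImage_eq_minorPower hω hδ, Submodule.smul_le]
      intro a ha d hd
      rw [Algebra.smul_def]
      exact ha d hd
    · intro U a ha _ d hd
      have := hI U (Submodule.smul_mem_smul ha hd)
      rwa [formsImage_eq_minorPower hω hδ, Algebra.smul_def] at this
  rw [hC]

/-- An ideal sheaf is, on `U`, generated by the products of `r` coefficients of top forms with a
fixed rational function. -/
def IsNashChart (I : X.IdealSheafData)
    (δ : Ω[X.functionField⁄k] [⋀^Fin n]→ₗ[X.functionField] X.functionField) (r : ℕ)
    (U : X.affineOpens) [Nonempty U.1] : Prop :=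
  ∃ h : X.functionField, h ≠ 0 ∧ ∃ gen : (Fin r → Fin n → Ω[Γ(X, U)⁄k]) → Γ(X, U),
    (∀ v, algebraMap Γ(X, U) X.functionField (gen v) =
      h * ∏ j, δ (KaehlerDifferential.map k k Γ(X, U) X.functionField ∘ v j)) ∧
    I.ideal U = Ideal.span (Set.range gen)

theorem exists_isNashChart (hnormal : ∀ x : X, IsIntegrallyClosed (X.presheaf.stalk x))
    (hD : IsCartier k (r • canonicalDivisor k n ω)) (hω : ω ≠ 0) (hδ0 : δ ≠ 0)
    (hδ : ∀ v, exteriorPower.ιMulti X.functionField n v = δ v • ω) (x : X) :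
    ∃ (U : X.affineOpens) (_ : Nonempty U.1), x ∈ U.1 ∧
      IsNashChart (nashIdeal k n r ω) δ r U := by
  obtain ⟨W, hxW, h, h0, hh⟩ := hD x
  obtain ⟨U, hU, hx, hUW⟩ := X.isBasis_affineOpens.exists_subset_of_mem_open hxW W.2
  obtain ⟨U, hU, rfl⟩ := hU
  have hne : Nonempty U := ⟨⟨x, hx⟩⟩
  obtain ⟨gen, hgen, hspan⟩ := exists_generators_conductorIdeal δ r hnormal hD hU
    (h := h) ⟨h0, fun y hy => hh y (hUW hy)⟩ (by
      rw [← formsImage_eq_minorPower hω hδ]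
      exact formsImage_le_divisorialSections hnormal hω hδ0 hδ r U)
  exact ⟨⟨U, hU⟩, hne, hx, h, h0, gen, hgen, by rw [nashIdeal_ideal hnormal hD hω hδ, hspan]⟩

theorem nashIdeal_smul_divisorialSections
    (hnormal : ∀ x : X, IsIntegrallyClosed (X.presheaf.stalk x))
    (hD : IsCartier k (r • canonicalDivisor k n ω)) (hω : ω ≠ 0) (hδ0 : δ ≠ 0)
    (hδ : ∀ v, exteriorPower.ιMulti X.functionField n v = δ v • ω) (U : X.affineOpens)
    [Nonempty U.1] :
    (nashIdeal k n r ω).ideal U • divisorialSections k (r • canonicalDivisor k n ω) U.1 =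
      formsImage k n r ω U.1 := by
  rw [nashIdeal_ideal hnormal hD hω hδ, formsImage_eq_minorPower hω hδ]
  refine conductorIdeal_smul_divisorialSections δ r hnormal hD U.2 ?_
  rw [← formsImage_eq_minorPower hω hδ]
  exact formsImage_le_divisorialSections hnormal hω hδ0 hδ r U.1

end NashIdeal

/-! ### Inverse images of ideal sheaves -/

section IdealSheaf

theorem top_mem_affineOpens (X : Scheme.{u}) [IsAffine X] : ⊤ ∈ X.affineOpens := isAffineOpen_top X

theorem top_le_preimage_top {X Y : Scheme.{u}} (g : Y ⟶ X) : (⊤ : Y.Opens) ≤ g ⁻¹ᵁ ⊤ := le_top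

theorem exists_isAffineOpen_le {X : Scheme.{u}} {W : X.Opens} {x : X} (hx : x ∈ W) :
    ∃ U : X.Opens, IsAffineOpen U ∧ x ∈ U ∧ U ≤ W := by
  obtain ⟨_, ⟨U, hU, rfl⟩, hxU, h⟩ := X.isBasis_affineOpens.exists_subset_of_mem_open hx W.2
  exact ⟨U, hU, hxU, h⟩

theorem isAffineOpen_coe {X : Scheme.{u}} (U : X.affineOpens) : IsAffineOpen U.1 := U.2

/-- Inverse image is left adjoint to direct image, which over affine schemes is contraction of
ideals; extension is left adjoint to contraction. -/
theorem ideal_comap_top {X Y : Scheme.{u}} [IsAffine X] [IsAffine Y] (g : Y ⟶ X)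
    (J : X.IdealSheafData) :
    (J.comap g).ideal ⟨⊤, top_mem_affineOpens Y⟩ =
      (J.ideal ⟨⊤, top_mem_affineOpens X⟩).map (g.appLE ⊤ ⊤ (top_le_preimage_top _)).hom := by
  have key : ∀ I : Y.IdealSheafData, J.comap g ≤ I ↔
      (J.ideal ⟨⊤, top_mem_affineOpens X⟩).map (g.appLE ⊤ ⊤ (top_le_preimage_top _)).hom ≤
        I.ideal ⟨⊤, top_mem_affineOpens Y⟩ := by
    intro I
    rw [← Scheme.IdealSheafData.le_map_iff_comap_le, Ideal.map_le_iff_le_comap]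
    have h : (I.map g).ideal ⟨⊤, top_mem_affineOpens X⟩ =
        (I.ideal ⟨⊤, top_mem_affineOpens Y⟩).comap (g.appLE ⊤ ⊤ (top_le_preimage_top _)).hom := by
      have h1 : g.appLE ⊤ ⊤ (top_le_preimage_top _) = g.app ⊤ := g.appLE_eq_app
      rw [h1]
      exact Scheme.IdealSheafData.ideal_map_of_isAffineHom I g ⟨⊤, top_mem_affineOpens X⟩
    constructor
    · intro hJ
      exact (hJ ⟨⊤, top_mem_affineOpens X⟩).trans h.le
    · intro hJ
      exact Scheme.IdealSheafData.le_of_isAffine (hJ.trans h.ge)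
  have hK := Scheme.IdealSheafData.equivOfIsAffine.apply_symm_apply
    ((J.ideal ⟨⊤, top_mem_affineOpens X⟩).map (g.appLE ⊤ ⊤ (top_le_preimage_top _)).hom)
  exact le_antisymm (((key (Scheme.IdealSheafData.equivOfIsAffine.symm _)).2 hK.ge
    ⟨⊤, top_mem_affineOpens Y⟩).trans hK.le) ((key _).1 le_rfl)

theorem ideal_comap_eq_map_of_isOpenImmersion {X Y : Scheme.{u}} (j : Y ⟶ X) [IsOpenImmersion j]
    (I : X.IdealSheafData) (W : Y.affineOpens) (W' : X.affineOpens) (h : W'.1 = j ''ᵁ W.1)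
    (hle : W.1 ≤ j ⁻¹ᵁ W'.1) :
    (I.comap j).ideal W = (I.ideal W').map (j.appLE W'.1 W.1 hle).hom := by
  obtain rfl : W' = ⟨j ''ᵁ W.1, W.2.image_of_isOpenImmersion j⟩ := Subtype.ext h
  rw [Scheme.IdealSheafData.ideal_comap_of_isOpenImmersion]
  have h1 : (j.appLE (j ''ᵁ W.1) W.1 hle) = (j.appIso W.1).hom := (j.appIso_hom' W.1).symm
  rw [h1]
  exact (Ideal.map_comap_of_equiv (j.appIso W.1).commRingCatIsoToRingEquiv).symm

theorem ideal_comap_fromSpec {X : Scheme.{u}} (U : X.affineOpens) (I : X.IdealSheafData)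
    (hle : ⊤ ≤ (isAffineOpen_coe U).fromSpec ⁻¹ᵁ U.1) :
    (I.comap (isAffineOpen_coe U).fromSpec).ideal ⟨⊤, top_mem_affineOpens _⟩ =
      (I.ideal U).map ((isAffineOpen_coe U).fromSpec.appLE U.1 ⊤ hle).hom :=
  ideal_comap_eq_map_of_isOpenImmersion _ _ _ _
    (by rw [Scheme.Hom.image_top_eq_opensRange, (isAffineOpen_coe U).opensRange_fromSpec]) _

/-- The inverse image of an ideal sheaf, on affine opens. -/
theorem ideal_comap {X T : Scheme.{u}} (f : T ⟶ X) (I : X.IdealSheafData) (U : X.affineOpens)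
    (V : T.affineOpens) (h : V.1 ≤ f ⁻¹ᵁ U.1) :
    (I.comap f).ideal V = (I.ideal U).map (f.appLE U.1 V.1 h).hom := by
  have hU : ⊤ ≤ (isAffineOpen_coe U).fromSpec ⁻¹ᵁ U.1 :=
    (isAffineOpen_coe U).fromSpec_preimage_self.ge
  have hV : ⊤ ≤ (isAffineOpen_coe V).fromSpec ⁻¹ᵁ V.1 :=
    (isAffineOpen_coe V).fromSpec_preimage_self.ge
  -- The affine charts of `U` and `V` reduce the claim to a morphism of affine schemes; the chart of
  -- `V` is an isomorphism on sections, so extension of ideals along it is injective.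
  have hcomp : Spec.map (f.appLE U.1 V.1 h) ≫ (isAffineOpen_coe U).fromSpec =
      (isAffineOpen_coe V).fromSpec ≫ f :=
    (isAffineOpen_coe U).SpecMap_appLE_fromSpec f (isAffineOpen_coe V) h
  have h1 := ideal_comap_fromSpec V (I.comap f) hV
  rw [← Scheme.IdealSheafData.comap_comp, ← hcomp, Scheme.IdealSheafData.comap_comp,
    ideal_comap_top, ideal_comap_fromSpec U I hU, Ideal.map_map, ← CommRingCat.hom_comp] at h1
  have h2 : (isAffineOpen_coe U).fromSpec.appLE U.1 ⊤ hU ≫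
      (Spec.map (f.appLE U.1 V.1 h)).appLE ⊤ ⊤ (top_le_preimage_top _) =
      f.appLE U.1 V.1 h ≫ (isAffineOpen_coe V).fromSpec.appLE V.1 ⊤ hV := by
    rw [Scheme.Hom.appLE_comp_appLE, Scheme.Hom.appLE_comp_appLE]
    simp only [hcomp]
  rw [h2, CommRingCat.hom_comp, ← Ideal.map_map] at h1
  have : IsIso ((isAffineOpen_coe V).fromSpec.appLE V.1 ⊤ hV) := by
    rw [Scheme.Hom.appLE]
    have : IsIso ((Spec Γ(T, V.1)).presheaf.map (homOfLE hV).op) := by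
      have : (homOfLE hV) = eqToHom (isAffineOpen_coe V).fromSpec_preimage_self.symm := rfl
      rw [this]; infer_instance
    rw [(isAffineOpen_coe V).fromSpec_app_self]
    infer_instance
  have hbij := ConcreteCategory.bijective_of_isIso ((isAffineOpen_coe V).fromSpec.appLE V.1 ⊤ hV)
  have hinj : Function.Injective
      (Ideal.map ((isAffineOpen_coe V).fromSpec.appLE V.1 ⊤ hV).hom) := by
    intro a b hab
    let e := RingEquiv.ofBijective ((isAffineOpen_coe V).fromSpec.appLE V.1 ⊤ hV).hom hbij
    have he : ∀ c : Ideal Γ(T, V.1),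
        (c.map ((isAffineOpen_coe V).fromSpec.appLE V.1 ⊤ hV).hom).comap
          ((isAffineOpen_coe V).fromSpec.appLE V.1 ⊤ hV).hom = c := fun c =>
      Ideal.comap_map_of_bijective _ hbij
    rw [← he a, hab, he]
  exact (hinj h1).symm ▸ rfl

theorem map_mem_nonZeroDivisors_of_flat {R S : Type u} [CommRing R] [CommRing S] (φ : R →+* S)
    (hφ : φ.Flat) {a : R} (ha : a ∈ nonZeroDivisors R) : φ a ∈ nonZeroDivisors S := by
  algebraize [φ]
  rw [mem_nonZeroDivisors_iff_right]
  intro x hx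
  have := Module.Flat.isSMulRegular_of_nonZeroDivisors (M := S) ha
  refine this ?_
  change a • x = a • 0
  rw [smul_zero, Algebra.smul_def, mul_comm]
  exact hx

theorem IsInvertibleIdeal.comap_of_flat {X Y : Scheme.{u}} {J : X.IdealSheafData}
    (hJ : IsInvertibleIdeal J) (j : Y ⟶ X) [Flat j] : IsInvertibleIdeal (J.comap j) := by
  intro y
  obtain ⟨V, hyV, a, ha, hJV⟩ := hJ (j y)
  obtain ⟨W, hW, hyW, hWV⟩ := exists_isAffineOpen_le (show y ∈ j ⁻¹ᵁ V.1 from hyV)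
  refine ⟨⟨W, hW⟩, hyW, j.appLE V.1 W hWV a, ?_, ?_⟩
  · exact map_mem_nonZeroDivisors_of_flat _ (j.flat_appLE V.2 hW hWV) ha
  · rw [ideal_comap j J V ⟨W, hW⟩ hWV, hJV, Ideal.map_span, Set.image_singleton]

/-- A morphism from a reduced scheme factors through a reduced closed subscheme containing its
image. -/
theorem exists_comp_subschemeι_vanishingIdeal {Y G : Scheme.{u}} [IsReduced Y] (g : Y ⟶ G)
    (Z : TopologicalSpace.Closeds G) (h : ∀ y, g y ∈ Z) :
    ∃ g' : Y ⟶ (Scheme.IdealSheafData.vanishingIdeal Z).subscheme,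
      g' ≫ (Scheme.IdealSheafData.vanishingIdeal Z).subschemeι = g := by
  have hker : (Scheme.IdealSheafData.vanishingIdeal Z).subschemeι.ker ≤ g.ker := by
    rw [Scheme.IdealSheafData.ker_subschemeι, ← Scheme.IdealSheafData.map_bot,
      ← Scheme.nilradical_eq_bot, ← Scheme.IdealSheafData.vanishingIdeal_top,
      Scheme.IdealSheafData.map_vanishingIdeal]
    refine Scheme.IdealSheafData.vanishingIdeal_antimono ?_
    rw [TopologicalSpace.Closeds.closure_le]
    rintro _ ⟨y, -, rfl⟩
    exact h y
  exact ⟨_, IsClosedImmersion.lift_fac _ _ hker⟩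

end IdealSheaf

/-! ### Morphisms -/

section Hom

/-- Closed points of the stalk spectra show that the maps agree on points; on a common affine
neighbourhood the maps of sections agree because their germs do. -/
theorem ext_of_fromSpecStalk {T Y : Scheme.{u}} {f g : T ⟶ Y}
    (h : ∀ t, T.fromSpecStalk t ≫ f = T.fromSpecStalk t ≫ g) : f = g := by
  have hpt : ∀ t, f t = g t := by
    intro t
    have h1 := congrArg (fun φ : Spec (T.presheaf.stalk t) ⟶ Y =>
      φ (IsLocalRing.closedPoint (T.presheaf.stalk t))) (h t)
    change f (T.fromSpecStalk t _) = g (T.fromSpecStalk t _) at h1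
    rwa [Scheme.fromSpecStalk_closedPoint] at h1
  refine Scheme.hom_ext_of_forall _ _ fun t => ?_
  obtain ⟨V, hV, htV, -⟩ := exists_isAffineOpen_le (show f t ∈ (⊤ : Y.Opens) from trivial)
  have htg : g t ∈ V := hpt t ▸ htV
  obtain ⟨W, hW, htW, hWV⟩ := exists_isAffineOpen_le
    (show t ∈ f ⁻¹ᵁ V ⊓ g ⁻¹ᵁ V from ⟨htV, htg⟩)
  have hWf : W ≤ f ⁻¹ᵁ V := fun x hx => (hWV hx).1
  have hWg : W ≤ g ⁻¹ᵁ V := fun x hx => (hWV hx).2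
  refine ⟨W, htW, ?_⟩
  have key : f.appLE V W hWf = g.appLE V W hWg := by
    ext a
    refine TopCat.Presheaf.section_ext T.sheaf W _ _ fun x hx => ?_
    have h1 : f.appLE V W hWf ≫ T.presheaf.germ W x hx =
        g.appLE V W hWg ≫ T.presheaf.germ W x hx := by
      apply Spec.map_injective
      rw [← cancel_mono hV.fromSpec, Spec.map_comp, Spec.map_comp, Category.assoc, Category.assoc,
        hV.SpecMap_appLE_fromSpec f hW hWf, hV.SpecMap_appLE_fromSpec g hW hWg]
      have h2 := h x
      rw [← hW.fromSpecStalk_eq_fromSpecStalk hx, IsAffineOpen.fromSpecStalk, Category.assoc,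
        Category.assoc] at h2
      exact h2
    exact ConcreteCategory.congr_hom h1 a
  rw [← cancel_epi hW.isoSpec.inv, ← Category.assoc, ← Category.assoc, hW.isoSpec_inv_ι,
    ← hV.SpecMap_appLE_fromSpec f hW hWf, ← hV.SpecMap_appLE_fromSpec g hW hWg, key]

/-- Local factorisations glue if factorisations are unique on all open subschemes. -/
theorem existsUnique_of_local {X B T : Scheme.{u}} (b : B ⟶ X) (f : T ⟶ X)
    (huniq : ∀ (T' : Scheme.{u}) (j : T' ⟶ T) [IsOpenImmersion j] (g g' : T' ⟶ B),
      g ≫ b = j ≫ f → g' ≫ b = j ≫ f → g = g')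
    (hloc : ∀ t : T, ∃ (V : T.affineOpens) (g : Spec Γ(T, V) ⟶ B),
      t ∈ V.1 ∧ g ≫ b = (isAffineOpen_coe V).fromSpec ≫ f) : ∃! g : T ⟶ B, g ≫ b = f := by
  choose V g htV hg using hloc
  let 𝒰 : T.OpenCover := {
    I₀ := T, X t := Spec Γ(T, (V t).1), f t := (isAffineOpen_coe (V t)).fromSpec,
    mem₀ := by
      rw [Scheme.presieve₀_mem_precoverage_iff]
      refine ⟨fun x => ⟨x, ?_⟩, inferInstance⟩
      have := htV x
      rw [← SetLike.mem_coe, ← (isAffineOpen_coe (V x)).range_fromSpec] at this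
      exact this }
  have hcompat : ∀ x y, Limits.pullback.fst (𝒰.f x) (𝒰.f y) ≫ g x =
      Limits.pullback.snd _ _ ≫ g y := by
    intro x y
    refine huniq _ (Limits.pullback.fst (𝒰.f x) (𝒰.f y) ≫ 𝒰.f x) _ _ ?_ ?_
    · rw [Category.assoc, hg, Category.assoc]
    · rw [Category.assoc, hg, Limits.pullback.condition, Category.assoc]
  refine ⟨𝒰.glueMorphisms g hcompat, ?_, fun g' hg' => ?_⟩
  · refine 𝒰.hom_ext _ _ fun x => ?_
    rw [← Category.assoc, 𝒰.ι_glueMorphisms, hg]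
  · refine huniq T (𝟙 T) _ _ (by rw [hg', Category.id_comp]) ?_
    rw [Category.id_comp]
    refine 𝒰.hom_ext _ _ fun x => ?_
    rw [← Category.assoc, 𝒰.ι_glueMorphisms, hg]

end Hom

/-! ### Differentials on the smooth locus -/

section Smooth

variable (k : Type u) [Field k] {X : Scheme.{u}} [X.Over (Spec (.of k))]
  [LocallyOfFiniteType (X ↘ Spec (.of k))]

/-- Smoothness at every point of `U` gives formal smoothness over the global sections of `Spec k`,
which are then identified with `k`. -/
theorem formallySmooth_section (U : X.affineOpens)
    (hU : U.1 ≤ (X ↘ Spec (.of k)).smoothLocus) : Algebra.FormallySmooth k Γ(X, U) := by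
  let S := Γ(Spec (.of k), ⊤)
  let : Algebra S Γ(X, U) := ((X ↘ Spec (.of k)).appLE ⊤ U.1 le_top).hom.toAlgebra
  let : Algebra k S := (Scheme.ΓSpecIso (.of k)).inv.hom.toAlgebra
  have : IsScalarTower k S Γ(X, U) := IsScalarTower.of_algebraMap_eq fun _ => rfl
  have hb : Function.Bijective (algebraMap k S) :=
    ConcreteCategory.bijective_of_isIso (Scheme.ΓSpecIso (.of k)).inv
  have : Algebra.FormallySmooth k S :=
    Algebra.FormallySmooth.of_equiv (AlgEquiv.ofBijective (Algebra.ofId k S) hb)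
  have : Algebra.FinitePresentation S Γ(X, U) :=
    (X ↘ Spec (.of k)).finitePresentation_appLE (isAffineOpen_top _) U.2 le_top
  have : Algebra.FormallySmooth S Γ(X, U) := by
    rw [← Algebra.smoothLocus_eq_univ_iff, Set.eq_univ_iff_forall]
    intro p
    obtain ⟨y, hy, hloc⟩ := isLocalization_stalk_fromSpec U p
    have h1 := (formallySmooth_stalkMap_iff (f := X ↘ Spec (.of k)) ⊤ (isAffineOpen_top _) U.1 U.2
      le_top y.2).1 (hU y.2)
    have h2 : U.2.primeIdealOf y = p := by
      apply U.2.isOpenImmersion_fromSpec.base_open.injective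
      exact (U.2.fromSpec_primeIdealOf y).trans hy.symm
    rw [← h2]
    exact h1
  exact Algebra.FormallySmooth.comp k S Γ(X, U)

variable [IsIntegral X] {n : ℕ}

theorem finrank_tensor_differentials (k : Type u) [Field k] {X : Scheme.{u}}
    [X.Over (Spec (.of k))] [IsIntegral X] {n : ℕ}
    [Module.Finite X.functionField Ω[X.functionField⁄k]]
    (hn : Module.finrank X.functionField Ω[X.functionField⁄k] = n) (U : X.affineOpens)
    [Nonempty U.1] (L : Type u) [Field L] [Algebra Γ(X, U) L]
    (hL : Function.Injective (algebraMap Γ(X, U) L)) :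
    Module.Finite L (L ⊗[Γ(X, U)] Ω[Γ(X, U)⁄k]) ∧
      Module.finrank L (L ⊗[Γ(X, U)] Ω[Γ(X, U)⁄k]) = n := by
  have := functionField_isFractionRing_of_isAffineOpen X U.1 U.2
  have : IsLocalizedModule (nonZeroDivisors Γ(X, U))
    (KaehlerDifferential.map k k Γ(X, U) X.functionField) :=
    KaehlerDifferential.isLocalizedModule_map k _ _ _
  have h := finrank_tensor_of_isLocalizedModule (K := X.functionField)
    (KaehlerDifferential.map k k Γ(X, U) X.functionField) L hL
  exact ⟨h.1, h.2.trans hn⟩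

theorem grassmannian_subsingleton_of_injective (k : Type u) [Field k] {X : Scheme.{u}}
    [X.Over (Spec (.of k))] [IsIntegral X] {n : ℕ}
    [Module.Finite X.functionField Ω[X.functionField⁄k]]
    (hn : Module.finrank X.functionField Ω[X.functionField⁄k] = n) (U : X.affineOpens)
    [Nonempty U.1] (B : Type u) [CommRing B] [IsDomain B] [Algebra Γ(X, U) B]
    (hB : Function.Injective (algebraMap Γ(X, U) B)) :
    Subsingleton (Module.Grassmannian B (B ⊗[Γ(X, U)] Ω[Γ(X, U)⁄k]) n) := by
  have hBL : Function.Injective (algebraMap B (FractionRing B)) := IsFractionRing.injective _ _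
  have hL : Function.Injective (algebraMap Γ(X, U) (FractionRing B)) := by
    rw [IsScalarTower.algebraMap_eq Γ(X, U) B]
    exact hBL.comp hB
  obtain ⟨_, h⟩ := finrank_tensor_differentials k hn U (FractionRing B) hL
  exact grassmannian_subsingleton hBL h

/-- On the smooth locus `Ω` is locally free; its rank at any point equals the rank at the generic
point below it. -/
theorem rankAtStalk_differentials [Module.Finite X.functionField Ω[X.functionField⁄k]]
    (hn : Module.finrank X.functionField Ω[X.functionField⁄k] = n) (U : X.affineOpens)
    [Nonempty U.1] (hU : U.1 ≤ (X ↘ Spec (.of k)).smoothLocus)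
    (p : PrimeSpectrum Γ(X, U)) : Module.rankAtStalk Ω[Γ(X, U)⁄k] p = n := by
  have := formallySmooth_section k U hU
  have := finiteType_section k U
  rw [← Module.rankAtStalk_eq_of_le_of_finite_of_flat _ (bot_le : ⊥ ≤ p)]
  obtain ⟨_, h⟩ := finrank_tensor_differentials k hn U (FractionRing Γ(X, U))
    (IsFractionRing.injective _ _)
  have h1 := Module.rankAtStalk_baseChange (R := Γ(X, U)) (S := FractionRing Γ(X, U))
    (M := Ω[Γ(X, U)⁄k]) ⊥
  rw [Module.rankAtStalk_eq_finrank_of_free] at h1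
  have h2 : (⊥ : PrimeSpectrum (FractionRing Γ(X, U))).comap
      (algebraMap Γ(X, U) (FractionRing Γ(X, U))) = ⊥ := by
    ext1
    exact (RingHom.injective_iff_ker_eq_bot _).1 (IsFractionRing.injective _ _)
  rw [h2] at h1
  rw [← h1, ← h]
  rfl

/-- On the smooth locus `Ω` is its own locally free quotient of rank `n`, so the zero submodule is a
point; it yields a section of `π` over `U`. -/
theorem nonempty_grassmannian_of_le_smoothLocus
    [Module.Finite X.functionField Ω[X.functionField⁄k]]
    (hn : Module.finrank X.functionField Ω[X.functionField⁄k] = n) (U : X.affineOpens)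
    [Nonempty U.1] (hU : U.1 ≤ (X ↘ Spec (.of k)).smoothLocus) :
    Nonempty (Module.Grassmannian Γ(X, U) (Γ(X, U) ⊗[Γ(X, U)] Ω[Γ(X, U)⁄k]) n) := by
  have := formallySmooth_section k U hU
  have := finiteType_section k U
  let e : ((Γ(X, U) ⊗[Γ(X, U)] Ω[Γ(X, U)⁄k]) ⧸
      (⊥ : Submodule Γ(X, U) (Γ(X, U) ⊗[Γ(X, U)] Ω[Γ(X, U)⁄k]))) ≃ₗ[Γ(X, U)] Ω[Γ(X, U)⁄k] :=
    (Submodule.quotEquivOfEqBot _ rfl).trans (TensorProduct.lid _ _)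
  exact ⟨⟨⊥, Module.Finite.equiv e.symm, Module.Projective.of_equiv e.symm, fun p => by
    rw [Module.rankAtStalk_eq_of_equiv e, rankAtStalk_differentials k hn U hU]⟩⟩

theorem grassmannian_subsingleton_of_le_smoothLocus
    [Module.Finite X.functionField Ω[X.functionField⁄k]]
    (hn : Module.finrank X.functionField Ω[X.functionField⁄k] = n) (U : X.affineOpens)
    [Nonempty U.1] (hU : U.1 ≤ (X ↘ Spec (.of k)).smoothLocus) (F : Type u) [Field F]
    [Algebra Γ(X, U) F] :
    Subsingleton (Module.Grassmannian F (F ⊗[Γ(X, U)] Ω[Γ(X, U)⁄k]) n) := by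
  have := formallySmooth_section k U hU
  have := finiteType_section k U
  have h1 := Module.rankAtStalk_baseChange (R := Γ(X, U)) (S := F) (M := Ω[Γ(X, U)⁄k]) ⊥
  rw [Module.rankAtStalk_eq_finrank_of_free, rankAtStalk_differentials k hn U hU] at h1
  exact grassmannian_subsingleton (L := F) Function.injective_id h1

end Smooth

/-! ### Points of the Grassmannian bundle -/

section Points

variable {k : Type u} [Field k] {X : Scheme.{u}} [X.Over (Spec (.of k))] {n : ℕ}
  (G : GrassmannianBundle k X n)

theorem GrassmannianBundle.hom_ext_of_subsingleton (U : X.affineOpens) (A : Type u) [CommRing A]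
    [Algebra Γ(X, U) A] (h : Subsingleton (Module.Grassmannian A (A ⊗[Γ(X, U)] Ω[Γ(X, U)⁄k]) n))
    {g g' : Spec (.of A) ⟶ G.space}
    (hg : g ≫ G.π = Spec.map (CommRingCat.ofHom (algebraMap Γ(X, U) A)) ≫ U.2.fromSpec)
    (hg' : g' ≫ G.π = Spec.map (CommRingCat.ofHom (algebraMap Γ(X, U) A)) ≫ U.2.fromSpec) :
    g = g' :=
  congrArg Subtype.val ((G.points U A).injective
    (Subsingleton.elim (G.points U A ⟨g, hg⟩) (G.points U A ⟨g', hg'⟩)))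

theorem GrassmannianBundle.exists_hom (U : X.affineOpens) (A : Type u) [CommRing A]
    [Algebra Γ(X, U) A] (h : Nonempty (Module.Grassmannian A (A ⊗[Γ(X, U)] Ω[Γ(X, U)⁄k]) n)) :
    ∃ g : Spec (.of A) ⟶ G.space,
      g ≫ G.π = Spec.map (CommRingCat.ofHom (algebraMap Γ(X, U) A)) ≫ U.2.fromSpec :=
  ⟨_, ((G.points U A).symm h.some).2⟩

theorem fromSpec_bot {X : Scheme.{u}} [IsIntegral X] (U : X.affineOpens) [Nonempty U.1] :
    U.2.fromSpec (⊥ : PrimeSpectrum Γ(X, U)) = genericPoint X := by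
  have := U.2.isOpenImmersion_fromSpec
  rw [← genericPoint_eq_bot_of_affine, genericPoint_eq_of_isOpenImmersion]

theorem algebraMap_injective_of_apply_eq_genericPoint {X : Scheme.{u}} [IsIntegral X]
    (U : X.affineOpens) [Nonempty U.1] (B : Type u) [CommRing B] [Algebra Γ(X, U) B]
    (p : PrimeSpectrum B)
    (h : (Spec.map (CommRingCat.ofHom (algebraMap Γ(X, U) B)) ≫ U.2.fromSpec) p =
      genericPoint X) : Function.Injective (algebraMap Γ(X, U) B) := by
  have := U.2.isOpenImmersion_fromSpec
  rw [← fromSpec_bot U] at h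
  have h1 : PrimeSpectrum.comap (algebraMap Γ(X, U) B) p = ⊥ :=
    this.base_open.injective h
  rw [RingHom.injective_iff_ker_eq_bot, eq_bot_iff]
  intro a ha
  have h2 : a ∈ (PrimeSpectrum.comap (algebraMap Γ(X, U) B) p).asIdeal := by
    rw [PrimeSpectrum.comap_asIdeal, Ideal.mem_comap, RingHom.mem_ker.1 ha]
    exact zero_mem _
  rwa [h1] at h2

variable [LocallyOfFiniteType (X ↘ Spec (.of k))] [IsIntegral X]

/-- The generic point of `Spec B` maps to that of `X`, which is in the smooth locus as `k` is
perfect; every other point is a specialisation of it. -/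
theorem apply_mem_closureRegular [CharZero k] (U : X.affineOpens) [Nonempty U.1] (B : Type u)
    [CommRing B] [IsDomain B] [Algebra Γ(X, U) B]
    (hB : Function.Injective (algebraMap Γ(X, U) B)) {g : Spec (.of B) ⟶ G.space}
    (hg : g ≫ G.π = Spec.map (CommRingCat.ofHom (algebraMap Γ(X, U) B)) ≫ U.2.fromSpec)
    (y : Spec (.of B)) : g y ∈ G.closureRegular := by
  let z : Spec (.of B) := (⊥ : PrimeSpectrum B)
  have h1 : z ⤳ y := (PrimeSpectrum.le_iff_specializes ⊥ y).1 bot_le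
  have h2 : g z ∈ G.π ⁻¹' ((X ↘ Spec (.of k)).smoothLocus : Set X) := by
    have h3 : G.π (g z) = genericPoint X := by
      rw [← Scheme.Hom.comp_apply, hg, ← fromSpec_bot U, Scheme.Hom.comp_apply]
      congr 1
      exact PrimeSpectrum.ext ((RingHom.injective_iff_ker_eq_bot _).1 hB)
    change G.π (g z) ∈ ((X ↘ Spec (.of k)).smoothLocus : Set X)
    rw [h3]
    exact Scheme.Hom.genericPoint_mem_smoothLocus_of_perfectField _
  exact (h1.map g.continuous).mem_closed isClosed_closure (subset_closure h2)

theorem exists_lift_nashBlowup [CharZero k] (U : X.affineOpens) [Nonempty U.1] (B : Type u)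
    [CommRing B] [IsDomain B] [Algebra Γ(X, U) B]
    (hB : Function.Injective (algebraMap Γ(X, U) B)) {g : Spec (.of B) ⟶ G.space}
    (hg : g ≫ G.π = Spec.map (CommRingCat.ofHom (algebraMap Γ(X, U) B)) ≫ U.2.fromSpec) :
    ∃ g' : Spec (.of B) ⟶ nashBlowup G,
      g' ≫ (Scheme.IdealSheafData.vanishingIdeal G.closureRegular).subschemeι = g :=
  exists_comp_subschemeι_vanishingIdeal g _ (apply_mem_closureRegular G U B hB hg)

/-- Over an affine open of the smooth locus, all points of the Grassmannian bundle specialise one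
point over the generic point. -/
theorem exists_specializes_of_le_smoothLocus
    [Module.Finite X.functionField Ω[X.functionField⁄k]]
    (hn : Module.finrank X.functionField Ω[X.functionField⁄k] = n) (U : X.affineOpens)
    [Nonempty U.1] (hU : U.1 ≤ (X ↘ Spec (.of k)).smoothLocus) :
    ∃ z₀ : G.space, G.π z₀ = genericPoint X ∧ ∀ z : G.space, G.π z ∈ U.1 → z₀ ⤳ z := by
  obtain ⟨σ, hσ⟩ := G.exists_hom U Γ(X, U) (nonempty_grassmannian_of_le_smoothLocus k hn U hU)
  have hσ' : σ ≫ G.π = U.2.fromSpec := by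
    have : Spec.map (CommRingCat.ofHom (algebraMap Γ(X, U) Γ(X, U))) = 𝟙 _ := Spec.map_id _
    rw [hσ, this]
    exact Category.id_comp _
  let b : Spec (.of Γ(X, U)) := (⊥ : PrimeSpectrum Γ(X, U))
  refine ⟨σ b, ?_, fun z hz => ?_⟩
  · rw [← Scheme.Hom.comp_apply, hσ']
    exact fromSpec_bot U
  let κ := G.space.residueField z
  let j : Spec κ ⟶ G.space := G.space.fromSpecResidueField z
  have hj : ∀ y, (j ≫ G.π) y ∈ U.1 := by
    intro y
    rw [Scheme.Hom.comp_apply]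
    have : j y = z := by
      have : j y ∈ Set.range j := ⟨y, rfl⟩
      rwa [Scheme.range_fromSpecResidueField] at this
    rwa [this]
  have := U.2.isOpenImmersion_fromSpec
  have hrange : Set.range (j ≫ G.π) ⊆ Set.range U.2.fromSpec := by
    rw [U.2.range_fromSpec]
    rintro _ ⟨y, rfl⟩
    exact hj y
  let l : Spec κ ⟶ Spec Γ(X, U) := IsOpenImmersion.lift U.2.fromSpec (j ≫ G.π) hrange
  have hl : l ≫ U.2.fromSpec = j ≫ G.π := IsOpenImmersion.lift_fac _ _ _
  let φ : Γ(X, U) ⟶ κ := Spec.preimage l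
  have hφ : Spec.map φ = l := Spec.map_preimage l
  let : Algebra Γ(X, U) κ := φ.hom.toAlgebra
  -- Over a field the fibre of `Ω` already has dimension `n`, so its only quotient of that rank is
  -- itself. Hence `z` lies on the section `σ`.
  have h1 : j = l ≫ σ := by
    refine G.hom_ext_of_subsingleton U κ
      (grassmannian_subsingleton_of_le_smoothLocus k hn U hU κ) (g := j) (g' := l ≫ σ) ?_ ?_
    · rw [← hl, ← hφ]; rfl
    · rw [Category.assoc, hσ', ← hφ]; rfl
  obtain ⟨y, hy⟩ : ∃ y, j y = z := by
    have : z ∈ Set.range j := by rw [Scheme.range_fromSpecResidueField]; rfl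
    exact this
  rw [← hy, h1, Scheme.Hom.comp_apply]
  refine Specializes.map ?_ σ.continuous
  exact (PrimeSpectrum.le_iff_specializes ⊥ (l y)).1 bot_le

/-- The points obtained over the various affine opens of the smooth locus are all specialisations of
one of them, because each lies over the generic point of `X`. So the closure is irreducible. -/
theorem exists_closure_singleton_eq_closureRegular [CharZero k]
    [Module.Finite X.functionField Ω[X.functionField⁄k]]
    (hn : Module.finrank X.functionField Ω[X.functionField⁄k] = n) :
    ∃ z₀ : G.space, G.π z₀ = genericPoint X ∧
      closure {z₀} = (G.closureRegular : Set G.space) := by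
  have hη : genericPoint X ∈ (X ↘ Spec (.of k)).smoothLocus :=
    Scheme.Hom.genericPoint_mem_smoothLocus_of_perfectField _
  obtain ⟨U₀, hU₀, hηU₀, hle₀⟩ := exists_isAffineOpen_le hη
  have : Nonempty U₀ := ⟨⟨_, hηU₀⟩⟩
  obtain ⟨z₀, hz₀, h₀⟩ := exists_specializes_of_le_smoothLocus G hn ⟨U₀, hU₀⟩ hle₀
  refine ⟨z₀, hz₀, le_antisymm ?_ ?_⟩
  · refine closure_mono ?_
    rintro _ rfl
    change G.π _ ∈ ((X ↘ Spec (.of k)).smoothLocus : Set X)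
    rw [hz₀]
    exact hη
  · refine closure_minimal ?_ isClosed_closure
    intro z hz
    obtain ⟨U, hU, hzU, hle⟩ := exists_isAffineOpen_le (show G.π z ∈ _ from hz)
    have : Nonempty U := ⟨⟨_, hzU⟩⟩
    obtain ⟨z₁, hz₁, h₁⟩ := exists_specializes_of_le_smoothLocus G hn ⟨U, hU⟩ hle
    have h2 : z₀ ⤳ z₁ := h₀ z₁ (by rw [hz₁]; exact hηU₀)
    exact (h2.trans (h₁ z hzU)).mem_closed isClosed_closure (subset_closure rfl)

theorem isReduced_subscheme_vanishingIdeal {Y : Scheme.{u}} (Z : TopologicalSpace.Closeds Y) :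
    IsReduced (Scheme.IdealSheafData.vanishingIdeal Z).subscheme := by
  have hst : ∀ x : (Scheme.IdealSheafData.vanishingIdeal Z).subscheme, _root_.IsReduced
      ((Scheme.IdealSheafData.vanishingIdeal Z).subscheme.presheaf.stalk x) := by
    intro x
    let 𝒰 := (Scheme.IdealSheafData.vanishingIdeal Z).subschemeCover
    obtain ⟨i, y, rfl⟩ := 𝒰.openCover.exists_eq x
    have hred : IsReduced (𝒰.openCover.X i) := by
      have : _root_.IsReduced (Γ(Y, i.1) ⧸ (Scheme.IdealSheafData.vanishingIdeal Z).ideal i) := by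
        rw [← Ideal.isRadical_iff_quotient_reduced]
        exact PrimeSpectrum.isRadical_vanishingIdeal _
      exact inferInstanceAs (IsReduced (Spec (.of
        (Γ(Y, i.1) ⧸ (Scheme.IdealSheafData.vanishingIdeal Z).ideal i))))
    exact isReduced_of_injective ((𝒰.openCover.f i).stalkMap y).hom
      (ConcreteCategory.bijective_of_isIso ((𝒰.openCover.f i).stalkMap y)).injective
  exact isReduced_of_isReduced_stalk _

/-- The generic point of the closure is the unique generic point of its reduced structure, and it
maps to the generic point of `X`. -/
theorem isIntegral_nashBlowup [CharZero k]
    [Module.Finite X.functionField Ω[X.functionField⁄k]]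
    (hn : Module.finrank X.functionField Ω[X.functionField⁄k] = n) :
    ∃ _ : IsIntegral (nashBlowup G),
      nashBlowupMap G (genericPoint (nashBlowup G)) = genericPoint X := by
  obtain ⟨z₀, hz₀, hcl⟩ := exists_closure_singleton_eq_closureRegular G hn
  have hred : IsReduced (nashBlowup G) := isReduced_subscheme_vanishingIdeal _
  let ι : nashBlowup G ⟶ G.space :=
    (Scheme.IdealSheafData.vanishingIdeal G.closureRegular).subschemeι
  have : IsClosedImmersion ι := inferInstanceAs (IsClosedImmersion
    (Scheme.IdealSheafData.vanishingIdeal G.closureRegular).subschemeι)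
  have hemb : Topology.IsClosedEmbedding ι := ι.isClosedEmbedding
  have hrange : Set.range ι = closure {z₀} := by
    rw [hcl]
    exact (Scheme.IdealSheafData.range_subschemeι _).trans
      (Scheme.IdealSheafData.coe_support_vanishingIdeal _)
  obtain ⟨z, hz⟩ : z₀ ∈ Set.range ι := hrange ▸ subset_closure rfl
  have hgen : IsGenericPoint z Set.univ := by
    rw [isGenericPoint_def, hemb.isInducing.closure_eq_preimage_closure_image,
      Set.image_singleton, hz, ← hrange, Set.preimage_range]
  have hirr : IrreducibleSpace (nashBlowup G) :=
    { toPreirreducibleSpace := ⟨hgen.isIrreducible.2⟩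
      toNonempty := ⟨z⟩ }
  have hint : IsIntegral (nashBlowup G) := isIntegral_of_irreducibleSpace_of_isReduced _
  refine ⟨hint, ?_⟩
  rw [(genericPoint_spec (nashBlowup G)).eq hgen]
  change G.π (ι z) = _
  rw [hz, hz₀]

end Points

/-! ### Charts of the Nash ideal and points of the Grassmannian bundle -/

section Generators

/-- Generators of an ideal `J` of a `k`-algebra `R` which control the locally free quotients of
rank `n` of the pullbacks of `Ω_R` to `R`-algebras. -/
structure IsPluckerGenerators (k : Type u) [Field k] (n : ℕ) {R : Type u} [CommRing R]
    [Algebra k R] (J : Ideal R) (S : Set R) : Prop where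
  span_eq : Ideal.span S = J
  nonempty_grassmannian (p : R) (hp : p ∈ S) (A : Type u) [CommRing A] [Nontrivial A] [Algebra R A]
    (hA : algebraMap R A p ∈ nonZeroDivisors A)
    (hdvd : ∀ x ∈ J, algebraMap R A p ∣ algebraMap R A x) :
    Nonempty (Module.Grassmannian A (A ⊗[R] Ω[R⁄k]) n)
  exists_generator (B : Type u) [CommRing B] [IsDomain B] [IsLocalRing B] [Algebra R B]
    (hB : Function.Injective (algebraMap R B)) (N : Module.Grassmannian B (B ⊗[R] Ω[R⁄k]) n) :
    ∃ p ∈ S, p ≠ 0 ∧ ∀ x ∈ J, algebraMap R B p ∣ algebraMap R B x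

theorem dvd_of_mem_span {R A : Type u} [CommRing R] [CommRing A] [Algebra R A] {S : Set R} {a : A}
    (h : ∀ x ∈ S, a ∣ algebraMap R A x) {x : R} (hx : x ∈ Ideal.span S) : a ∣ algebraMap R A x := by
  have hle : Ideal.span S ≤ (Ideal.span {a}).comap (algebraMap R A) :=
    Ideal.span_le.2 fun y hy => Ideal.mem_span_singleton.2 (h y hy)
  exact Ideal.mem_span_singleton.1 (hle hx)

theorem IsNashChart.exists_isPluckerGenerators {k : Type u} [Field k] {X : Scheme.{u}}
    [X.Over (Spec (.of k))] [IsIntegral X] {n r : ℕ} {I : X.IdealSheafData}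
    {δ : Ω[X.functionField⁄k] [⋀^Fin n]→ₗ[X.functionField] X.functionField}
    {U : X.affineOpens} [Nonempty U.1] (hI : IsNashChart I δ r U)
    [Module.Finite X.functionField Ω[X.functionField⁄k]]
    (hn : Module.finrank X.functionField Ω[X.functionField⁄k] = n) (hδ : δ ≠ 0) (hr : 0 < r) :
    ∃ S, IsPluckerGenerators k n (I.ideal U) S := by
  obtain ⟨h, h0, gen, hgen, hspan⟩ := hI
  have := functionField_isFractionRing_of_isAffineOpen X U.1 U.2
  have : IsLocalizedModule (nonZeroDivisors Γ(X, U))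
    (KaehlerDifferential.map k k Γ(X, U) X.functionField) :=
    KaehlerDifferential.isLocalizedModule_map k _ _ _
  refine ⟨Set.range gen, hspan.symm, ?_, ?_⟩
  · rintro _ ⟨v, rfl⟩ A _ _ _ hA hdvd
    exact nonempty_grassmannian_of_generator
      (KaehlerDifferential.map k k Γ(X, U) X.functionField) δ h gen hgen hr v hA
      fun w => hdvd _ (hspan ▸ Ideal.subset_span ⟨w, rfl⟩)
  · intro B _ _ _ _ hB N
    obtain ⟨v, hv, hdvd⟩ := exists_generator_of_grassmannian
      (KaehlerDifferential.map k k Γ(X, U) X.functionField) δ h gen hgen hn hδ h0 hB N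
    refine ⟨gen v, ⟨v, rfl⟩, hv, fun x hx => ?_⟩
    rw [hspan] at hx
    refine dvd_of_mem_span ?_ hx
    rintro _ ⟨w, rfl⟩
    exact hdvd w

end Generators

/-! ### Lifts through affine blow-up algebras -/

section Lifts

/-- The structure morphism to `X` of an algebra over the sections over an affine open. -/
abbrev specHom {X : Scheme.{u}} (U : X.affineOpens) (A : Type u) [CommRing A] [Algebra Γ(X, U) A] :
    Spec (.of A) ⟶ X :=
  Spec.map (CommRingCat.ofHom (algebraMap Γ(X, U) A)) ≫ U.2.fromSpec

theorem specMap_comp_specHom {X : Scheme.{u}} {U : X.affineOpens} {A B : Type u}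
    [CommRing A] [CommRing B] [Algebra Γ(X, U) A]
    [Algebra Γ(X, U) B] (ψ : A →ₐ[Γ(X, U)] B) :
    Spec.map (CommRingCat.ofHom ψ.toRingHom) ≫ specHom U A = specHom U B := by
  rw [specHom, ← Category.assoc, ← Spec.map_comp, ← CommRingCat.ofHom_comp]
  congr 3
  exact ψ.comp_algebraMap

variable {k : Type u} [Field k] {X : Scheme.{u}} [X.Over (Spec (.of k))] [IsIntegral X]
  {n : ℕ} (G : GrassmannianBundle k X n)
  {U : X.affineOpens} [Nonempty U.1] {J : Ideal Γ(X, U)} {S : Set Γ(X, U)}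

theorem IsPluckerGenerators.exists_hom_affineBlowup (hS : IsPluckerGenerators k n J S)
    {p : Γ(X, U)} (hp : p ∈ S) (hp0 : p ≠ 0) :
    ∃ g : Spec (.of (affineBlowup J p)) ⟶ G.space, g ≫ G.π = specHom U (affineBlowup J p) := by
  have := isDomain_affineBlowup (I := J) hp0
  refine G.exists_hom U _ (hS.nonempty_grassmannian p hp _ ?_ fun x hx => dvd_affineBlowup hx)
  refine mem_nonZeroDivisors_of_ne_zero fun h => hp0 ?_
  exact algebraMap_affineBlowup_injective (I := J) hp0 (h.trans (map_zero _).symm)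

/-- The Nash blow-up has points in the algebras in which one of the generators becomes a
nonzerodivisor which generates the ideal. -/
theorem IsPluckerGenerators.exists_lift [CharZero k] [LocallyOfFiniteType (X ↘ Spec (.of k))]
    (hS : IsPluckerGenerators k n J S)
    {p : Γ(X, U)} (hp : p ∈ S) {A : Type u} [CommRing A] [Nontrivial A] [Algebra Γ(X, U) A]
    (hA : algebraMap Γ(X, U) A p ∈ nonZeroDivisors A)
    (hd : ∀ x ∈ J, algebraMap Γ(X, U) A p ∣ algebraMap Γ(X, U) A x) :
    ∃ g : Spec (.of A) ⟶ nashBlowup G, g ≫ nashBlowupMap G = specHom U A := by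
  have hp0 : p ≠ 0 := by
    rintro rfl
    exact nonZeroDivisors.ne_zero hA (map_zero _)
  have := isDomain_affineBlowup (I := J) hp0
  obtain ⟨g, hg⟩ := hS.exists_hom_affineBlowup G hp hp0
  obtain ⟨g', hg'⟩ := exists_lift_nashBlowup G U _ (algebraMap_affineBlowup_injective hp0) hg
  obtain ⟨φ⟩ := exists_affineBlowup_algHom hA hd
  refine ⟨Spec.map (CommRingCat.ofHom φ.toRingHom) ≫ g', ?_⟩
  have h : g' ≫ nashBlowupMap G = specHom U (affineBlowup J p) :=
    (Category.assoc _ _ _).symm.trans ((congrArg (· ≫ G.π) hg').trans hg)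
  exact (Category.assoc _ _ _).trans
    ((congrArg (Spec.map (CommRingCat.ofHom φ.toRingHom) ≫ ·) h).trans (specMap_comp_specHom φ))

variable [Module.Finite X.functionField Ω[X.functionField⁄k]]

/-- Points of the Grassmannian bundle over domains are determined by their pullback to an algebra
in which the ideal becomes invertible. -/
theorem IsPluckerGenerators.comp_eq_comp (hS : IsPluckerGenerators k n J S)
    (hn : Module.finrank X.functionField Ω[X.functionField⁄k] = n)
    {p : Γ(X, U)} (hp : p ∈ S) (hp0 : p ≠ 0) {A B₁ B₂ : Type u} [CommRing A] [CommRing B₁]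
    [CommRing B₂] [IsDomain B₁] [IsDomain B₂] [Algebra Γ(X, U) A] [Algebra Γ(X, U) B₁]
    [Algebra Γ(X, U) B₂] (hB₁ : Function.Injective (algebraMap Γ(X, U) B₁))
    (hB₂ : Function.Injective (algebraMap Γ(X, U) B₂))
    (hd₁ : ∀ x ∈ J, algebraMap Γ(X, U) B₁ p ∣ algebraMap Γ(X, U) B₁ x)
    (hd₂ : ∀ x ∈ J, algebraMap Γ(X, U) B₂ p ∣ algebraMap Γ(X, U) B₂ x)
    (hA : algebraMap Γ(X, U) A p ∈ nonZeroDivisors A)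
    (ψ₁ : B₁ →ₐ[Γ(X, U)] A) (ψ₂ : B₂ →ₐ[Γ(X, U)] A)
    {g₁ : Spec (.of B₁) ⟶ G.space} {g₂ : Spec (.of B₂) ⟶ G.space}
    (hg₁ : g₁ ≫ G.π = specHom U B₁) (hg₂ : g₂ ≫ G.π = specHom U B₂) :
    Spec.map (CommRingCat.ofHom ψ₁.toRingHom) ≫ g₁ =
      Spec.map (CommRingCat.ofHom ψ₂.toRingHom) ≫ g₂ := by
  obtain ⟨g, hg⟩ := hS.exists_hom_affineBlowup G hp hp0
  -- Each point over `B` is induced from the single chart `Spec R[J/p]`, since `R[J/p]` maps to `B`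
  -- and `B` admits at most one quotient.
  have key : ∀ (B : Type u) [CommRing B] [IsDomain B] [Algebra Γ(X, U) B]
      (_ : Function.Injective (algebraMap Γ(X, U) B))
      (_ : ∀ x ∈ J, algebraMap Γ(X, U) B p ∣ algebraMap Γ(X, U) B x)
      (b : Spec (.of B) ⟶ G.space) (_ : b ≫ G.π = specHom U B),
      ∃ φ : affineBlowup J p →ₐ[Γ(X, U)] B, b = Spec.map (CommRingCat.ofHom φ.toRingHom) ≫ g := by
    intro B _ _ _ hB hd b hb
    have hpB : algebraMap Γ(X, U) B p ∈ nonZeroDivisors B :=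
      mem_nonZeroDivisors_of_ne_zero fun h => hp0 (hB (h.trans (map_zero _).symm))
    obtain ⟨φ⟩ := exists_affineBlowup_algHom hpB hd
    refine ⟨φ, G.hom_ext_of_subsingleton U B
      (grassmannian_subsingleton_of_injective k hn U B hB) hb ?_⟩
    rw [Category.assoc, hg]
    exact specMap_comp_specHom φ
  obtain ⟨φ₁, rfl⟩ := key B₁ hB₁ hd₁ g₁ hg₁
  obtain ⟨φ₂, rfl⟩ := key B₂ hB₂ hd₂ g₂ hg₂
  rw [← Category.assoc, ← Category.assoc, ← Spec.map_comp, ← Spec.map_comp,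
    ← CommRingCat.ofHom_comp, ← CommRingCat.ofHom_comp]
  congr 3
  exact congrArg AlgHom.toRingHom (affineBlowup_algHom_ext hA (ψ₁.comp φ₁) (ψ₂.comp φ₂))

end Lifts

/-! ### The universal property of the Nash blow-up -/

section Invertible

theorem IsInvertibleIdeal.exists_le {T : Scheme.{u}} {J : T.IdealSheafData}
    (hJ : IsInvertibleIdeal J) {W : T.Opens} {t : T} (ht : t ∈ W) :
    ∃ V : T.affineOpens, t ∈ V.1 ∧ V.1 ≤ W ∧
      ∃ a ∈ nonZeroDivisors Γ(T, V), J.ideal V = Ideal.span {a} := by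
  obtain ⟨V, htV, a, ha, hJV⟩ := hJ t
  obtain ⟨V', hV', htV', hle⟩ := exists_isAffineOpen_le (show t ∈ W ⊓ V.1 from ⟨ht, htV⟩)
  have h1 : V' ≤ (𝟙 T) ⁻¹ᵁ V.1 := fun x hx => (hle hx).2
  refine ⟨⟨V', hV'⟩, htV', fun x hx => (hle hx).1, (𝟙 T : T ⟶ T).appLE V.1 V' h1 a, ?_, ?_⟩
  · exact map_mem_nonZeroDivisors_of_flat _ ((𝟙 T : T ⟶ T).flat_appLE V.2 hV' h1) ha
  · have h2 := ideal_comap (𝟙 T) J V ⟨V', hV'⟩ h1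
    rw [Scheme.IdealSheafData.comap_id] at h2
    rw [h2, hJV, Ideal.map_span, Set.image_singleton]

theorem germ_mem_nonZeroDivisors {T : Scheme.{u}} {V : T.Opens} (hV : IsAffineOpen V) {t : T}
    (ht : t ∈ V) {a : Γ(T, V)} (ha : a ∈ nonZeroDivisors Γ(T, V)) :
    T.presheaf.germ V t ht a ∈ nonZeroDivisors (T.presheaf.stalk t) := by
  let : Algebra Γ(T, V) (T.presheaf.stalk t) := (T.presheaf.germ V t ht).hom.toAlgebra
  have := hV.isLocalization_stalk ⟨t, ht⟩
  have : Module.Flat Γ(T, V) (T.presheaf.stalk t) :=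
    IsLocalization.flat _ (hV.primeIdealOf ⟨t, ht⟩).asIdeal.primeCompl
  exact map_mem_nonZeroDivisors_of_flat (algebraMap Γ(T, V) (T.presheaf.stalk t))
    (RingHom.flat_algebraMap_iff.2 this) ha

/-- A morphism from the spectrum of a local ring whose closed point lies in an affine open `U`
is given by a ring homomorphism from the sections over `U`. -/
theorem exists_specMap_comp_fromSpec {X : Scheme.{u}} (U : X.affineOpens) (A : CommRingCat.{u})
    [IsLocalRing A] (m : Spec A ⟶ X) (h : m (IsLocalRing.closedPoint A) ∈ U.1) :
    ∃ φ : Γ(X, U) →+* A, Spec.map (CommRingCat.ofHom φ) ≫ U.2.fromSpec = m := by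
  have := U.2.isOpenImmersion_fromSpec
  have hrange : Set.range m ⊆ Set.range U.2.fromSpec := by
    rw [U.2.range_fromSpec]
    rintro _ ⟨y, rfl⟩
    exact ((IsLocalRing.specializes_closedPoint y).map m.continuous).mem_open U.1.2 h
  refine ⟨(Spec.preimage (IsOpenImmersion.lift U.2.fromSpec m hrange)).hom, ?_⟩
  exact (congrArg (· ≫ U.2.fromSpec) (Spec.map_preimage _)).trans
    (IsOpenImmersion.lift_fac U.2.fromSpec m hrange)

theorem ringHom_ext_of_specMap_comp_fromSpec {X : Scheme.{u}} (U : X.affineOpens)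
    {A : CommRingCat.{u}} {φ ψ : Γ(X, U) →+* A}
    (h : Spec.map (CommRingCat.ofHom φ) ≫ U.2.fromSpec =
      Spec.map (CommRingCat.ofHom ψ) ≫ U.2.fromSpec) : φ = ψ := by
  have := U.2.isOpenImmersion_fromSpec
  exact congrArg CommRingCat.Hom.hom (Spec.map_injective ((cancel_mono U.2.fromSpec).1 h))

theorem eq_appLE_germ_of_specMap_comp_fromSpec {X T : Scheme.{u}} {f : T ⟶ X} (U : X.affineOpens)
    (V : T.affineOpens) (hVU : V.1 ≤ f ⁻¹ᵁ U.1) {t : T} (htV : t ∈ V.1)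
    {φ : Γ(X, U) →+* T.presheaf.stalk t}
    (hφ : Spec.map (CommRingCat.ofHom φ) ≫ U.2.fromSpec = T.fromSpecStalk t ≫ f) :
    φ = (f.appLE U.1 V.1 hVU ≫ T.presheaf.germ V.1 t htV).hom := by
  refine ringHom_ext_of_specMap_comp_fromSpec U (hφ.trans ?_)
  have h2 : Spec.map (f.appLE U.1 V.1 hVU) ≫ (isAffineOpen_coe U).fromSpec =
    (isAffineOpen_coe V).fromSpec ≫ f :=
    (isAffineOpen_coe U).SpecMap_appLE_fromSpec f (isAffineOpen_coe V) hVU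
  rw [← (isAffineOpen_coe V).fromSpecStalk_eq_fromSpecStalk htV, IsAffineOpen.fromSpecStalk,
    Category.assoc, ← h2, ← Category.assoc, ← Spec.map_comp]
  rfl

theorem IsInvertibleIdeal.exists_map_eq_span_stalk {X T : Scheme.{u}} {I : X.IdealSheafData}
    {f : T ⟶ X} (hf : IsInvertibleIdeal (I.comap f)) (U : X.affineOpens) (t : T)
    (φ : Γ(X, U) →+* T.presheaf.stalk t)
    (hφ : Spec.map (CommRingCat.ofHom φ) ≫ U.2.fromSpec = T.fromSpecStalk t ≫ f) (ht : f t ∈ U.1) :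
    ∃ a ∈ nonZeroDivisors (T.presheaf.stalk t), (I.ideal U).map φ = Ideal.span {a} := by
  obtain ⟨V, htV, hVU, a, ha, hV⟩ := hf.exists_le (show t ∈ f ⁻¹ᵁ U.1 from ht)
  have h1 := eq_appLE_germ_of_specMap_comp_fromSpec U V hVU htV hφ
  refine ⟨T.presheaf.germ V.1 t htV a, germ_mem_nonZeroDivisors V.2 htV ha, ?_⟩
  rw [ideal_comap f I U V hVU] at hV
  rw [h1, CommRingCat.hom_comp, ← Ideal.map_map, hV, Ideal.map_span, Set.image_singleton]

end Invertible

/-! ### Principal stalks on the Nash blow-up and uniqueness of lifts -/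

section Universal

variable {k : Type u} [Field k] [CharZero k] {X : Scheme.{u}} [X.Over (Spec (.of k))] [IsIntegral X]
  [LocallyOfFiniteType (X ↘ Spec (.of k))] {n : ℕ} (G : GrassmannianBundle k X n)
  [Module.Finite X.functionField Ω[X.functionField⁄k]]

/-- The local ring at `q` is a local domain containing the sections over `U`, because the blow-up is
integral and dominates `X`. The inclusion in the Grassmannian bundle gives a quotient over it, whose
basis selects `p`. -/
theorem IsPluckerGenerators.exists_stalk_generator {U : X.affineOpens} [Nonempty U.1]
    {J : Ideal Γ(X, U)} {S : Set Γ(X, U)} (hS : IsPluckerGenerators k n J S)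
    (hn : Module.finrank X.functionField Ω[X.functionField⁄k] = n)
    (q : nashBlowup G) (φ : Γ(X, U) →+* (nashBlowup G).presheaf.stalk q)
    (hφ : Spec.map (CommRingCat.ofHom φ) ≫ U.2.fromSpec =
      (nashBlowup G).fromSpecStalk q ≫ nashBlowupMap G) :
    IsDomain ((nashBlowup G).presheaf.stalk q) ∧ Function.Injective φ ∧
      ∃ p ∈ S, p ≠ 0 ∧ ∀ x ∈ J, φ p ∣ φ x := by
  obtain ⟨hint, hgen⟩ := isIntegral_nashBlowup G hn
  have hdom : IsDomain ((nashBlowup G).presheaf.stalk q) := inferInstance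
  let : Algebra Γ(X, U) ((nashBlowup G).presheaf.stalk q) := φ.toAlgebra
  have hinj : Function.Injective φ := by
    obtain ⟨z, hz⟩ : genericPoint (nashBlowup G) ∈ Set.range ((nashBlowup G).fromSpecStalk q) := by
      rw [Scheme.range_fromSpecStalk]
      exact genericPoint_specializes q
    refine algebraMap_injective_of_apply_eq_genericPoint U ((nashBlowup G).presheaf.stalk q) z ?_
    rw [← hgen, ← hz]
    exact congrArg (fun g : Spec ((nashBlowup G).presheaf.stalk q) ⟶ X => g z) hφ
  refine ⟨hdom, hinj, hS.exists_generator ((nashBlowup G).presheaf.stalk q) hinj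
    (G.points U ((nashBlowup G).presheaf.stalk q) ⟨(nashBlowup G).fromSpecStalk q ≫
      (Scheme.IdealSheafData.vanishingIdeal G.closureRegular).subschemeι, ?_⟩)⟩
  exact (Category.assoc _ _ _).trans hφ.symm

/-- On stalks both maps come from local domains on the Nash blow-up. Once a single generator `p`
serves in both, `comp_eq_comp` identifies the compositions into the Grassmannian bundle, where the
closed immersion is a monomorphism. -/
theorem hom_ext_of_isInvertibleIdeal
    (hn : Module.finrank X.functionField Ω[X.functionField⁄k] = n) {I : X.IdealSheafData}
    (hI : ∀ x : X, ∃ (U : X.affineOpens) (_ : Nonempty U.1), x ∈ U.1 ∧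
      ∃ S, IsPluckerGenerators k n (I.ideal U) S)
    {T : Scheme.{u}} {f : T ⟶ X} (hf : IsInvertibleIdeal (I.comap f)) {g₁ g₂ : T ⟶ nashBlowup G}
    (h₁ : g₁ ≫ nashBlowupMap G = f) (h₂ : g₂ ≫ nashBlowupMap G = f) : g₁ = g₂ := by
  let ι : nashBlowup G ⟶ G.space :=
    (Scheme.IdealSheafData.vanishingIdeal G.closureRegular).subschemeι
  have hι : IsClosedImmersion ι := inferInstanceAs (IsClosedImmersion
    (Scheme.IdealSheafData.vanishingIdeal G.closureRegular).subschemeι)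
  refine ext_of_fromSpecStalk fun t => ?_
  obtain ⟨U, hne, htU, S, hS⟩ := hI (f t)
  have hpt : ∀ (g : T ⟶ nashBlowup G) (_ : g ≫ nashBlowupMap G = f),
      ∃ (φ : Γ(X, U) →+* (nashBlowup G).presheaf.stalk (g t)),
        Spec.map (CommRingCat.ofHom φ) ≫ U.2.fromSpec =
          (nashBlowup G).fromSpecStalk (g t) ≫ nashBlowupMap G ∧
        Spec.map (CommRingCat.ofHom ((g.stalkMap t).hom.comp φ)) ≫ U.2.fromSpec =
          T.fromSpecStalk t ≫ f := by
    intro g hg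
    obtain ⟨φ, hφ⟩ := exists_specMap_comp_fromSpec U ((nashBlowup G).presheaf.stalk (g t))
      ((nashBlowup G).fromSpecStalk (g t) ≫ nashBlowupMap G) (by
        change nashBlowupMap G ((nashBlowup G).fromSpecStalk (g t) _) ∈ _
        rw [Scheme.fromSpecStalk_closedPoint]
        rw [← hg] at htU
        exact htU)
    refine ⟨φ, hφ, ?_⟩
    rw [← hg, ← Scheme.SpecMap_stalkMap_fromSpecStalk_assoc, ← hφ, ← Category.assoc,
      ← Spec.map_comp]
    rfl
  obtain ⟨φ₁, hφ₁, hψ₁⟩ := hpt g₁ h₁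
  obtain ⟨φ₂, hφ₂, hψ₂⟩ := hpt g₂ h₂
  obtain ⟨hdom₁, hinj₁, p, hp, hp0, hd₁⟩ := hS.exists_stalk_generator G hn _ φ₁ hφ₁
  obtain ⟨hdom₂, hinj₂, p', hp', -, hd'⟩ := hS.exists_stalk_generator G hn _ φ₂ hφ₂
  have hψ : (g₁.stalkMap t).hom.comp φ₁ = (g₂.stalkMap t).hom.comp φ₂ :=
    ringHom_ext_of_specMap_comp_fromSpec U (hψ₁.trans hψ₂.symm)
  obtain ⟨a, ha, hJ⟩ := hf.exists_map_eq_span_stalk U t _ hψ₁ htU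
  have hdA : ∀ x ∈ I.ideal U, (g₁.stalkMap t).hom (φ₁ p) ∣ (g₁.stalkMap t).hom (φ₁ x) :=
    fun x hx => map_dvd _ (hd₁ x hx)
  -- The image of `p` divides the nonzerodivisor `a` that generates the pulled back ideal.
  have hpA : (g₁.stalkMap t).hom (φ₁ p) ∈ nonZeroDivisors (T.presheaf.stalk t) := by
    have h3 : Ideal.span {a} ≤ Ideal.span {(g₁.stalkMap t).hom (φ₁ p)} := by
      rw [← hJ, Ideal.map_le_iff_le_comap]
      exact fun x hx => Ideal.mem_span_singleton.2 (hdA x hx)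
    obtain ⟨b, hb⟩ := Ideal.span_singleton_le_span_singleton.1 h3
    rw [hb] at ha
    exact (mul_mem_nonZeroDivisors.1 ha).1
  have hpS : ∀ x ∈ S, x ∈ I.ideal U := fun x hx => hS.span_eq ▸ Ideal.subset_span hx
  -- The second stalk may select another generator `p'`, with `p = p' c`. In the stalk of `T` the
  -- element `p` also divides `p'`, so `c` becomes a unit there; as stalk maps are local, `c` was
  -- already a unit.
  have hd₂ : ∀ x ∈ I.ideal U, φ₂ p ∣ φ₂ x := by
    obtain ⟨c, hc⟩ := hd' p (hpS p hp)
    obtain ⟨d, hd⟩ := hdA p' (hpS p' hp')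
    have hψ' : ∀ x, (g₂.stalkMap t).hom (φ₂ x) = (g₁.stalkMap t).hom (φ₁ x) :=
      fun x => (RingHom.congr_fun hψ x).symm
    have hu : (g₂.stalkMap t).hom c * d = 1 := by
      have h4 := congrArg (g₂.stalkMap t).hom hc
      rw [map_mul, hψ', hψ', hd] at h4
      have h5 : (g₁.stalkMap t).hom (φ₁ p) * ((g₂.stalkMap t).hom c * d) =
          (g₁.stalkMap t).hom (φ₁ p) * 1 := by
        rw [mul_one]; nth_rewrite 2 [h4]; ring
      exact (mul_cancel_left_mem_nonZeroDivisors hpA).1 h5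
    have hcu : IsUnit c := isUnit_of_map_unit (g₂.stalkMap t).hom c (IsUnit.of_mul_eq_one _ hu)
    intro x hx
    refine dvd_trans ?_ (hd' x hx)
    rw [hc]
    exact (hcu.dvd_mul_right (a := _)).1 dvd_rfl
  rw [← cancel_mono ι, Category.assoc, Category.assoc]
  let : Algebra Γ(X, U) ((nashBlowup G).presheaf.stalk (g₁ t)) := φ₁.toAlgebra
  let : Algebra Γ(X, U) ((nashBlowup G).presheaf.stalk (g₂ t)) := φ₂.toAlgebra
  let : Algebra Γ(X, U) (T.presheaf.stalk t) := ((g₁.stalkMap t).hom.comp φ₁).toAlgebra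
  let ψ₁ : (nashBlowup G).presheaf.stalk (g₁ t) →ₐ[Γ(X, U)] T.presheaf.stalk t :=
    { (g₁.stalkMap t).hom with commutes' := fun _ => rfl }
  let ψ₂ : (nashBlowup G).presheaf.stalk (g₂ t) →ₐ[Γ(X, U)] T.presheaf.stalk t :=
    { (g₂.stalkMap t).hom with commutes' := fun x => (RingHom.congr_fun hψ x).symm }
  have key := hS.comp_eq_comp G hn hp hp0 hinj₁ hinj₂ hd₁ hd₂ hpA ψ₁ ψ₂
    (g₁ := (nashBlowup G).fromSpecStalk (g₁ t) ≫ ι) (g₂ := (nashBlowup G).fromSpecStalk (g₂ t) ≫ ι)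
    ((Category.assoc _ _ _).trans hφ₁.symm) ((Category.assoc _ _ _).trans hφ₂.symm)
  rw [← Scheme.SpecMap_stalkMap_fromSpecStalk_assoc, ← Scheme.SpecMap_stalkMap_fromSpecStalk_assoc]
  exact key

end Universal

/-! ### The Nash blow-up is a blow-up -/

section IsBlowUp

variable {k : Type u} [Field k] {X : Scheme.{u}} [X.Over (Spec (.of k))] [IsIntegral X]

theorem exists_lift_of_isInvertibleIdeal [CharZero k] [LocallyOfFiniteType (X ↘ Spec (.of k))]
    {n : ℕ} (G : GrassmannianBundle k X n) {I : X.IdealSheafData}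
    {U : X.affineOpens} [Nonempty U.1] {S : Set Γ(X, U)}
    (hS : IsPluckerGenerators k n (I.ideal U) S)
    {T : Scheme.{u}} (f : T ⟶ X) (hf : IsInvertibleIdeal (I.comap f)) (t : T) (ht : f t ∈ U.1) :
    ∃ (V : T.affineOpens) (g : Spec Γ(T, V) ⟶ nashBlowup G),
      t ∈ V.1 ∧ g ≫ nashBlowupMap G = (isAffineOpen_coe V).fromSpec ≫ f := by
  obtain ⟨V, htV, hVU, a, ha, hV⟩ := hf.exists_le (show t ∈ f ⁻¹ᵁ U.1 from ht)
  rw [ideal_comap f I U V hVU, ← hS.span_eq, Ideal.map_span] at hV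
  have hmul : ∀ s ∈ S, ∃ d, (f.appLE U.1 V.1 hVU).hom s = a * d := by
    intro s hs
    exact Ideal.mem_span_singleton.1 (hV ▸ Ideal.subset_span ⟨s, hs, rfl⟩)
  -- Nakayama's argument: if every ratio `d` vanished at `t`, then `(a) ⊆ (a) P`, and cancelling `a`
  -- would put `1` in the prime `P` of `t`. Where `d` is invertible, `s` generates the pulled back
  -- ideal.
  have hex : ∃ s ∈ S, ∃ d, (f.appLE U.1 V.1 hVU).hom s = a * d ∧ t ∈ T.basicOpen d := by
    by_contra! hcon
    let P : Ideal Γ(T, V) := (V.2.primeIdealOf ⟨t, htV⟩).asIdeal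
    have hP : ∀ d, t ∉ T.basicOpen d → d ∈ P := by
      intro d hd
      by_contra hdP
      refine hd ?_
      rw [Scheme.mem_basicOpen (hx := htV)]
      let : Algebra Γ(T, V) (T.presheaf.stalk t) := (T.presheaf.germ V.1 t htV).hom.toAlgebra
      have := V.2.isLocalization_stalk ⟨t, htV⟩
      exact IsLocalization.map_units (T.presheaf.stalk t) (⟨d, hdP⟩ : P.primeCompl)
    have hle : Ideal.span {a} ≤ Ideal.span {a} * P := by
      rw [← hV, Ideal.span_le]
      rintro _ ⟨s, hs, rfl⟩
      obtain ⟨d, hd⟩ := hmul s hs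
      rw [hd, hV]
      exact Ideal.mul_mem_mul (Ideal.mem_span_singleton_self a) (hP d (hcon s hs d hd))
    obtain ⟨b, hb, hab⟩ := Ideal.mem_span_singleton_mul.1 (hle (Ideal.mem_span_singleton_self a))
    have hb1 : b = 1 := (mul_cancel_left_mem_nonZeroDivisors ha).1 (hab.trans (mul_one a).symm)
    exact (V.2.primeIdealOf ⟨t, htV⟩).2.ne_top ((Ideal.eq_top_iff_one _).2 (hb1 ▸ hb))
  obtain ⟨s, hs, d, hd, htd⟩ := hex
  let V' : T.affineOpens := ⟨T.basicOpen d, V.2.basicOpen d⟩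
  have hle : V'.1 ≤ V.1 := T.basicOpen_le d
  have hVU' : V'.1 ≤ f ⁻¹ᵁ U.1 := hle.trans hVU
  let : Algebra Γ(X, U) Γ(T, V') := (f.appLE U.1 V'.1 hVU').hom.toAlgebra
  have hres : ∀ x, algebraMap Γ(X, U) Γ(T, V') x =
      T.presheaf.map (homOfLE hle).op ((f.appLE U.1 V.1 hVU).hom x) := by
    intro x
    have := Scheme.Hom.appLE_map f hVU (homOfLE hle).op
    exact (ConcreteCategory.congr_hom this x).symm
  have hdu : IsUnit (T.presheaf.map (homOfLE hle).op d) := RingedSpace.isUnit_res_basicOpen _ d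
  have hnt : Nontrivial Γ(T, V') := by
    have : Nonempty V'.1 := ⟨⟨t, htd⟩⟩
    infer_instance
  have hflat : T.presheaf.map (homOfLE hle).op a ∈ nonZeroDivisors Γ(T, V') := by
    have hle' : V'.1 ≤ (𝟙 T) ⁻¹ᵁ V.1 := hle
    have h1 := map_mem_nonZeroDivisors_of_flat _ ((𝟙 T : T ⟶ T).flat_appLE V.2 V'.2 hle') ha
    rw [Scheme.Hom.appLE, Scheme.Hom.id_app] at h1
    exact h1
  have hsA : algebraMap Γ(X, U) Γ(T, V') s ∈ nonZeroDivisors Γ(T, V') := by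
    rw [hres, hd, map_mul]
    exact mul_mem_nonZeroDivisors.2 ⟨hflat, hdu.mem_nonZeroDivisors⟩
  have hdvd : ∀ x ∈ I.ideal U, algebraMap Γ(X, U) Γ(T, V') s ∣ algebraMap Γ(X, U) Γ(T, V') x := by
    intro x hx
    rw [← hS.span_eq] at hx
    refine dvd_of_mem_span (fun y hy => ?_) hx
    obtain ⟨e, he⟩ := hmul y hy
    rw [hres, hres, hd, he, map_mul, map_mul, hdu.mul_right_dvd]
    exact dvd_mul_right _ _
  obtain ⟨g, hg⟩ := hS.exists_lift G hs hsA hdvd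
  refine ⟨V', g, htd, hg.trans ?_⟩
  exact (isAffineOpen_coe U).SpecMap_appLE_fromSpec f (isAffineOpen_coe V') hVU'

/-- Spreading out: a finitely generated ideal that is generated by `a` in the stalk is generated by
`a` on a basic open, one denominator `s` serving all the generators. -/
theorem exists_ideal_eq_span_of_germ_dvd {Y : Scheme.{u}} [IsIntegral Y] {J : Y.IdealSheafData}
    {W : Y.affineOpens} {q : Y} (hq : q ∈ W.1) (hfg : (J.ideal W).FG) {a : Γ(Y, W)}
    (ha : a ∈ J.ideal W) (ha0 : a ≠ 0)
    (hdvd : ∀ x ∈ J.ideal W, Y.presheaf.germ W.1 q hq a ∣ Y.presheaf.germ W.1 q hq x) :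
    ∃ V : Y.affineOpens, q ∈ V.1 ∧ ∃ b ∈ nonZeroDivisors Γ(Y, V), J.ideal V = Ideal.span {b} := by
  classical
  let : Algebra Γ(Y, W) (Y.presheaf.stalk q) := (Y.presheaf.germ W.1 q hq).hom.toAlgebra
  have := W.2.isLocalization_stalk ⟨q, hq⟩
  have hinj : Function.Injective (algebraMap Γ(Y, W) (Y.presheaf.stalk q)) :=
    germ_injective_of_isIntegral _ _ hq
  obtain ⟨S, hS⟩ := hfg
  have hSJ : ∀ x ∈ S, x ∈ J.ideal W := fun x hx => hS ▸ Ideal.subset_span hx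
  choose! e he using hdvd
  obtain ⟨s, hs⟩ := IsLocalization.exist_integer_multiples_of_finset
    (W.2.primeIdealOf ⟨q, hq⟩).asIdeal.primeCompl (S.image e)
  have hmul : ∀ x ∈ J.ideal W, a ∣ s.1 * x := by
    have hle : J.ideal W ≤ Submodule.comap (LinearMap.mulLeft Γ(Y, W) s.1) (Ideal.span {a}) := by
      rw [← hS]
      refine Submodule.span_le.2 fun x hx => ?_
      obtain ⟨c, hc⟩ := hs (e x) (Finset.mem_image_of_mem e hx)
      refine Ideal.mem_span_singleton.2 ⟨c, hinj ?_⟩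
      have hx' : algebraMap Γ(Y, W) (Y.presheaf.stalk q) x =
        algebraMap Γ(Y, W) (Y.presheaf.stalk q) a * e x := he x (hSJ x hx)
      rw [LinearMap.mulLeft_apply, map_mul, map_mul, hc, hx', Algebra.smul_def]
      ring
    exact fun x hx => Ideal.mem_span_singleton.1 (hle hx)
  let V : Y.affineOpens := ⟨Y.basicOpen s.1, W.2.basicOpen s.1⟩
  have hVW : V.1 ≤ W.1 := Y.basicOpen_le s.1
  have hqV : q ∈ V.1 := (Scheme.mem_basicOpen _ _ _ hq).2
    (IsLocalization.map_units (Y.presheaf.stalk q) s)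
  have hne : Nonempty V.1 := ⟨⟨q, hqV⟩⟩
  have hsu : IsUnit (Y.presheaf.map (homOfLE hVW).op s.1) := RingedSpace.isUnit_res_basicOpen _ s.1
  have hJV : J.ideal V = (J.ideal W).map (Y.presheaf.map (homOfLE hVW).op).hom :=
    (J.map_ideal hVW).symm
  refine ⟨V, hqV, Y.presheaf.map (homOfLE hVW).op a, ?_, ?_⟩
  · refine mem_nonZeroDivisors_of_ne_zero fun h => ha0 ?_
    exact map_injective_of_isIntegral Y (homOfLE hVW) (h.trans (map_zero _).symm)
  · rw [hJV]
    refine le_antisymm (Ideal.map_le_iff_le_comap.2 fun x hx => ?_) ?_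
    · have h1 := map_dvd (Y.presheaf.map (homOfLE hVW).op).hom (hmul x hx)
      rw [map_mul] at h1
      exact Ideal.mem_span_singleton.2 ((hsu.dvd_mul_left).1 h1)
    · rw [Ideal.span_singleton_le_iff_mem]
      exact Ideal.mem_map_of_mem _ ha

variable [CharZero k] [LocallyOfFiniteType (X ↘ Spec (.of k))] {n : ℕ}
  (G : GrassmannianBundle k X n) [Module.Finite X.functionField Ω[X.functionField⁄k]]

theorem isInvertibleIdeal_comap_nashBlowupMap
    (hn : Module.finrank X.functionField Ω[X.functionField⁄k] = n) {I : X.IdealSheafData}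
    (hI : ∀ x : X, ∃ (U : X.affineOpens) (_ : Nonempty U.1), x ∈ U.1 ∧
      ∃ S, IsPluckerGenerators k n (I.ideal U) S) :
    IsInvertibleIdeal (I.comap (nashBlowupMap G)) := by
  intro q
  obtain ⟨hint, -⟩ := isIntegral_nashBlowup G hn
  obtain ⟨U, hne, hqU, S, hS⟩ := hI (nashBlowupMap G q)
  have hnoeth : IsNoetherianRing Γ(X, U) := by
    have : IsLocallyNoetherian X := LocallyOfFiniteType.isLocallyNoetherian (X ↘ Spec (.of k))
    exact IsLocallyNoetherian.component_noetherian U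
  obtain ⟨W, hW, hqW, hWU⟩ := exists_isAffineOpen_le (show q ∈ nashBlowupMap G ⁻¹ᵁ U.1 from hqU)
  obtain ⟨φ, hφ⟩ := exists_specMap_comp_fromSpec U ((nashBlowup G).presheaf.stalk q)
    ((nashBlowup G).fromSpecStalk q ≫ nashBlowupMap G) (by
      change nashBlowupMap G ((nashBlowup G).fromSpecStalk q _) ∈ _
      rwa [Scheme.fromSpecStalk_closedPoint])
  obtain ⟨-, hinj, p, hp, hp0, hdvd⟩ := hS.exists_stalk_generator G hn q φ hφ
  have hφ' := eq_appLE_germ_of_specMap_comp_fromSpec U ⟨W, hW⟩ hWU hqW hφ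
  have hideal := ideal_comap (nashBlowupMap G) I U ⟨W, hW⟩ hWU
  refine exists_ideal_eq_span_of_germ_dvd (W := ⟨W, hW⟩) hqW ?_
    (a := (nashBlowupMap G).appLE U.1 W hWU p) ?_ ?_ ?_
  · rw [hideal]
    exact Ideal.FG.map (IsNoetherian.noetherian _) _
  · rw [hideal]
    exact Ideal.mem_map_of_mem _ (hS.span_eq ▸ Ideal.subset_span hp)
  · intro h
    refine hp0 (hinj ?_)
    rw [map_zero, hφ', CommRingCat.hom_comp, RingHom.comp_apply]
    exact (congrArg _ h).trans (map_zero _)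
  · rw [hideal]
    have hle : (I.ideal U).map ((nashBlowupMap G).appLE U.1 W hWU).hom ≤
        (Ideal.span {φ p}).comap ((nashBlowup G).presheaf.germ W q hqW).hom := by
      rw [Ideal.map_le_iff_le_comap]
      intro x hx
      refine Ideal.mem_span_singleton.2 ((hdvd x hx).trans (dvd_of_eq ?_))
      rw [hφ']
      rfl
    intro x hx
    have h1 := Ideal.mem_span_singleton.1 (hle hx)
    rwa [hφ'] at h1

theorem isBlowUp_nashBlowupMap
    (hn : Module.finrank X.functionField Ω[X.functionField⁄k] = n) {I : X.IdealSheafData}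
    (hI : ∀ x : X, ∃ (U : X.affineOpens) (_ : Nonempty U.1), x ∈ U.1 ∧
      ∃ S, IsPluckerGenerators k n (I.ideal U) S) :
    IsBlowUp I (nashBlowupMap G) where
  invertible := isInvertibleIdeal_comap_nashBlowupMap G hn hI
  existsUnique_lift f hf := by
    refine existsUnique_of_local _ f (fun T' j _ g g' hg hg' => ?_) fun t => ?_
    · refine hom_ext_of_isInvertibleIdeal G hn hI (f := j ≫ f) ?_ hg hg'
      rw [Scheme.IdealSheafData.comap_comp]
      exact hf.comap_of_flat j
    · obtain ⟨U, hne, htU, S, hS⟩ := hI (f t)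
      exact exists_lift_of_isInvertibleIdeal G hS f hf t htU

end IsBlowUp

end NashBlowup

end

/-! ### The main theorem -/

open NashBlowup in
theorem propositionp {k : Type u} [Field k] [CharZero k]
    (X : Scheme.{u}) [X.Over (Spec (.of k))] [IsIntegral X]
    [IsSeparated (X ↘ Spec (.of k))] [LocallyOfFiniteType (X ↘ Spec (.of k))]
    [QuasiCompact (X ↘ Spec (.of k))]
    (hnormal : ∀ x : X, IsIntegrallyClosed (X.presheaf.stalk x))
    (n : ℕ) (hn : topologicalKrullDim X = n)
    (ω : ⋀[X.functionField]^n Ω[X.functionField⁄k]) (hω : ω ≠ 0)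
    (r : ℕ) (hr : 0 < r) (hcartier : IsCartier k (r • canonicalDivisor k n ω))
    (G : GrassmannianBundle k X n) :
    (∀ (U : X.affineOpens) [Nonempty U.1],
      (nashIdeal k n r ω).ideal U • divisorialSections k (r • canonicalDivisor k n ω) U.1 =
        formsImage k n r ω U.1) ∧
    IsBlowUp (nashIdeal k n r ω) (nashBlowupMap G) := by
  obtain ⟨hfin, hrank, δ, hδ0, hδ⟩ := exists_coordinate_functionField k hn ω hω
  refine ⟨fun U _ => nashIdeal_smul_divisorialSections hnormal hcartier hω hδ0 hδ U,
    isBlowUp_nashBlowupMap G hrank fun x => ?_⟩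
  obtain ⟨U, hne, hxU, hU⟩ := exists_isNashChart hnormal hcartier hω hδ0 hδ x
  exact ⟨U, hne, hxU, hU.exists_isPluckerGenerators hrank hδ0 hr⟩
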